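/- For $n\ge 1$ let $N=2^n$, and index the entries of a signal $s\in\mathbb{C}^N$ by $y\in\mathbb{Z}_2^n$. For an $n\times n$ matrix $P$ over $\mathbb{Z}_2$ that is Hankel (constant along reverse diagonals) and $\ell\in\mathbb{Z}_2^n$, the Hankel codeword $\varphi_{P,\ell}\in\mathbb{C}^N$ is $$\varphi_{P,\ell}(y)=\frac1{\sqrt N}\, i^{\,y^TPy+2\ell^Ty},$$ where the entries of $P,\ell,y$ are read as integers $0,1$ and the exponent is computed over $\mathbb{Z}$. Theorem. For every $c\in\mathbb{N}$ there are a randomized algorithm $A$ and a constant $C$, depending only on $c$, such that the following holds for all integers $n\ge1$ and all real $k\ge 1$. Given $n$, $k$ and chosen-sampling access to a signal $s\in\mathbb{C}^N$ (the algorithm may ask for the entry $s(y)$ at any position $y$ of its choice), $A$ always halts within $C\,(k\log_2 N)^C$ steps. If moreover $s\neq 0$, then with probability at least $1-N^{-c}$ over its coin tosses it outputs a list of labels $(P,\ell)$ of Hankel codewords that contains every $(P,\ell)$, $P$ Hankel, with $$|\langle s,\varphi_{P,\ell}\rangle|^2\ \ge\ \frac1k\,\|s\|^2 .$$ Here an algorithm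 is one fixed program for a randomized random access machine with fair coin tosses, arrays of natural numbers (addition, truncated subtraction and comparison at unit cost), arrays of complex numbers held exactly (field operations, conjugation and comparison of real parts at unit cost), and no numerical constants other than integers and $i$. A sample of $s$ takes one step once the $n$ bits of its position have been written in memory, and the output is written bit by bit. -/

import Mathlib

open scoped ENNReal

namespace HankelDecoding

/-! ### The Hankel code -/

/-- Signals of length `N = 2 ^ n`, i.e. vectors of `ℂ^N` with the Euclidean norm, whose positions
are the vectors `y ∈ ℤ₂ⁿ`. -/
abbrev Signal (n : ℕ) : Type := EuclideanSpace ℂ (Fin n → ZMod 2)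

/-- A Hankel matrix is constant along reverse diagonals. -/
def IsHankel {n : ℕ} (P : Matrix (Fin n) (Fin n) (ZMod 2)) : Prop :=
  ∀ i j i' j' : Fin n, (i : ℕ) + (j : ℕ) = (i' : ℕ) + (j' : ℕ) → P i j = P i' j'

/-- The codeword `φ_{P,ℓ}`, with `φ_{P,ℓ}(y) = N^{-1/2} i ^ (yᵀ P y + 2 ℓᵀ y)`, where the exponent is
computed over the integers, the entries of `P`, `ℓ` and `y` being read as the integers `0`, `1`. -/
noncomputable def codeword {n : ℕ} (P : Matrix (Fin n) (Fin n) (ZMod 2)) (l : Fin n → ZMod 2) :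
    Signal n :=
  WithLp.toLp 2 fun y =>
    ((1 / Real.sqrt (2 ^ n) : ℝ) : ℂ) *
      Complex.I ^ ((∑ i, ∑ j, (y i).val * (P i j).val * (y j).val) + 2 * ∑ i, (l i).val * (y i).val)

/-- A label `(P, ℓ)` of a codeword. -/
abbrev Label (n : ℕ) : Type := Matrix (Fin n) (Fin n) (ZMod 2) × (Fin n → ZMod 2)

/-- A label written as a string of `n ^ 2 + n` bits: the entries of `P` row by row, then `ℓ`. -/
def encode {n : ℕ} (x : Label n) : List (ZMod 2) :=
  (List.ofFn fun i => List.ofFn (x.1 i)).flatten ++ List.ofFn x.2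

/-! ### Randomized real-number machines with sampling access to a signal

The machine is a random access machine with finitely many arrays of natural numbers and finitely
many arrays of complex numbers (arrays are named by natural numbers that are fixed in the program),
a write-only output of bits, fair coins, and an oracle for the entries of the signal.
Natural numbers can only be added, subtracted and compared at unit cost, so the bit length of all
integers stays linear in the running time; complex numbers are handled exactly, with
unit-cost field operations, complex conjugation and comparison of real parts.  The only numerical
constants of a program are integers and the imaginary unit. -/

/-- Contents of the memory of the machine. -/
structure Memory where
  nat : ℕ → ℕ → ℕ
  num : ℕ → ℕ → ℂ
  out : List (ZMod 2)

/-- Expressions for natural numbers; `get a e` is the cell with index `e` of array `a`. -/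
inductive NatExpr where
  | lit (m : ℕ)
  | get (a : ℕ) (e : NatExpr)
  | add (e f : NatExpr)
  | sub (e f : NatExpr)

/-- Expressions for complex numbers; `get a e` is the cell with index `e` of array `a`. -/
inductive NumExpr where
  | ofNat (e : NatExpr)
  | imag
  | get (a : ℕ) (e : NatExpr)
  | add (x y : NumExpr)
  | sub (x y : NumExpr)
  | mul (x y : NumExpr)
  | div (x y : NumExpr)
  | conj (x : NumExpr)

/-- Tests: comparison of natural numbers, comparison of the real parts of complex numbers, and
Boolean combinations. -/
inductive Test where
  | natLE (e f : NatExpr)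
  | numLE (x y : NumExpr)
  | not (b : Test)
  | and (b c : Test)

/-- Programs. -/
inductive Program where
  | skip
  /-- Store the value of `e` in cell `i` of the array `a` of natural numbers. -/
  | setNat (a : ℕ) (i e : NatExpr)
  /-- Store the value of `x` in cell `i` of the array `a` of complex numbers. -/
  | setNum (a : ℕ) (i : NatExpr) (x : NumExpr)
  /-- Toss a fair coin and store the resulting bit in cell `i` of the array `a` of natural
  numbers. -/
  | toss (a : ℕ) (i : NatExpr)
  /-- Sample the signal at the position `y ∈ ℤ₂ⁿ` whose bits stand in the cells
  `p, p + 1, …, p + n - 1` of the array `b` of natural numbers, and store the sample in cell `i` of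
  the array `a` of complex numbers. -/
  | query (a : ℕ) (i : NatExpr) (b : ℕ) (p : NatExpr)
  /-- Append the parity of `e` to the output. -/
  | emit (e : NatExpr)
  | seq (p q : Program)
  | branch (b : Test) (p q : Program)
  | loop (b : Test) (p : Program)

noncomputable section

/-- Value of an expression for a natural number (subtraction is truncated). -/
def NatExpr.eval (σ : Memory) : NatExpr → ℕ
  | .lit m => m
  | .get a e => σ.nat a (e.eval σ)
  | .add e f => e.eval σ + f.eval σ
  | .sub e f => e.eval σ - f.eval σ

/-- Value of an expression for a complex number (division by zero gives zero). -/
def NumExpr.eval (σ : Memory) : NumExpr → ℂ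
  | .ofNat e => (e.eval σ : ℂ)
  | .imag => Complex.I
  | .get a e => σ.num a (e.eval σ)
  | .add x y => x.eval σ + y.eval σ
  | .sub x y => x.eval σ - y.eval σ
  | .mul x y => x.eval σ * y.eval σ
  | .div x y => x.eval σ / y.eval σ
  | .conj x => starRingEnd ℂ (x.eval σ)

/-- Truth of a test. -/
def Test.Holds (σ : Memory) : Test → Prop
  | .natLE e f => e.eval σ ≤ f.eval σ
  | .numLE x y => (x.eval σ).re ≤ (y.eval σ).re
  | .not b => ¬ b.Holds σ
  | .and b c => b.Holds σ ∧ c.Holds σ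

/-- Overwrite one cell of an array of natural numbers. -/
def Memory.writeNat (σ : Memory) (a i v : ℕ) : Memory :=
  { σ with nat := Function.update σ.nat a (Function.update (σ.nat a) i v) }

/-- Overwrite one cell of an array of complex numbers. -/
def Memory.writeNum (σ : Memory) (a i : ℕ) (v : ℂ) : Memory :=
  { σ with num := Function.update σ.num a (Function.update (σ.num a) i v) }

/-- A configuration: the stack of program parts that are still to be executed, and the memory.
The machine has halted when the stack is empty. -/
abbrev Config : Type := List Program × Memory

open Classical in
/-- One step of the machine with sampling access to `s`, as a probability distribution on the
next configuration. -/
def step {n : ℕ} (s : Signal n) : Config → PMF Config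
  | ([], σ) => PMF.pure ([], σ)
  | (.skip :: K, σ) => PMF.pure (K, σ)
  | (.setNat a i e :: K, σ) => PMF.pure (K, σ.writeNat a (i.eval σ) (e.eval σ))
  | (.setNum a i x :: K, σ) => PMF.pure (K, σ.writeNum a (i.eval σ) (x.eval σ))
  | (.toss a i :: K, σ) =>
      (PMF.uniformOfFintype Bool).map fun b => (K, σ.writeNat a (i.eval σ) b.toNat)
  | (.query a i b p :: K, σ) =>
      PMF.pure (K, σ.writeNum a (i.eval σ)
        (s fun j : Fin n => ((σ.nat b (p.eval σ + (j : ℕ)) : ℕ) : ZMod 2)))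
  | (.emit e :: K, σ) => PMF.pure (K, { σ with out := σ.out ++ [((e.eval σ : ℕ) : ZMod 2)] })
  | (.seq p q :: K, σ) => PMF.pure (p :: q :: K, σ)
  | (.branch b p q :: K, σ) => PMF.pure (if b.Holds σ then (p :: K, σ) else (q :: K, σ))
  | (.loop b p :: K, σ) =>
      PMF.pure (if b.Holds σ then (p :: .loop b p :: K, σ) else (K, σ))

/-- The distribution of the configuration after `t` steps. -/
def run {n : ℕ} (s : Signal n) : ℕ → Config → PMF Config
  | 0, z => PMF.pure z
  | t + 1, z => (step s z).bind (run s t)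

/-- The initial configuration of the program `A` on the parameters `n = log₂ N` and `k`: the number
`n` is in cell `0` of array `0` of natural numbers, the number `k` is in cell `0` of array `0` of
complex numbers, all other cells are `0`, and the output is empty. -/
def initial (A : Program) (n : ℕ) (k : ℝ) : Config :=
  ([A],
    { nat := fun a i => if a = 0 ∧ i = 0 then n else 0
      num := fun a i => if a = 0 ∧ i = 0 then (k : ℂ) else 0
      out := [] })

/-- On the signal `s`, the program `A` halts after at most `T` steps, whatever the coin tosses. -/
def HaltsWithin {n : ℕ} (A : Program) (k : ℝ) (s : Signal n) (T : ℕ) : Prop :=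
  ∀ z ∈ (run s T (initial A n k)).support, z.1 = []

/-- The output is a list of (labels of) Hankel codewords that contains every Hankel codeword
`φ_{P,ℓ}` with `|⟨s, φ_{P,ℓ}⟩|² ≥ (1/k) ‖s‖²`. -/
def IsCorrectOutput {n : ℕ} (k : ℝ) (s : Signal n) (out : List (ZMod 2)) : Prop :=
  ∃ L : List (Label n), out = L.flatMap encode ∧
    (∀ x ∈ L, IsHankel x.1) ∧
    ∀ (P : Matrix (Fin n) (Fin n) (ZMod 2)) (l : Fin n → ZMod 2), IsHankel P →
      1 / k * ‖s‖ ^ 2 ≤ ‖inner ℂ s (codeword P l)‖ ^ 2 → (P, l) ∈ L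

/-- The probability that the output after `T` steps is not correct. -/
def failureProbability {n : ℕ} (A : Program) (k : ℝ) (s : Signal n) (T : ℕ) : ℝ≥0∞ :=
  (run s T (initial A n k)).toOuterMeasure {z | ¬ IsCorrectOutput k s z.2.out}

end

end HankelDecoding

open HankelDecoding

/-!
# List decoding of Hankel codes

The algorithm runs many independent trials and outputs one Hankel label per trial. The theorem holds
because a single trial finds any given Hankel label `(P, l)` of correlation at least `1 / k` with
probability at least `1 / poly (k * n)` (`le_coins_trialLabel_eq`). There are at most `2 ^ (3 * n)`
Hankel labels (`card_hankel_le`), so that after polynomially many trials the union bound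
`coins_exists_missed_le` leaves a failure probability of at most `N ^ (-c)`.

A trial finds `(P, l)` for the following reasons.

* *Truncation.* The entries of `s` may be of very different sizes. A random position `y₀` is good,
  with probability at least `1 / (16 * k)`, in the sense that setting to zero the entries of `s`
  that are much larger than `s y₀` leaves a signal `h`, bounded by a level `θ`, whose correlation
  with the codeword is at least a fraction `1 / poly k` of the largest one that this bound admits
  (`exists_truncation`).
* *Derivatives.* The derivative `y ↦ h (y + a) * conj (h y)` of a signal that correlates with the
  phase `i ^ (yᵀ P y + 2 lᵀ y)` correlates with the character `y ↦ (-1) ^ (yᵀ P a)`, for a suitable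
  direction `a ≠ 0` that is supported on the first `m = O(log (k * n))` coordinates
  (`exists_large_derivative`). There are only `2 ^ m = poly (k * n)` such directions, so that `a`
  can be guessed. If `n < m`, no derivative is needed, since a whole row of `P` can be guessed.
* *Decoding of characters.* A character `α` that correlates with a bounded function is read off from
  sums of the function over an affine cube spanned by `m + 1` random points, once the values of
  `α` at the `m + 1` points have been guessed: pairwise independence of the points of the cube makes
  the sums concentrate (`half_le_card_decoding`). This yields the vector `P a`.
* *Linear recurrences.* Since `P` is a Hankel matrix, with `P i j = p (i + j)`, the vector `P a` is
  an inhomogeneous linear recurrence for the sequence `p`, of order equal to the last index `d < m`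
  with `a d = 1`. Guessing `d` initial values thus determines the first row of `P`. The last row is
  found in the same way after reversing the coordinates, and the two rows determine `P`
  (`hankelOf_eq`). After multiplication by the conjugate of the quadratic phase of `P`, the vector
  `l` is decoded as a character (`exists_decodeLabel_eq`).

To speak about the machine, its randomness is moved to a tape of coins that is tossed in advance
(`run_eq_map_coins`). On a fixed tape the machine is deterministic, and `Wp` is a program logic for
it that bounds running times and keeps track of the coins consumed.
-/

namespace HankelDecoding

/-! ### Coin tapes -/

/-- A tape of `L` fair coin tosses. -/
noncomputable def coins : ℕ → PMF (List Bool)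
  | 0 => PMF.pure []
  | L + 1 => (PMF.uniformOfFintype Bool).bind fun b => (coins L).map (b :: ·)

theorem coins_add (a b : ℕ) :
    coins (a + b) = (coins a).bind fun x => (coins b).map (x ++ ·) := by
  induction a with
  | zero =>
    rw [Nat.zero_add, coins, PMF.pure_bind]
    exact (PMF.map_id _).symm
  | succ a ih =>
    rw [Nat.succ_add, coins, coins, PMF.bind_bind]
    congr 1
    funext c
    rw [ih, PMF.bind_map, PMF.map_bind]
    congr 1
    funext x
    simp [PMF.map_comp, Function.comp_def]

theorem length_of_mem_support_coins {L : ℕ} {x : List Bool} (hx : x ∈ (coins L).support) :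
    x.length = L := by
  induction L generalizing x with
  | zero => simp [coins] at hx; simp [hx]
  | succ L ih =>
    simp only [coins, PMF.mem_support_bind_iff, PMF.support_map, Set.mem_image] at hx
    obtain ⟨b, -, y, hy, rfl⟩ := hx
    simp [ih hy]

theorem coins_apply {L : ℕ} {x : List Bool} (hx : x.length = L) :
    coins L x = ((2 : ℝ≥0∞) ^ L)⁻¹ := by
  induction L generalizing x with
  | zero => simp [coins, List.length_eq_zero_iff.mp hx]
  | succ L ih =>
    obtain ⟨b, y, rfl⟩ : ∃ b y, x = b :: y := by
      cases x with
      | nil => simp at hx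
      | cons b y => exact ⟨b, y, rfl⟩
    have hy : y.length = L := by simpa using hx
    have h1 : ∀ c, ((coins L).map (c :: ·)) (b :: y) = if c = b then coins L y else 0 := by
      intro c
      rw [PMF.map_apply]
      by_cases h : c = b
      · subst h
        simp only [List.cons.injEq, true_and, if_true]
        rw [tsum_eq_single y (by intro z hz; simp [Ne.symm hz])]
        simp
      · simp [h, Ne.symm h]
    simp only [coins, PMF.bind_apply, PMF.uniformOfFintype_apply, h1, ih hy]
    rw [tsum_fintype]
    simp only [mul_ite, mul_zero, Finset.sum_ite_eq', Finset.mem_univ, if_true, Fintype.card_bool]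
    rw [pow_succ, mul_comm, ENNReal.mul_inv (by simp) (by simp)]
    simp

/-! ### Runs driven by a tape -/

open Classical in
/-- One step of the machine where the next coin is read off a tape. An exhausted tape shows
`false`. -/
noncomputable def tapeStep {n : ℕ} (s : Signal n) : Config × List Bool → Config × List Bool
  | (([], σ), w) => (([], σ), w)
  | ((.skip :: K, σ), w) => ((K, σ), w)
  | ((.setNat a i e :: K, σ), w) => ((K, σ.writeNat a (i.eval σ) (e.eval σ)), w)
  | ((.setNum a i x :: K, σ), w) => ((K, σ.writeNum a (i.eval σ) (x.eval σ)), w)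
  | ((.toss a i :: K, σ), w) => ((K, σ.writeNat a (i.eval σ) (w.headD false).toNat), w.tail)
  | ((.query a i b p :: K, σ), w) =>
      ((K, σ.writeNum a (i.eval σ)
        (s fun j : Fin n => ((σ.nat b (p.eval σ + (j : ℕ)) : ℕ) : ZMod 2))), w)
  | ((.emit e :: K, σ), w) =>
      ((K, { σ with out := σ.out ++ [((e.eval σ : ℕ) : ZMod 2)] }), w)
  | ((.seq p q :: K, σ), w) => ((p :: q :: K, σ), w)
  | ((.branch b p q :: K, σ), w) => (if b.Holds σ then (p :: K, σ) else (q :: K, σ), w)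
  | ((.loop b p :: K, σ), w) =>
      (if b.Holds σ then (p :: .loop b p :: K, σ) else (K, σ), w)

theorem step_cases {n : ℕ} (s : Signal n) (z : Config) :
    (∃ z', step s z = PMF.pure z' ∧ ∀ w, tapeStep s (z, w) = (z', w)) ∨
    ∃ f : Bool → Config, step s z = (PMF.uniformOfFintype Bool).map f ∧
      ∀ b w, tapeStep s (z, b :: w) = (f b, w) := by
  obtain ⟨K, σ⟩ := z
  cases K with
  | nil => exact Or.inl ⟨_, rfl, fun _ => rfl⟩
  | cons p K =>
    cases p with
    | toss a i => exact Or.inr ⟨_, rfl, fun _ _ => rfl⟩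
    | _ => exact Or.inl ⟨_, rfl, fun _ => rfl⟩

/-- The random run is the image of a uniformly random tape under the deterministic run: every step
reads at most one coin, so a tape as long as the run suffices. -/
theorem run_eq_map_coins {n : ℕ} (s : Signal n) (T L : ℕ) (z : Config) (h : T ≤ L) :
    run s T z = (coins L).map fun w => ((tapeStep s)^[T] (z, w)).1 := by
  induction T generalizing L z with
  | zero =>
    rw [run]
    exact (PMF.map_const (coins L) z).symm
  | succ T ih =>
    rw [run]
    rcases step_cases s z with ⟨z', h1, h2⟩ | ⟨f, h1, h2⟩
    · rw [h1, PMF.pure_bind, ih L z' (by omega)]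
      simp only [Function.iterate_succ_apply, h2]
    · obtain ⟨L, rfl⟩ : ∃ L', L = L' + 1 := ⟨L - 1, by omega⟩
      rw [h1, PMF.bind_map, coins, PMF.map_bind]
      congr 1
      funext b
      rw [Function.comp_apply, ih L (f b) (by omega), PMF.map_comp]
      simp only [Function.comp_def, Function.iterate_succ_apply, h2]

theorem tapeStep_halted {n : ℕ} (s : Signal n) (T : ℕ) (σ : Memory) (w : List Bool) :
    (tapeStep s)^[T] (([], σ), w) = (([], σ), w) := by
  induction T with
  | zero => rfl
  | succ T ih => rw [Function.iterate_succ_apply]; exact ih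

/-! ### Big-step semantics -/

/-- `Ev s p σ x σ' T`: started in memory `σ`, the program `p` reads exactly the coins `x` and ends
in memory `σ'` after exactly `T` steps. -/
inductive Ev {n : ℕ} (s : Signal n) : Program → Memory → List Bool → Memory → ℕ → Prop
  | skip (σ : Memory) : Ev s .skip σ [] σ 1
  | setNat (σ : Memory) (a : ℕ) (i e : NatExpr) :
      Ev s (.setNat a i e) σ [] (σ.writeNat a (i.eval σ) (e.eval σ)) 1
  | setNum (σ : Memory) (a : ℕ) (i : NatExpr) (x : NumExpr) :
      Ev s (.setNum a i x) σ [] (σ.writeNum a (i.eval σ) (x.eval σ)) 1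
  | toss (σ : Memory) (a : ℕ) (i : NatExpr) (c : Bool) :
      Ev s (.toss a i) σ [c] (σ.writeNat a (i.eval σ) c.toNat) 1
  | query (σ : Memory) (a : ℕ) (i : NatExpr) (b : ℕ) (p : NatExpr) :
      Ev s (.query a i b p) σ [] (σ.writeNum a (i.eval σ)
        (s fun j : Fin n => ((σ.nat b (p.eval σ + (j : ℕ)) : ℕ) : ZMod 2))) 1
  | emit (σ : Memory) (e : NatExpr) :
      Ev s (.emit e) σ [] { σ with out := σ.out ++ [((e.eval σ : ℕ) : ZMod 2)] } 1
  | seq {p q : Program} {σ σ' σ'' : Memory} {x y : List Bool} {T U : ℕ} :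
      Ev s p σ x σ' T → Ev s q σ' y σ'' U → Ev s (.seq p q) σ (x ++ y) σ'' (T + U + 1)
  | branch_pos {b : Test} {p q : Program} {σ σ' : Memory} {x : List Bool} {T : ℕ} :
      b.Holds σ → Ev s p σ x σ' T → Ev s (.branch b p q) σ x σ' (T + 1)
  | branch_neg {b : Test} {p q : Program} {σ σ' : Memory} {x : List Bool} {T : ℕ} :
      ¬ b.Holds σ → Ev s q σ x σ' T → Ev s (.branch b p q) σ x σ' (T + 1)
  | loop_neg {b : Test} {p : Program} {σ : Memory} :
      ¬ b.Holds σ → Ev s (.loop b p) σ [] σ 1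
  | loop_pos {b : Test} {p : Program} {σ σ' σ'' : Memory} {x y : List Bool} {T U : ℕ} :
      b.Holds σ → Ev s p σ x σ' T → Ev s (.loop b p) σ' y σ'' U →
        Ev s (.loop b p) σ (x ++ y) σ'' (T + U + 1)

theorem Ev.iterate {n : ℕ} {s : Signal n} {p : Program} {σ σ' : Memory} {x : List Bool} {T : ℕ}
    (h : Ev s p σ x σ' T) (K : List Program) (w : List Bool) :
    (tapeStep s)^[T] ((p :: K, σ), x ++ w) = ((K, σ'), w) := by
  induction h generalizing K w with
  | skip | setNat | setNum | query | emit | toss => rfl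
  | seq _ _ ih1 ih2 =>
    rw [Function.iterate_succ_apply]
    simp only [tapeStep]
    rw [Nat.add_comm, Function.iterate_add_apply, List.append_assoc, ih1, ih2]
  | branch_pos hb _ ih =>
    rw [Function.iterate_succ_apply]
    simp only [tapeStep, hb, if_true]
    exact ih K w
  | branch_neg hb _ ih =>
    rw [Function.iterate_succ_apply]
    simp only [tapeStep, hb, if_false]
    exact ih K w
  | loop_neg hb => simp [tapeStep, hb]
  | loop_pos hb _ _ ih1 ih2 =>
    rw [Function.iterate_succ_apply]
    simp only [tapeStep, hb, if_true]
    rw [Nat.add_comm, Function.iterate_add_apply, List.append_assoc, ih1, ih2]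

/-! ### Frames -/

/-- Whether the program assigns to the array `a` of natural numbers. -/
def Program.setsNat (a : ℕ) : Program → Bool
  | .setNat b _ _ => b == a
  | .toss b _ => b == a
  | .seq p q => p.setsNat a || q.setsNat a
  | .branch _ p q => p.setsNat a || q.setsNat a
  | .loop _ p => p.setsNat a
  | _ => false

/-- Whether the program assigns to the array `a` of complex numbers. -/
def Program.setsNum (a : ℕ) : Program → Bool
  | .setNum b _ _ => b == a
  | .query b _ _ _ => b == a
  | .seq p q => p.setsNum a || q.setsNum a
  | .branch _ p q => p.setsNum a || q.setsNum a
  | .loop _ p => p.setsNum a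
  | _ => false

/-- Whether the program can write to the output. -/
def Program.emits : Program → Bool
  | .emit _ => true
  | .seq p q => p.emits || q.emits
  | .branch _ p q => p.emits || q.emits
  | .loop _ p => p.emits
  | _ => false

/-- The memories `σ` and `σ'` agree wherever `p` does not write. -/
structure Frame (p : Program) (σ σ' : Memory) : Prop where
  nat : ∀ a, p.setsNat a = false → σ'.nat a = σ.nat a
  num : ∀ a, p.setsNum a = false → σ'.num a = σ.num a
  out : p.emits = false → σ'.out = σ.out

theorem Frame.refl (p : Program) (σ : Memory) : Frame p σ σ :=
  ⟨fun _ _ => rfl, fun _ _ => rfl, fun _ => rfl⟩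

theorem Frame.trans {p : Program} {σ σ' σ'' : Memory} (h : Frame p σ σ') (h' : Frame p σ' σ'') :
    Frame p σ σ'' :=
  ⟨fun a ha => (h'.nat a ha).trans (h.nat a ha), fun a ha => (h'.num a ha).trans (h.num a ha),
    fun ha => (h'.out ha).trans (h.out ha)⟩

theorem Ev.frame {n : ℕ} {s : Signal n} {p : Program} {σ σ' : Memory} {x : List Bool} {T : ℕ}
    (h : Ev s p σ x σ' T) : Frame p σ σ' := by
  induction h with
  | skip | loop_neg => exact Frame.refl _ _
  | setNat | toss | setNum | query | emit =>
    constructor <;> intros <;>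
      simp_all [Program.setsNat, Program.setsNum, Program.emits, Memory.writeNat, Memory.writeNum,
        Function.update_of_ne, Ne.symm]
  | seq _ _ ih1 ih2 =>
    constructor
    · intro a ha
      simp only [Program.setsNat, Bool.or_eq_false_iff] at ha
      rw [ih2.nat a ha.2, ih1.nat a ha.1]
    · intro a ha
      simp only [Program.setsNum, Bool.or_eq_false_iff] at ha
      rw [ih2.num a ha.2, ih1.num a ha.1]
    · intro ha
      simp only [Program.emits, Bool.or_eq_false_iff] at ha
      rw [ih2.out ha.2, ih1.out ha.1]
  | branch_pos _ _ ih =>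
    constructor
    · intro a ha
      simp only [Program.setsNat, Bool.or_eq_false_iff] at ha
      exact ih.nat a ha.1
    · intro a ha
      simp only [Program.setsNum, Bool.or_eq_false_iff] at ha
      exact ih.num a ha.1
    · intro ha
      simp only [Program.emits, Bool.or_eq_false_iff] at ha
      exact ih.out ha.1
  | branch_neg _ _ ih =>
    constructor
    · intro a ha
      simp only [Program.setsNat, Bool.or_eq_false_iff] at ha
      exact ih.nat a ha.2
    · intro a ha
      simp only [Program.setsNum, Bool.or_eq_false_iff] at ha
      exact ih.num a ha.2
    · intro ha
      simp only [Program.emits, Bool.or_eq_false_iff] at ha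
      exact ih.out ha.2
  | loop_pos _ _ _ ih1 ih2 =>
    exact Frame.trans ⟨ih1.nat, ih1.num, ih1.out⟩ ih2

/-! ### A program logic -/

/-- `Wp s p σ x B Q`: started in memory `σ`, the program `p` reads exactly the coins `x` and halts
within `B` steps in a memory that satisfies `Q`. -/
def Wp {n : ℕ} (s : Signal n) (p : Program) (σ : Memory) (x : List Bool) (B : ℕ)
    (Q : Memory → Prop) : Prop :=
  ∃ σ' T, T ≤ B ∧ Ev s p σ x σ' T ∧ Q σ'

namespace Wp

variable {n : ℕ} {s : Signal n} {p q : Program} {σ : Memory} {x y : List Bool} {B B' : ℕ}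
  {Q Q' : Memory → Prop}

theorem mono (h : Wp s p σ x B Q) (hB : B ≤ B') (hQ : ∀ σ', Frame p σ σ' → Q σ' → Q' σ') :
    Wp s p σ x B' Q' := by
  obtain ⟨σ', T, hT, hE, h⟩ := h
  exact ⟨σ', T, hT.trans hB, hE, hQ σ' hE.frame h⟩

theorem conseq (h : Wp s p σ x B Q) (hQ : ∀ σ', Frame p σ σ' → Q σ' → Q' σ') :
    Wp s p σ x B Q' :=
  h.mono le_rfl hQ

theorem time (h : Wp s p σ x B Q) (hB : B ≤ B') : Wp s p σ x B' Q :=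
  h.mono hB fun _ _ h => h

theorem seq (h : Wp s p σ x B fun σ' => Wp s q σ' y B' Q) :
    Wp s (.seq p q) σ (x ++ y) (B + B' + 1) Q := by
  obtain ⟨σ', T, hT, hE, σ'', U, hU, hE', h⟩ := h
  exact ⟨σ'', T + U + 1, by omega, hE.seq hE', h⟩

/-- The rule for a sequence whose first part reads no coins. -/
theorem seq_nil (h : Wp s p σ [] B fun σ' => Wp s q σ' y B' Q) :
    Wp s (.seq p q) σ y (B + B' + 1) Q := h.seq

/-- The rule for a sequence whose second part reads no coins. -/
theorem seq_last (h : Wp s p σ x B fun σ' => Wp s q σ' [] B' Q) :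
    Wp s (.seq p q) σ x (B + B' + 1) Q := by
  have := h.seq
  rwa [List.append_nil] at this

theorem skip (h : Q σ) : Wp s .skip σ [] 1 Q := ⟨σ, 1, le_rfl, .skip σ, h⟩

theorem setNat {a : ℕ} {i e : NatExpr} (h : Q (σ.writeNat a (i.eval σ) (e.eval σ))) :
    Wp s (.setNat a i e) σ [] 1 Q := ⟨_, 1, le_rfl, .setNat σ a i e, h⟩

theorem setNum {a : ℕ} {i : NatExpr} {e : NumExpr}
    (h : Q (σ.writeNum a (i.eval σ) (e.eval σ))) :
    Wp s (.setNum a i e) σ [] 1 Q := ⟨_, 1, le_rfl, .setNum σ a i e, h⟩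

theorem toss {a : ℕ} {i : NatExpr} {c : Bool} (h : Q (σ.writeNat a (i.eval σ) c.toNat)) :
    Wp s (.toss a i) σ [c] 1 Q := ⟨_, 1, le_rfl, .toss σ a i c, h⟩

theorem query {a : ℕ} {i : NatExpr} {b : ℕ} {e : NatExpr}
    (h : Q (σ.writeNum a (i.eval σ)
        (s fun j : Fin n => ((σ.nat b (e.eval σ + (j : ℕ)) : ℕ) : ZMod 2)))) :
    Wp s (.query a i b e) σ [] 1 Q := ⟨_, 1, le_rfl, .query σ a i b e, h⟩

theorem emit {e : NatExpr}
    (h : Q { σ with out := σ.out ++ [((e.eval σ : ℕ) : ZMod 2)] }) :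
    Wp s (.emit e) σ [] 1 Q := ⟨_, 1, le_rfl, .emit σ e, h⟩

theorem branch {b : Test} (h : b.Holds σ → Wp s p σ x B Q) (h' : ¬ b.Holds σ → Wp s q σ x B' Q) :
    Wp s (.branch b p q) σ x (B + B' + 1) Q := by
  by_cases hb : b.Holds σ
  · obtain ⟨σ', T, hT, hE, h⟩ := h hb
    exact ⟨σ', T + 1, by omega, .branch_pos hb hE, h⟩
  · obtain ⟨σ', T, hT, hE, h⟩ := h' hb
    exact ⟨σ', T + 1, by omega, .branch_neg hb hE, h⟩

/-- The rule for a loop that runs exactly `N` times, with invariant `I` and the coins `x j` read in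
round `j`. The body may use that everything it does not write is as it was at the start. -/
theorem loop {b : Test} (I : ℕ → Memory → Prop) (N : ℕ) (x : ℕ → List Bool) (h0 : I 0 σ)
    (hb : ∀ j σ', j < N → Frame p σ σ' → I j σ' →
      b.Holds σ' ∧ Wp s p σ' (x j) B (I (j + 1)))
    (hN : ∀ σ', Frame p σ σ' → I N σ' → ¬ b.Holds σ') :
    Wp s (.loop b p) σ ((List.range N).flatMap x) (N * (B + 1) + 1) (I N) := by
  have key : ∀ k j σ', j + k = N → Frame p σ σ' → I j σ' →
      Wp s (.loop b p) σ' ((List.range' j k).flatMap x) (k * (B + 1) + 1) (I N) := by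
    intro k
    induction k with
    | zero =>
      intro j σ' hj hF hI
      obtain rfl : j = N := by omega
      exact ⟨σ', 1, by omega, .loop_neg (hN σ' hF hI), hI⟩
    | succ k ih =>
      intro j σ' hj hF hI
      obtain ⟨hbj, σ1, T, hT, hE, hI1⟩ := hb j σ' (by omega) hF hI
      obtain ⟨σ2, U, hU, hE', hI2⟩ := ih (j + 1) σ1 (by omega) (hF.trans hE.frame) hI1
      rw [List.range'_succ, List.flatMap_cons]
      exact ⟨σ2, T + U + 1, by rw [Nat.succ_mul]; omega, .loop_pos hbj hE hE', hI2⟩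
  have := key N 0 σ (by omega) (Frame.refl _ _) h0
  rwa [← List.range_eq_range'] at this

end Wp

@[simp] theorem Memory.writeNat_nat_self (σ : Memory) (a i v : ℕ) :
    (σ.writeNat a i v).nat a = Function.update (σ.nat a) i v := by simp [Memory.writeNat]

@[simp] theorem Memory.writeNat_nat_of_ne (σ : Memory) {a b : ℕ} (i v : ℕ) (h : b ≠ a) :
    (σ.writeNat a i v).nat b = σ.nat b := by simp [Memory.writeNat, h]

@[simp] theorem Memory.writeNat_num (σ : Memory) (a i v : ℕ) :
    (σ.writeNat a i v).num = σ.num := rfl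

@[simp] theorem Memory.writeNat_out (σ : Memory) (a i v : ℕ) :
    (σ.writeNat a i v).out = σ.out := rfl

@[simp] theorem Memory.writeNum_num_self (σ : Memory) (a i : ℕ) (v : ℂ) :
    (σ.writeNum a i v).num a = Function.update (σ.num a) i v := by simp [Memory.writeNum]

@[simp] theorem Memory.writeNum_num_of_ne (σ : Memory) {a b : ℕ} (i : ℕ) (v : ℂ) (h : b ≠ a) :
    (σ.writeNum a i v).num b = σ.num b := by simp [Memory.writeNum, h]

@[simp] theorem Memory.writeNum_nat (σ : Memory) (a i : ℕ) (v : ℂ) :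
    (σ.writeNum a i v).nat = σ.nat := rfl

/-- The scalar variable `a`: cell `0` of the array `a`. -/
abbrev NatExpr.var (a : ℕ) : NatExpr := .get a (.lit 0)

/-- `for i < e do p`, with the variable `i` as counter. -/
def Program.for (i : ℕ) (e : NatExpr) (p : Program) : Program :=
  .seq (.setNat i (.lit 0) (.lit 0))
    (.loop (.natLE (.add (.var i) (.lit 1)) e)
      (.seq p (.setNat i (.lit 0) (.add (.var i) (.lit 1)))))

/-- The rule for a counting loop of length `N`. In round `j`, the counter is `j`. -/
theorem Wp.for {n : ℕ} {s : Signal n} {p : Program} {σ : Memory} {B : ℕ} {i : ℕ} {e : NatExpr}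
    (I : ℕ → Memory → Prop) (N : ℕ) (x : ℕ → List Bool)
    (hi : p.setsNat i = false)
    (he : ∀ σ', Frame (Program.for i e p) σ σ' → e.eval σ' = N)
    (hI : ∀ j σ' v, I j σ' → I j (σ'.writeNat i 0 v))
    (h0 : I 0 σ)
    (hb : ∀ j σ', j < N → Frame (Program.for i e p) σ σ' → σ'.nat i 0 = j → I j σ' →
      Wp s p σ' (x j) B (I (j + 1))) :
    Wp s (Program.for i e p) σ ((List.range N).flatMap x) (N * (B + 3) + 3) (I N) := by
  set c : Program := .seq p (.setNat i (.lit 0) (.add (.var i) (.lit 1))) with hc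
  have hfr : ∀ τ τ', Frame c τ τ' → Frame (Program.for i e p) τ τ' := by
    intro τ τ' h
    refine ⟨fun a ha => h.nat a ?_, fun a ha => h.num a ?_, fun ha => h.out ?_⟩ <;>
      simp_all [Program.for, Program.setsNat, Program.setsNum, Program.emits]
  have hst : Frame (Program.for i e p) σ (σ.writeNat i 0 0) := by
    refine ⟨fun a ha => ?_, fun _ _ => rfl, fun _ => rfl⟩
    have : a ≠ i := by
      rintro rfl
      simp [Program.for, Program.setsNat] at ha
    simp [this]
  refine (Wp.seq_nil (B := 1) (B' := N * ((B + 1 + 1) + 1) + 1) (Wp.setNat ?_)).time (by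
    have : N * (B + 1 + 1 + 1) = N * (B + 3) := rfl
    omega)
  have := Wp.loop (s := s) (p := c) (σ := σ.writeNat i 0 0) (B := B + 1 + 1)
    (b := .natLE (.add (.var i) (.lit 1)) e)
    (fun j τ => τ.nat i 0 = j ∧ I j τ) N x ⟨by simp, hI _ _ _ h0⟩ ?_ ?_
  · exact this.conseq fun τ _ h => h.2
  · intro j τ hj hF hIj
    have hF' := hst.trans (hfr _ _ hF)
    refine ⟨?_, ?_⟩
    · simp only [Test.Holds, NatExpr.eval, he τ hF', hIj.1]
      omega
    · have h1 := hb j τ hj hF' hIj.1 hIj.2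
      have h2 := Wp.seq (q := .setNat i (.lit 0) (.add (.var i) (.lit 1))) (y := []) (B' := 1)
        (Q := fun τ => τ.nat i 0 = j + 1 ∧ I (j + 1) τ) (h1.conseq fun τ' hF'' h => Wp.setNat ?_)
      · simpa using h2
      · have : τ'.nat i 0 = j := by rw [hF''.nat i hi]; exact hIj.1
        refine ⟨by simp [NatExpr.eval, this], hI _ _ _ h⟩
  · intro τ hF hIN
    simp only [Test.Holds, NatExpr.eval, he τ (hst.trans (hfr _ _ hF)), hIN.1]
    omega

/-- The rule for a counting loop that reads no coins. -/
theorem Wp.for_nil {n : ℕ} {s : Signal n} {p : Program} {σ : Memory} {B : ℕ} {i : ℕ} {e : NatExpr}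
    (I : ℕ → Memory → Prop) (N : ℕ)
    (hi : p.setsNat i = false)
    (he : ∀ σ', Frame (Program.for i e p) σ σ' → e.eval σ' = N)
    (hI : ∀ j σ' v, I j σ' → I j (σ'.writeNat i 0 v))
    (h0 : I 0 σ)
    (hb : ∀ j σ', j < N → Frame (Program.for i e p) σ σ' → σ'.nat i 0 = j → I j σ' →
      Wp s p σ' [] B (I (j + 1))) :
    Wp s (Program.for i e p) σ [] (N * (B + 3) + 3) (I N) := by
  have h : (List.range N).flatMap (fun _ => ([] : List Bool)) = [] := by
    rw [List.flatMap_eq_nil_iff]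
    exact fun _ _ => rfl
  exact h ▸ Wp.for I N (fun _ => []) hi he hI h0 hb

/-! ### Sums over random affine cubes -/

/-- The points of the affine cube with base point `ρ 0` and edges `ρ 1, …, ρ m`: the number `S`
selects the edge `ρ (i + 1)` if its binary digit `i` is `1`. -/
def cube {H : Type*} [Add H] (ρ : ℕ → H) : ℕ → ℕ → H
  | 0, _ => ρ 0
  | m + 1, S => if S < 2 ^ m then cube ρ m S else cube ρ m (S - 2 ^ m) + ρ (m + 1)

theorem cube_congr {H : Type*} [Add H] {ρ ρ' : ℕ → H} {m : ℕ} (h : ∀ i ≤ m, ρ i = ρ' i) (S : ℕ) :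
    cube ρ m S = cube ρ' m S := by
  induction m generalizing S with
  | zero => exact h 0 le_rfl
  | succ m ih =>
    have ih' := ih fun i hi => h i (by omega)
    simp only [cube, ih', h (m + 1) le_rfl]

theorem cube_map {H K : Type*} [Add H] [Add K] (f : H → K) (hf : ∀ x y, f (x + y) = f x + f y)
    (ρ : ℕ → H) (m S : ℕ) : f (cube ρ m S) = cube (fun i => f (ρ i)) m S := by
  induction m generalizing S with
  | zero => rfl
  | succ m ih =>
    simp only [cube]
    split_ifs
    · exact ih S
    · rw [hf, ih]

theorem sum_cube_succ {H E : Type*} [Add H] [AddCommMonoid E] (G : H → E) (ρ : ℕ → H) (m : ℕ) :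
    ∑ S ∈ Finset.range (2 ^ (m + 1)), G (cube ρ (m + 1) S) =
      ∑ S ∈ Finset.range (2 ^ m), G (cube ρ m S) +
        ∑ S ∈ Finset.range (2 ^ m), G (cube ρ m S + ρ (m + 1)) := by
  rw [pow_succ, mul_two, Finset.sum_range_add]
  congr 1
  · refine Finset.sum_congr rfl fun S hS => ?_
    rw [cube, if_pos (Finset.mem_range.mp hS)]
  · refine Finset.sum_congr rfl fun S _ => ?_
    rw [cube, if_neg (by omega), Nat.add_sub_cancel_left]

/-- A finite family, continued by zeros. -/
def extendZero {H : Type*} [Zero H] {m : ℕ} (r : Fin m → H) (i : ℕ) : H :=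
  if h : i < m then r ⟨i, h⟩ else 0

theorem extendZero_snoc_of_lt {H : Type*} [Zero H] {m : ℕ} (r : Fin m → H) (x : H) {i : ℕ}
    (h : i < m) : extendZero (Fin.snoc r x : Fin (m + 1) → H) i = extendZero r i := by
  have h' : i < m + 1 := by omega
  simp [extendZero, h, h', Fin.snoc]

theorem extendZero_snoc_last {H : Type*} [Zero H] {m : ℕ} (r : Fin m → H) (x : H) :
    extendZero (Fin.snoc r x : Fin (m + 1) → H) m = x := by
  simp [extendZero, Fin.snoc]

/-- The points of a random affine cube are pairwise independent; hence the sum of a function of mean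
zero over the cube has the second moment of a sum of independent variables. -/
theorem sum_normSq_sum_cube {H : Type*} [AddCommGroup H] [Fintype H] (m : ℕ) (G : H → ℂ)
    (hG : ∑ y, G y = 0) :
    ∑ r : Fin (m + 1) → H,
        Complex.normSq (∑ S ∈ Finset.range (2 ^ m), G (cube (extendZero r) m S)) =
      2 ^ m * (Fintype.card H : ℝ) ^ m * ∑ y, Complex.normSq (G y) := by
  induction m generalizing G with
  | zero =>
    simp only [pow_zero, Finset.range_one, Finset.sum_singleton, cube, one_mul]
    refine Fintype.sum_equiv (Equiv.funUnique (Fin 1) H) _ _ fun r => ?_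
    simp [extendZero, Equiv.funUnique]
  | succ m ih =>
    have hsh : ∀ x, ∑ y, G (y + x) = 0 := fun x => by
      rw [← hG]; exact Fintype.sum_equiv (Equiv.addRight x) _ _ fun _ => rfl
    have hsh2 : ∀ x, ∑ y, Complex.normSq (G (y + x)) = ∑ y, Complex.normSq (G y) := fun x =>
      Fintype.sum_equiv (Equiv.addRight x) _ _ fun _ => rfl
    have hsh3 : ∀ x, ∑ y, G (x + y) = 0 := fun x => by
      rw [← hG]; exact Fintype.sum_equiv (Equiv.addLeft x) _ _ fun _ => rfl
    have e : ∑ r : Fin (m + 1 + 1) → H, Complex.normSq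
          (∑ S ∈ Finset.range (2 ^ (m + 1)), G (cube (extendZero r) (m + 1) S)) =
        ∑ x : H, ∑ r : Fin (m + 1) → H, Complex.normSq
          (∑ S ∈ Finset.range (2 ^ m), G (cube (extendZero r) m S) +
            ∑ S ∈ Finset.range (2 ^ m), G (cube (extendZero r) m S + x)) := by
      rw [← Fintype.sum_prod_type']
      refine (Fintype.sum_equiv (Fin.snocEquiv fun _ => H) _ _ fun p => ?_).symm
      obtain ⟨x, r⟩ := p
      rw [sum_cube_succ]
      have hc : ∀ S, cube (extendZero (Fin.snoc r x : Fin (m + 1 + 1) → H)) m S =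
          cube (extendZero r) m S := fun S =>
        cube_congr (fun i hi => extendZero_snoc_of_lt r x (by omega)) S
      simp only [Fin.snocEquiv, Equiv.coe_fn_mk, hc, extendZero_snoc_last]
    rw [e]
    simp only [Complex.normSq_add, Finset.sum_add_distrib]
    have e3 : ∑ x : H, ∑ r : Fin (m + 1) → H,
        2 * ((∑ S ∈ Finset.range (2 ^ m), G (cube (extendZero r) m S)) *
          (starRingEnd ℂ) (∑ S ∈ Finset.range (2 ^ m),
            G (cube (extendZero r) m S + x))).re = 0 := by
      -- the mixed terms vanish because `G` has mean zero
      rw [Finset.sum_comm]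
      refine Finset.sum_eq_zero fun r _ => ?_
      rw [← Finset.mul_sum, ← Complex.re_sum, ← Finset.mul_sum, ← map_sum, Finset.sum_comm]
      simp [hsh3]
    rw [e3, add_zero]
    simp only [ih G hG, fun x => ih (fun y => G (y + x)) (hsh x), hsh2]
    simp only [Finset.sum_const, Finset.card_univ, nsmul_eq_mul]
    ring

/-! ### Decoding of characters -/

/-- The sign `(-1) ^ b`. -/
def sgn (b : ZMod 2) : ℂ := if b = 0 then 1 else -1

theorem zmod_two_cases (b : ZMod 2) : b = 0 ∨ b = 1 := by
  revert b; decide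

theorem sgn_add (a b : ZMod 2) : sgn (a + b) = sgn a * sgn b := by
  rcases zmod_two_cases a with rfl | rfl <;> rcases zmod_two_cases b with rfl | rfl <;>
    simp [sgn, CharTwo.add_self_eq_zero]

@[simp] theorem sgn_zero : sgn 0 = 1 := by simp [sgn]

@[simp] theorem sgn_one : sgn 1 = -1 := by simp [sgn]

theorem sgn_mul_self (a : ZMod 2) : sgn a * sgn a = 1 := by
  rcases zmod_two_cases a with rfl | rfl <;> simp

@[simp] theorem normSq_sgn (a : ZMod 2) : Complex.normSq (sgn a) = 1 := by
  rcases zmod_two_cases a with rfl | rfl <;> simp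

@[simp] theorem conj_sgn (a : ZMod 2) : (starRingEnd ℂ) (sgn a) = sgn a := by
  rcases zmod_two_cases a with rfl | rfl <;> simp

/-- The vector `u` with the bit at position `z` flipped. -/
def flipBit (z : ℕ) (u : ℕ → ZMod 2) : ℕ → ZMod 2 := Function.update u z (u z + 1)

/-- The correlation of `F` with a sign pattern over an affine cube with bit `z` flipped. A row of
`ρ` consists of a vector of `n` bits and, at position `n`, the guessed value of a character. -/
noncomputable def cubeSum {n : ℕ} (F : (Fin n → ZMod 2) → ℂ) (ρ : ℕ → ℕ → ZMod 2) (m z : ℕ) : ℂ :=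
  ∑ S ∈ Finset.range (2 ^ m),
    sgn (flipBit z (cube ρ m S) n) * F fun j => flipBit z (cube ρ m S) j

open Classical in
/-- The decoded value of a character at the unit vector `z`: a flip of bit `z` is compared with a
flip of the sign bit. -/
noncomputable def cubeBit {n : ℕ} (F : (Fin n → ZMod 2) → ℂ) (ρ : ℕ → ℕ → ZMod 2) (m z : ℕ) :
    ZMod 2 :=
  if 0 ≤ (cubeSum F ρ m z * (starRingEnd ℂ) (cubeSum F ρ m n)).re then 1 else 0

/-- The rows `ρ` extend the vectors `Y` by the values of the character `α`. -/
def RowsMatch {n m : ℕ} (α : Fin n → ZMod 2) (Y : Fin (m + 1) → Fin n → ZMod 2)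
    (ρ : ℕ → ℕ → ZMod 2) : Prop :=
  ∀ i : Fin (m + 1), (∀ q : Fin n, ρ i q = Y i q) ∧ ρ i n = α ⬝ᵥ Y i

/-- Two numbers within distance `‖c‖ / 2` of `c` enclose an angle of less than `π / 2`. -/
theorem re_mul_conj_pos_of_close {u v c : ℂ} (hu : ‖u - c‖ < ‖c‖ / 2) (hv : ‖v - c‖ < ‖c‖ / 2) :
    0 < (u * (starRingEnd ℂ) v).re := by
  have h1 : ‖u - v‖ < ‖c‖ := by
    calc ‖u - v‖ = ‖(u - c) - (v - c)‖ := by ring_nf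
      _ ≤ ‖u - c‖ + ‖v - c‖ := norm_sub_le _ _
      _ < ‖c‖ := by linarith
  have h2 : ‖c‖ < ‖u + v‖ := by
    have : ‖2 * c‖ ≤ ‖u + v‖ + (‖u - c‖ + ‖v - c‖) := by
      calc ‖2 * c‖ = ‖(u + v) - ((u - c) + (v - c))‖ := by ring_nf
        _ ≤ ‖u + v‖ + ‖(u - c) + (v - c)‖ := norm_sub_le _ _
        _ ≤ _ := by gcongr; exact norm_add_le _ _
    rw [norm_mul, Complex.norm_ofNat] at this
    linarith
  have h3 : Complex.normSq (u - v) < Complex.normSq (u + v) := by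
    rw [Complex.normSq_eq_norm_sq, Complex.normSq_eq_norm_sq]
    have := norm_nonneg (u - v)
    nlinarith
  rw [Complex.normSq_add, Complex.normSq_sub] at h3
  linarith

theorem dotProduct_single_add {n : ℕ} (α y : Fin n → ZMod 2) (z : Fin n) :
    α ⬝ᵥ (y + Pi.single z 1) = α ⬝ᵥ y + α z := by
  rw [dotProduct_add, dotProduct_single, mul_one]

/-- Over a correctly labelled cube, the sums with a flipped bit are, up to a sign, sums of `α * F`
over shifted cubes. The sign is that of `α` at the unit vector `z`; for `z = n`, where the label
itself is flipped, it is `-1`. -/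
theorem cubeSum_eq {n m : ℕ} {F : (Fin n → ZMod 2) → ℂ} {α : Fin n → ZMod 2}
    {Y : Fin (m + 1) → Fin n → ZMod 2} {ρ : ℕ → ℕ → ZMod 2} (h : RowsMatch α Y ρ) :
    cubeSum F ρ m n = - ∑ S ∈ Finset.range (2 ^ m),
        sgn (α ⬝ᵥ (cube (extendZero Y) m S + 0)) * F (cube (extendZero Y) m S + 0) ∧
    ∀ z : Fin n, cubeSum F ρ m z = sgn (α z) * ∑ S ∈ Finset.range (2 ^ m),
        sgn (α ⬝ᵥ (cube (extendZero Y) m S + Pi.single z 1)) *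
          F (cube (extendZero Y) m S + Pi.single z 1) := by
  have hq : ∀ (S : ℕ) (q : Fin n), cube ρ m S q = cube (extendZero Y) m S q := by
    intro S q
    rw [cube_map (fun u : ℕ → ZMod 2 => u q) (fun _ _ => rfl),
      cube_map (fun u : Fin n → ZMod 2 => u q) (fun _ _ => rfl)]
    refine cube_congr (fun i hi => ?_) S
    have hi' : i < m + 1 := by omega
    simpa [extendZero, hi'] using (h ⟨i, hi'⟩).1 q
  have hn : ∀ S : ℕ, cube ρ m S n = α ⬝ᵥ cube (extendZero Y) m S := by
    intro S
    rw [cube_map (fun u : ℕ → ZMod 2 => u n) (fun _ _ => rfl),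
      cube_map (fun u : Fin n → ZMod 2 => α ⬝ᵥ u) (fun _ _ => dotProduct_add _ _ _)]
    refine cube_congr (fun i hi => ?_) S
    have hi' : i < m + 1 := by omega
    simpa [extendZero, hi'] using (h ⟨i, hi'⟩).2
  constructor
  · rw [cubeSum, ← Finset.sum_neg_distrib]
    refine Finset.sum_congr rfl fun S _ => ?_
    have e : (fun j : Fin n => flipBit n (cube ρ m S) j) = cube (extendZero Y) m S + 0 := by
      funext j
      rw [flipBit, Function.update_of_ne (by have := j.isLt; omega), hq, add_zero]
    rw [e, flipBit, Function.update_self, sgn_add, hn, add_zero, sgn_one]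
    ring
  · intro z
    rw [cubeSum, Finset.mul_sum]
    refine Finset.sum_congr rfl fun S _ => ?_
    have e : (fun j : Fin n => flipBit z (cube ρ m S) j) =
        cube (extendZero Y) m S + Pi.single z 1 := by
      funext j
      rw [flipBit, Pi.add_apply]
      by_cases hj : j = z
      · subst hj; simp [hq]
      · rw [Function.update_of_ne (by exact fun h => hj (Fin.ext h)), hq, Pi.single_eq_of_ne hj,
          add_zero]
    rw [e, flipBit, Function.update_of_ne (by have := z.isLt; omega), hn, dotProduct_single_add,
      sgn_add, ← mul_assoc, mul_comm (sgn (α z)), mul_assoc (sgn _) (sgn _) (sgn _), sgn_mul_self,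
      mul_one]

/-- If the correlation of `F` with the character `α` is large, then half of all cubes, labelled by
the values of `α`, decode to `α`. -/
theorem half_le_card_decoding {n m : ℕ} (F : (Fin n → ZMod 2) → ℂ) (α : Fin n → ZMod 2) {b : ℝ}
    (hb : 0 < b) (hF : ∀ y, Complex.normSq (F y) ≤ b)
    (hα : 8 * (n + 1) * b * ((2 : ℝ) ^ n) ^ 2 ≤
      2 ^ m * Complex.normSq (∑ y, sgn (α ⬝ᵥ y) * F y)) :
    ∃ 𝒴 : Finset (Fin (m + 1) → Fin n → ZMod 2),
      ((2 : ℝ) ^ n) ^ (m + 1) / 2 ≤ 𝒴.card ∧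
      ∀ Y ∈ 𝒴, ∀ ρ, RowsMatch α Y ρ → ∀ z : Fin n, cubeBit F ρ m z = α z := by
  classical
  set N : ℝ := 2 ^ n with hN
  have hN0 : 0 < N := by positivity
  have hcard : (Fintype.card (Fin n → ZMod 2) : ℝ) = N := by simp [hN, ZMod.card]
  set f : (Fin n → ZMod 2) → ℂ := fun y => sgn (α ⬝ᵥ y) * F y with hf
  set c : ℂ := (∑ y, f y) / (N : ℂ) with hc
  have hNc : (N : ℂ) ≠ 0 := by exact_mod_cast hN0.ne'
  have hcN : (∑ y, f y) = (N : ℂ) * c := by rw [hc]; field_simp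
  have hα' : 8 * (n + 1) * b ≤ 2 ^ m * Complex.normSq c := by
    have e : Complex.normSq (∑ y, f y) = N ^ 2 * Complex.normSq c := by
      rw [hcN, Complex.normSq_mul, Complex.normSq_ofReal]; ring
    have h1 : 8 * (n + 1) * b * N ^ 2 ≤ (2 ^ m * Complex.normSq c) * N ^ 2 := by
      calc _ ≤ 2 ^ m * Complex.normSq (∑ y, f y) := hα
        _ = _ := by rw [e]; ring
    exact le_of_mul_le_mul_right h1 (by positivity)
  have hcpos : 0 < Complex.normSq c := by
    have : 0 < 2 ^ m * Complex.normSq c := lt_of_lt_of_le (by positivity) hα'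
    exact pos_of_mul_pos_right this (by positivity)
  -- the sums over the shifted cubes; a cube is bad for `x` if this sum is far from its mean
  set A : (Fin (m + 1) → Fin n → ZMod 2) → (Fin n → ZMod 2) → ℂ := fun Y x =>
    ∑ S ∈ Finset.range (2 ^ m), f (cube (extendZero Y) m S + x) with hA
  set bad : (Fin n → ZMod 2) → Finset (Fin (m + 1) → Fin n → ZMod 2) := fun x =>
    Finset.univ.filter fun Y => ‖(2 ^ m : ℂ) * c‖ / 2 ≤ ‖A Y x - 2 ^ m * c‖ with hbad
  -- Chebyshev's inequality for one shift `x`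
  have hcheb : ∀ x, ((bad x).card : ℝ) * (2 * (n + 1)) ≤ N ^ (m + 1) := by
    intro x
    have hmean : ∑ y, (f (y + x) - c) = 0 := by
      rw [Finset.sum_sub_distrib, Fintype.sum_equiv (Equiv.addRight x) (fun y => f (y + x)) f
        fun _ => rfl, hcN]
      simp only [Finset.sum_const, Finset.card_univ, nsmul_eq_mul]
      rw [← hcard]
      simp
    have hvar : ∑ y, Complex.normSq (f (y + x) - c) ≤ N * b := by
      rw [Fintype.sum_equiv (Equiv.addRight x) (fun y => Complex.normSq (f (y + x) - c))
        (fun y => Complex.normSq (f y - c)) fun _ => rfl]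
      have h1 : ∀ y, Complex.normSq (f y - c) =
          Complex.normSq (F y) + Complex.normSq c - 2 * (f y * (starRingEnd ℂ) c).re := by
        intro y
        rw [Complex.normSq_sub, hf]
        simp [Complex.normSq_mul]
      simp only [h1, Finset.sum_sub_distrib, Finset.sum_add_distrib]
      rw [← Finset.mul_sum, ← Complex.re_sum, ← Finset.sum_mul, hcN, mul_assoc, Complex.mul_conj]
      have h2 : ∑ y : Fin n → ZMod 2, Complex.normSq (F y) ≤ N * b := by
        calc _ ≤ ∑ y : Fin n → ZMod 2, b := Finset.sum_le_sum fun y _ => hF y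
          _ = N * b := by
            rw [Finset.sum_const, Finset.card_univ, nsmul_eq_mul, hcard]
      have h3 : ∑ y : Fin n → ZMod 2, Complex.normSq c = N * Complex.normSq c := by
        rw [Finset.sum_const, Finset.card_univ, nsmul_eq_mul, hcard]
      have h4 : ((N : ℂ) * (Complex.normSq c : ℂ)).re = N * Complex.normSq c := by
        rw [← Complex.ofReal_mul, Complex.ofReal_re]
      rw [h3, h4]
      nlinarith
    have hmom := sum_normSq_sum_cube m (fun y => f (y + x) - c) hmean
    rw [hcard] at hmom
    have hsum : ∀ Y : Fin (m + 1) → Fin n → ZMod 2,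
        ∑ S ∈ Finset.range (2 ^ m), (f (cube (extendZero Y) m S + x) - c) = A Y x - 2 ^ m * c := by
      intro Y
      simp [hA, Finset.sum_sub_distrib]
    simp only [hsum] at hmom
    have hlow : ((bad x).card : ℝ) * ((2 ^ m) ^ 2 * Complex.normSq c / 4) ≤
        2 ^ m * N ^ m * (N * b) := by
      calc ((bad x).card : ℝ) * ((2 ^ m) ^ 2 * Complex.normSq c / 4)
          = ∑ Y ∈ bad x, ((2 ^ m) ^ 2 * Complex.normSq c / 4) := by
            rw [Finset.sum_const, nsmul_eq_mul]
        _ ≤ ∑ Y ∈ bad x, Complex.normSq (A Y x - 2 ^ m * c) := by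
            refine Finset.sum_le_sum fun Y hY => ?_
            have hY' := (Finset.mem_filter.mp hY).2
            have hn2 : ‖(2 ^ m : ℂ) * c‖ ^ 2 = (2 ^ m) ^ 2 * Complex.normSq c := by
              rw [← Complex.normSq_eq_norm_sq, Complex.normSq_mul, map_pow]
              congr 1
              rw [Complex.normSq_ofNat, ← pow_mul, mul_comm m 2, pow_mul]
              norm_num
            rw [Complex.normSq_eq_norm_sq (A Y x - _), ← hn2]
            have h0 := norm_nonneg ((2 ^ m : ℂ) * c)
            nlinarith
        _ ≤ ∑ Y, Complex.normSq (A Y x - 2 ^ m * c) :=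
            Finset.sum_le_univ_sum_of_nonneg fun Y => Complex.normSq_nonneg _
        _ = 2 ^ m * N ^ m * ∑ y, Complex.normSq (f (y + x) - c) := hmom
        _ ≤ _ := by gcongr
    -- divide by `2 ^ m * b`
    have h5 : ((bad x).card : ℝ) * (2 * (n + 1)) * (2 ^ m * b) ≤ N ^ (m + 1) * (2 ^ m * b) := by
      calc ((bad x).card : ℝ) * (2 * (n + 1)) * (2 ^ m * b)
          = (bad x).card * 2 ^ m / 4 * (8 * (n + 1) * b) := by ring
        _ ≤ (bad x).card * 2 ^ m / 4 * (2 ^ m * Complex.normSq c) :=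
            mul_le_mul_of_nonneg_left hα'
              (div_nonneg (mul_nonneg (Nat.cast_nonneg _) (by positivity)) (by norm_num))
        _ = ((bad x).card : ℝ) * ((2 ^ m) ^ 2 * Complex.normSq c / 4) := by ring
        _ ≤ 2 ^ m * N ^ m * (N * b) := hlow
        _ = _ := by ring
    exact le_of_mul_le_mul_right h5 (by positivity)
  -- the shifts that occur in the decoding of `α`
  set shifts : Finset (Fin n → ZMod 2) :=
    insert 0 (Finset.univ.image fun z : Fin n => Pi.single z 1) with hsh
  have hshc : (shifts.card : ℝ) ≤ n + 1 := by
    have h1 := Finset.card_insert_le (0 : Fin n → ZMod 2)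
      (Finset.univ.image fun z : Fin n => Pi.single z 1)
    have h2 : (Finset.univ.image fun z : Fin n => (Pi.single z 1 : Fin n → ZMod 2)).card ≤ n := by
      refine Finset.card_image_le.trans ?_
      rw [Finset.card_univ, Fintype.card_fin]
    have h3 : shifts.card ≤ n + 1 := h1.trans (by omega)
    exact_mod_cast h3
  refine ⟨Finset.univ \ shifts.biUnion bad, ?_, ?_⟩
  · have h1 : ((shifts.biUnion bad).card : ℝ) ≤ N ^ (m + 1) / 2 := by
      calc ((shifts.biUnion bad).card : ℝ) ≤ ((∑ x ∈ shifts, (bad x).card : ℕ) : ℝ) := by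
            exact_mod_cast Finset.card_biUnion_le
        _ = ∑ x ∈ shifts, ((bad x).card : ℝ) := by push_cast; rfl
        _ ≤ ∑ x ∈ shifts, N ^ (m + 1) / (2 * (n + 1)) := by
            refine Finset.sum_le_sum fun x _ => ?_
            rw [le_div_iff₀ (by positivity)]
            exact hcheb x
        _ = shifts.card * (N ^ (m + 1) / (2 * (n + 1))) := by
            rw [Finset.sum_const, nsmul_eq_mul]
        _ ≤ (n + 1) * (N ^ (m + 1) / (2 * (n + 1))) := by gcongr
        _ = N ^ (m + 1) / 2 := by field_simp
    have h2 : (((Finset.univ : Finset (Fin (m + 1) → Fin n → ZMod 2)) \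
        shifts.biUnion bad).card : ℝ) =
        N ^ (m + 1) - (shifts.biUnion bad).card := by
      rw [Finset.card_sdiff_of_subset (Finset.subset_univ _),
        Nat.cast_sub (Finset.card_le_card (Finset.subset_univ _)),
        Finset.card_univ]
      congr 1
      rw [Fintype.card_fun, Fintype.card_fin, Nat.cast_pow, hcard]
    rw [h2]
    linarith
  · intro Y hY ρ hρ z
    have hgood : ∀ x ∈ shifts, ‖A Y x - 2 ^ m * c‖ < ‖(2 ^ m : ℂ) * c‖ / 2 := by
      intro x hx
      by_contra! hcon
      exact (Finset.mem_sdiff.mp hY).2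
        (Finset.mem_biUnion.mpr ⟨x, hx, Finset.mem_filter.mpr ⟨Finset.mem_univ _, hcon⟩⟩)
    have hpos := re_mul_conj_pos_of_close (hgood (Pi.single z 1) (by simp [hsh]))
      (hgood 0 (by simp [hsh]))
    obtain ⟨e1, e2⟩ := cubeSum_eq (F := F) hρ
    have e : (cubeSum F ρ m z * (starRingEnd ℂ) (cubeSum F ρ m n)) =
        -(sgn (α z) * (A Y (Pi.single z 1) * (starRingEnd ℂ) (A Y 0))) := by
      rw [e1, e2 z, map_neg]
      ring
    rw [cubeBit, e]
    rcases zmod_two_cases (α z) with h | h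
    · rw [h, sgn_zero, one_mul, if_neg]
      rw [Complex.neg_re]
      linarith
    · rw [h, sgn_one, if_pos]
      simpa using hpos.le

/-! ### Quadratic phases -/

/-- The unimodular function `√N • codeword P l`. -/
noncomputable def phase {n : ℕ} (P : Matrix (Fin n) (Fin n) (ZMod 2)) (l y : Fin n → ZMod 2) : ℂ :=
  Complex.I ^ ((∑ i, ∑ j, (y i).val * (P i j).val * (y j).val) + 2 * ∑ i, (l i).val * (y i).val)

@[simp] theorem normSq_phase {n : ℕ} (P : Matrix (Fin n) (Fin n) (ZMod 2)) (l y : Fin n → ZMod 2) :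
    Complex.normSq (phase P l y) = 1 := by
  rw [phase, map_pow, Complex.normSq_I, one_pow]

theorem neg_one_pow_eq_sgn (B : ℕ) : (-1 : ℂ) ^ B = sgn (B : ZMod 2) := by
  induction B with
  | zero => simp
  | succ B ih => rw [pow_succ, ih, Nat.cast_succ, sgn_add, sgn_one]

theorem I_pow_two_mul (B : ℕ) : Complex.I ^ (2 * B) = sgn (B : ZMod 2) := by
  rw [pow_mul, Complex.I_sq, neg_one_pow_eq_sgn]

theorem phase_eq_mul_sgn {n : ℕ} (P : Matrix (Fin n) (Fin n) (ZMod 2)) (l y : Fin n → ZMod 2) :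
    phase P l y = phase P 0 y * sgn (l ⬝ᵥ y) := by
  rw [phase, pow_add, I_pow_two_mul, phase]
  simp [dotProduct]

theorem val_add_cast (a b : ZMod 2) :
    (((a + b).val : ℕ) : ℤ) = a.val + b.val - 2 * (a.val * b.val) := by
  revert a b; decide

theorem IsHankel.isSymm {n : ℕ} {P : Matrix (Fin n) (Fin n) (ZMod 2)} (hP : IsHankel P) :
    P.transpose = P := by
  ext i j
  exact hP j i i j (Nat.add_comm _ _)

/-- The multiplicative derivative of a quadratic phase is a character, up to a constant factor. -/
theorem phase_add {n : ℕ} {P : Matrix (Fin n) (Fin n) (ZMod 2)} (hP : P.transpose = P)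
    (l y a : Fin n → ZMod 2) :
    phase P l (y + a) = phase P l y * phase P l a * sgn (P.mulVec a ⬝ᵥ y) := by
  set p : Matrix (Fin n) (Fin n) ℤ := Matrix.of fun i j => ((P i j).val : ℤ) with hp
  have hps : p.transpose = p := by
    ext i j
    have h := congrFun (congrFun hP i) j
    rw [Matrix.transpose_apply] at h
    simp only [Matrix.transpose_apply, hp, Matrix.of_apply, h]
  set v : (Fin n → ZMod 2) → Fin n → ℤ := fun y i => ((y i).val : ℤ) with hv
  set W : Fin n → ℤ := fun i => v y i * v a i with hW
  have hsymm : ∀ x z : Fin n → ℤ, x ⬝ᵥ p.mulVec z = z ⬝ᵥ p.mulVec x := by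
    intro x z
    rw [Matrix.dotProduct_mulVec, ← Matrix.mulVec_transpose, hps, dotProduct_comm]
  have hvadd : v (y + a) = v y + v a - (2 : ℤ) • W := by
    funext i
    simp only [hv, hW, Pi.add_apply, Pi.sub_apply, Pi.smul_apply, smul_eq_mul, val_add_cast]
  have hexp : ∀ x : Fin n → ZMod 2, phase P l x =
      Complex.I ^ (v x ⬝ᵥ p.mulVec (v x) + 2 * (v l ⬝ᵥ v x)) := by
    intro x
    rw [phase, ← zpow_natCast]
    congr 1
    push_cast
    congr 1
    simp only [dotProduct, Matrix.mulVec, Finset.mul_sum, hp, hv, Matrix.of_apply]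
    exact Finset.sum_congr rfl fun i _ => Finset.sum_congr rfl fun j _ => by ring
  have hB : sgn (P.mulVec a ⬝ᵥ y) = Complex.I ^ (2 * (v y ⬝ᵥ p.mulVec (v a))) := by
    have e : v y ⬝ᵥ p.mulVec (v a) =
        ((∑ i, ∑ j, (y i).val * ((P i j).val * (a j).val) : ℕ) : ℤ) := by
      simp only [dotProduct, Matrix.mulVec, Finset.mul_sum, hp, hv, Matrix.of_apply]
      push_cast
      rfl
    rw [e]
    have e2 : (2 * ((∑ i, ∑ j, (y i).val * ((P i j).val * (a j).val) : ℕ) : ℤ)) =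
        ((2 * ∑ i, ∑ j, (y i).val * ((P i j).val * (a j).val) : ℕ) : ℤ) := by push_cast; rfl
    rw [e2, zpow_natCast, I_pow_two_mul]
    congr 1
    push_cast
    simp only [ZMod.natCast_val, ZMod.cast_id', id_eq, dotProduct, Matrix.mulVec, Finset.sum_mul]
    exact Finset.sum_congr rfl fun i _ => Finset.sum_congr rfl fun j _ => by ring
  have hkey : v (y + a) ⬝ᵥ p.mulVec (v (y + a)) + 2 * (v l ⬝ᵥ v (y + a)) =
      (v y ⬝ᵥ p.mulVec (v y) + 2 * (v l ⬝ᵥ v y)) + (v a ⬝ᵥ p.mulVec (v a) + 2 * (v l ⬝ᵥ v a)) +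
        2 * (v y ⬝ᵥ p.mulVec (v a)) +
        4 * (W ⬝ᵥ p.mulVec W - W ⬝ᵥ p.mulVec (v y) - W ⬝ᵥ p.mulVec (v a) - v l ⬝ᵥ W) := by
    rw [hvadd]
    simp only [Matrix.mulVec_add, Matrix.mulVec_sub, Matrix.mulVec_smul, dotProduct_add,
      dotProduct_sub, add_dotProduct, sub_dotProduct, smul_dotProduct, dotProduct_smul, smul_eq_mul]
    rw [hsymm (v a) (v y), hsymm (v y) W, hsymm (v a) W]
    ring
  have h4 : ∀ D : ℤ, Complex.I ^ (4 * D) = 1 := by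
    intro D
    have : Complex.I ^ (4 : ℤ) = 1 := by
      rw [show (4 : ℤ) = ((4 : ℕ) : ℤ) from rfl, zpow_natCast, Complex.I_pow_four]
    rw [zpow_mul, this, one_zpow]
  rw [hexp (y + a), hkey, zpow_add₀ Complex.I_ne_zero, zpow_add₀ Complex.I_ne_zero,
    zpow_add₀ Complex.I_ne_zero, h4, mul_one, ← hexp, ← hexp, ← hB]

/-! ### Large derivatives -/

/-- Correlations survive on average over the derivatives in the directions of any subgroup. -/
theorem card_mul_normSq_sum_le {Γ : Type*} [AddCommGroup Γ] [Fintype Γ] (V : AddSubgroup Γ)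
    [Fintype V] (f : Γ → ℂ) :
    (Fintype.card V : ℝ) * ‖∑ y, f y‖ ^ 2 ≤
      Fintype.card Γ * ∑ a : V, ‖∑ y, f (y + a) * (starRingEnd ℂ) (f y)‖ := by
  have hV : 0 < (Fintype.card V : ℝ) := by exact_mod_cast Fintype.card_pos
  have h1 : ∑ y, ∑ a : V, f (y + a) = Fintype.card V * ∑ y, f y := by
    rw [Finset.sum_comm]
    have : ∀ a : V, ∑ y, f (y + a) = ∑ y, f y := fun a =>
      Fintype.sum_equiv (Equiv.addRight (a : Γ)) _ _ fun _ => rfl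
    simp [this]
  -- expand the square; the correlations depend only on the difference of the two directions
  have h2 : (∑ y, (‖∑ a : V, f (y + a)‖ ^ 2 : ℝ) : ℝ) ≤
      Fintype.card V * ∑ a : V, ‖∑ y, f (y + a) * (starRingEnd ℂ) (f y)‖ := by
    have e : ((∑ y, (‖∑ a : V, f (y + a)‖ ^ 2 : ℝ) : ℝ) : ℂ) =
        Fintype.card V * ∑ a : V, ∑ y, f (y + a) * (starRingEnd ℂ) (f y) := by
      push_cast
      simp only [← Complex.mul_conj', map_sum, Finset.sum_mul_sum]
      rw [Finset.sum_comm]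
      have h3 : ∀ b : V, ∑ y, ∑ a : V, f (y + b) * (starRingEnd ℂ) (f (y + a)) =
          ∑ c : V, ∑ y, f (y + b) * (starRingEnd ℂ) (f (y + b + c)) := by
        intro b
        rw [Finset.sum_comm]
        refine Fintype.sum_equiv (Equiv.subRight b) _ _ fun a => ?_
        refine Finset.sum_congr rfl fun y _ => ?_
        congr 3
        simp only [Equiv.subRight_apply, AddSubgroup.coe_sub]
        abel
      have h4 : ∀ b c : V, ∑ y, f (y + b) * (starRingEnd ℂ) (f (y + b + c)) =
          ∑ y, f (y + (-c : V)) * (starRingEnd ℂ) (f y) := by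
        intro b c
        refine Fintype.sum_equiv (Equiv.addRight ((b : Γ) + c)) _ _ fun y => ?_
        simp only [Equiv.coe_addRight, AddSubgroup.coe_neg]
        congr 2
        · abel
        · congr 1; abel
      simp only [h3, h4]
      rw [Finset.sum_const, Finset.card_univ, nsmul_eq_mul]
      congr 1
      exact Fintype.sum_equiv (Equiv.neg V) _ _ fun _ => rfl
    have e' : (∑ y, (‖∑ a : V, f (y + a)‖ ^ 2 : ℝ) : ℝ) =
        ‖((∑ y, (‖∑ a : V, f (y + a)‖ ^ 2 : ℝ) : ℝ) : ℂ)‖ := by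
      rw [Complex.norm_real, Real.norm_of_nonneg (Finset.sum_nonneg fun _ _ => by positivity)]
    rw [e', e, norm_mul, Complex.norm_natCast]
    gcongr
    exact norm_sum_le _ _
  -- the Cauchy–Schwarz inequality for the averages over the cosets of `V`
  have h5 : (Fintype.card V * ‖∑ y, f y‖) ^ 2 ≤
      Fintype.card Γ * ∑ y, ‖∑ a : V, f (y + a)‖ ^ 2 := by
    have : (Fintype.card V : ℝ) * ‖∑ y, f y‖ = ‖∑ y, ∑ a : V, f (y + a)‖ := by
      rw [h1, norm_mul, Complex.norm_natCast]
    rw [this]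
    calc ‖∑ y, ∑ a : V, f (y + a)‖ ^ 2 ≤ (∑ y, ‖∑ a : V, f (y + a)‖) ^ 2 := by
          gcongr; exact norm_sum_le _ _
      _ ≤ _ := by
          simpa using sq_sum_le_card_mul_sum_sq (s := Finset.univ)
            (f := fun y => ‖∑ a : V, f (y + a)‖)
  have h6 : (Fintype.card V : ℝ) * ((Fintype.card V : ℝ) * ‖∑ y, f y‖ ^ 2) ≤
      Fintype.card V *
        (Fintype.card Γ * ∑ a : V, ‖∑ y, f (y + a) * (starRingEnd ℂ) (f y)‖) := by
    calc _ = (Fintype.card V * ‖∑ y, f y‖) ^ 2 := by ring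
      _ ≤ Fintype.card Γ * ∑ y, ‖∑ a : V, f (y + a)‖ ^ 2 := h5
      _ ≤ Fintype.card Γ *
          (Fintype.card V * ∑ a : V, ‖∑ y, f (y + a) * (starRingEnd ℂ) (f y)‖) := by gcongr
      _ = _ := by ring
  exact le_of_mul_le_mul_left h6 hV

/-- The multiplicative derivative of `h` in direction `a`. -/
noncomputable def derivative {n : ℕ} (h : (Fin n → ZMod 2) → ℂ) (a y : Fin n → ZMod 2) : ℂ :=
  h (y + a) * (starRingEnd ℂ) (h y)

/-- The vectors supported on the first `m` coordinates. -/
def initialVectors (n m : ℕ) : AddSubgroup (Fin n → ZMod 2) where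
  carrier := {a | ∀ j : Fin n, m ≤ (j : ℕ) → a j = 0}
  zero_mem' := fun _ _ => rfl
  add_mem' := fun ha hb j hj => by rw [Pi.add_apply, ha j hj, hb j hj, add_zero]
  neg_mem' := fun ha j hj => by rw [Pi.neg_apply, ha j hj, neg_zero]

theorem two_pow_le_card_initialVectors {n m : ℕ} (h : m ≤ n) [Fintype (initialVectors n m)] :
    2 ^ m ≤ Fintype.card (initialVectors n m) := by
  have e : 2 ^ m = Fintype.card (Fin m → ZMod 2) := by simp [ZMod.card]
  rw [e]
  refine Fintype.card_le_of_injective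
    (fun u => ⟨fun j => if hj : (j : ℕ) < m then u ⟨j, hj⟩ else 0, fun j hj => ?_⟩) ?_
  · simp [not_lt.mpr hj]
  · intro u v huv
    funext j
    have := congrFun (congrArg Subtype.val huv) ⟨j, by omega⟩
    simpa using this

/-- If `h` correlates with the phase of `(P, l)`, then its derivative in some direction `a ≠ 0` that
is supported on the first `m` coordinates correlates with the character `P a`. The hypothesis
`2 < 2 ^ m * η` ensures that the direction `0` does not account for the whole average over these
directions. -/
theorem exists_large_derivative {n m : ℕ} {P : Matrix (Fin n) (Fin n) (ZMod 2)}
    (hP : IsHankel P) (l : Fin n → ZMod 2) (h : (Fin n → ZMod 2) → ℂ) {θ η : ℝ} (hθ : 0 < θ)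
    (hη : 0 < η) (hh : ∀ y, Complex.normSq (h y) ≤ θ) (hmn : m ≤ n) (hm : 2 < 2 ^ m * η)
    (hc : θ * (2 ^ n) ^ 2 * η ≤ Complex.normSq (∑ y, h y * (starRingEnd ℂ) (phase P l y))) :
    ∃ a : Fin n → ZMod 2, a ≠ 0 ∧ (∀ j : Fin n, m ≤ (j : ℕ) → a j = 0) ∧
      (θ * 2 ^ n * η / 2) ^ 2 ≤
        Complex.normSq (∑ y, sgn (P.mulVec a ⬝ᵥ y) * derivative h a y) := by
  classical
  by_contra! hcon
  set N : ℝ := 2 ^ n with hN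
  have hN0 : 0 < N := by positivity
  have hcard : (Fintype.card (Fin n → ZMod 2) : ℝ) = N := by simp [hN, ZMod.card]
  set f : (Fin n → ZMod 2) → ℂ := fun y => h y * (starRingEnd ℂ) (phase P l y) with hf
  have hder : ∀ a, ‖∑ y, f (y + a) * (starRingEnd ℂ) (f y)‖ =
      ‖∑ y, sgn (P.mulVec a ⬝ᵥ y) * derivative h a y‖ := by
    intro a
    have : ∀ y, f (y + a) * (starRingEnd ℂ) (f y) =
        (starRingEnd ℂ) (phase P l a) * (sgn (P.mulVec a ⬝ᵥ y) * derivative h a y) := by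
      intro y
      have h1 : (starRingEnd ℂ) (phase P l y) * phase P l y = 1 := by
        rw [mul_comm, Complex.mul_conj, normSq_phase, Complex.ofReal_one]
      simp only [hf, phase_add hP.isSymm, map_mul, conj_sgn, Complex.conj_conj, derivative]
      linear_combination (h (y + a) * (starRingEnd ℂ) (h y) * (starRingEnd ℂ) (phase P l a) *
        sgn (P.mulVec a ⬝ᵥ y)) * h1
    simp only [this]
    rw [← Finset.mul_sum, norm_mul]
    have h2 : ‖(starRingEnd ℂ) (phase P l a)‖ = 1 := by
      rw [Complex.norm_conj, Complex.norm_def, normSq_phase, Real.sqrt_one]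
    rw [h2, one_mul]
  have hsq : ∀ y, ‖h y‖ ^ 2 ≤ θ := fun y => by
    rw [← Complex.normSq_eq_norm_sq]; exact hh y
  -- the bound used for the direction `0`
  have htriv : ∀ a, ‖∑ y, f (y + a) * (starRingEnd ℂ) (f y)‖ ≤ N * θ := by
    intro a
    rw [hder]
    calc _ ≤ ∑ y : Fin n → ZMod 2, ‖sgn (P.mulVec a ⬝ᵥ y) * derivative h a y‖ := norm_sum_le _ _
      _ ≤ ∑ y : Fin n → ZMod 2, θ := by
          refine Finset.sum_le_sum fun y _ => ?_
          rw [norm_mul, derivative, norm_mul, Complex.norm_conj, Complex.norm_def (sgn _),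
            normSq_sgn, Real.sqrt_one, one_mul]
          nlinarith [hsq y, hsq (y + a), sq_nonneg (‖h (y + a)‖ - ‖h y‖)]
      _ = N * θ := by rw [Finset.sum_const, Finset.card_univ, nsmul_eq_mul, hcard]
  set V := initialVectors n m with hV
  have hmain := card_mul_normSq_sum_le V f
  rw [hcard] at hmain
  have hVc : (2 : ℝ) ^ m ≤ Fintype.card V := by
    exact_mod_cast two_pow_le_card_initialVectors hmn
  have hsmall : ∀ a : V, a ≠ 0 →
      ‖∑ y, f (y + a) * (starRingEnd ℂ) (f y)‖ ≤ θ * N * η / 2 := by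
    intro a ha
    have h1 := hcon a (fun h0 => ha (Subtype.ext h0)) a.2
    rw [Complex.normSq_eq_norm_sq, ← hder] at h1
    exact (abs_le_of_sq_le_sq' h1.le (by positivity)).2
  have hsum : ∑ a : V, ‖∑ y, f (y + a) * (starRingEnd ℂ) (f y)‖ ≤
      N * θ + Fintype.card V * (θ * N * η / 2) := by
    rw [← Finset.add_sum_erase _ _ (Finset.mem_univ (0 : V))]
    refine add_le_add (htriv _) ?_
    calc _ ≤ ∑ a ∈ Finset.univ.erase (0 : V), θ * N * η / 2 :=
          Finset.sum_le_sum fun a ha => hsmall a (Finset.ne_of_mem_erase ha)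
      _ ≤ ∑ a : V, θ * N * η / 2 :=
          Finset.sum_le_sum_of_subset_of_nonneg (Finset.subset_univ _)
            fun _ _ _ => by positivity
      _ = _ := by rw [Finset.sum_const, Finset.card_univ, nsmul_eq_mul]
  rw [← Complex.normSq_eq_norm_sq] at hmain
  have h1 : (Fintype.card V : ℝ) * (θ * N ^ 2 * η) ≤
      N * (N * θ + Fintype.card V * (θ * N * η / 2)) :=
    (mul_le_mul_of_nonneg_left hc (Nat.cast_nonneg _)).trans
      (hmain.trans (mul_le_mul_of_nonneg_left hsum hN0.le))
  have h2 : (Fintype.card V * η) * (θ * N ^ 2) ≤ 2 * (θ * N ^ 2) := by nlinarith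
  have h3 : (Fintype.card V : ℝ) * η ≤ 2 := le_of_mul_le_mul_right h2 (by positivity)
  nlinarith

/-! ### Truncation -/

/-- The signal with all entries of squared modulus above `θ` replaced by zero. -/
noncomputable def truncate {n : ℕ} (θ : ℝ) (s : (Fin n → ZMod 2) → ℂ) (y : Fin n → ZMod 2) : ℂ :=
  open Classical in if Complex.normSq (s y) ≤ θ then s y else 0

theorem normSq_truncate_le {n : ℕ} {θ : ℝ} (hθ : 0 ≤ θ) (s : (Fin n → ZMod 2) → ℂ)
    (y : Fin n → ZMod 2) : Complex.normSq (truncate θ s y) ≤ θ := by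
  rw [truncate]
  split_ifs with h
  · exact h
  · simpa using hθ

/-- A random entry of a signal that correlates with a unimodular function gives, with probability
at least `1 / (16 k)`, a level at which the signal can be truncated without losing the
correlation. -/
theorem exists_truncation {n : ℕ} (s g : (Fin n → ZMod 2) → ℂ) {k : ℝ} (hk : 1 ≤ k)
    (hg : ∀ y, Complex.normSq (g y) = 1) (hs : 0 < ∑ y, Complex.normSq (s y))
    (hc : 2 ^ n * (∑ y, Complex.normSq (s y)) / k ≤
      Complex.normSq (∑ y, s y * (starRingEnd ℂ) (g y))) :
    ∃ 𝒢 : Finset (Fin n → ZMod 2), 2 ^ n / (16 * k) ≤ (𝒢.card : ℝ) ∧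
      ∀ y₀ ∈ 𝒢, 0 < 16 * k ^ 2 * Complex.normSq (s y₀) ∧
        16 * k ^ 2 * Complex.normSq (s y₀) * (2 ^ n) ^ 2 * (1 / (1024 * k ^ 4)) ≤
          Complex.normSq (∑ y, truncate (16 * k ^ 2 * Complex.normSq (s y₀)) s y *
            (starRingEnd ℂ) (g y)) := by
  classical
  set N : ℝ := 2 ^ n with hN
  have hN0 : 0 < N := by positivity
  have hk0 : 0 < k := by linarith
  have hcard : (Fintype.card (Fin n → ZMod 2) : ℝ) = N := by simp [hN, ZMod.card]
  set E := ∑ y, Complex.normSq (s y) with hE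
  set u : ℝ := Real.sqrt (N * E / k) with hu
  have hu0 : 0 < u := Real.sqrt_pos.mpr (by positivity)
  have hu2 : u ^ 2 = N * E / k := Real.sq_sqrt (by positivity)
  have hEu : E = u ^ 2 * k / N := by rw [hu2]; field_simp
  have hE2 : E = ∑ y, ‖s y‖ ^ 2 := by simp [hE, Complex.normSq_eq_norm_sq]
  have hgn : ∀ y, ‖(starRingEnd ℂ) (g y)‖ = 1 := fun y => by
    rw [Complex.norm_conj, Complex.norm_def, hg, Real.sqrt_one]
  have hcu : u ≤ ‖∑ y, s y * (starRingEnd ℂ) (g y)‖ := by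
    rw [Complex.normSq_eq_norm_sq, ← hu2] at hc
    exact (abs_le_of_sq_le_sq' hc (norm_nonneg _)).2
  -- Entries of modulus below `u / (2 N)` contribute at most `u / 2` to the sum of all moduli, and
  -- those above `4 k u / N` contribute at most `u / 4`.
  refine ⟨Finset.univ.filter fun y => u / (2 * N) ≤ ‖s y‖ ∧ ‖s y‖ ≤ 4 * k * u / N, ?_, ?_⟩
  · have hpt : ∀ y, ‖s y‖ ≤ u / (2 * N) + (if u / (2 * N) ≤ ‖s y‖ ∧ ‖s y‖ ≤ 4 * k * u / N
        then 4 * k * u / N else 0) + ‖s y‖ ^ 2 * (N / (4 * k * u)) := by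
      intro y
      have hp1 : 0 < u / (2 * N) := by positivity
      have hp2 : 0 ≤ ‖s y‖ ^ 2 * (N / (4 * k * u)) := by positivity
      have hp3 : 0 < 4 * k * u / N := by positivity
      by_cases h1 : u / (2 * N) ≤ ‖s y‖
      · by_cases h2 : ‖s y‖ ≤ 4 * k * u / N
        · rw [if_pos ⟨h1, h2⟩]; linarith
        · rw [if_neg fun h => h2 h.2]
          push Not at h2
          have e : ‖s y‖ ^ 2 * (N / (4 * k * u)) = ‖s y‖ * (‖s y‖ / (4 * k * u / N)) := by
            field_simp
          have h3 : 1 ≤ ‖s y‖ / (4 * k * u / N) := (one_le_div hp3).mpr h2.le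
          rw [e]
          nlinarith [norm_nonneg (s y)]
      · rw [if_neg fun h => h1 h.1]; linarith
    have hsum : u ≤ u / 2 + (Finset.univ.filter fun y => u / (2 * N) ≤ ‖s y‖ ∧
        ‖s y‖ ≤ 4 * k * u / N).card * (4 * k * u / N) + u / 4 := by
      calc u ≤ ∑ y, ‖s y‖ := by
            refine hcu.trans ((norm_sum_le _ _).trans (le_of_eq ?_))
            simp only [norm_mul, hgn, mul_one]
        _ ≤ ∑ y, (u / (2 * N) + (if u / (2 * N) ≤ ‖s y‖ ∧ ‖s y‖ ≤ 4 * k * u / N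
              then 4 * k * u / N else 0) + ‖s y‖ ^ 2 * (N / (4 * k * u))) :=
            Finset.sum_le_sum fun y _ => hpt y
        _ = N * (u / (2 * N)) + (Finset.univ.filter fun y => u / (2 * N) ≤ ‖s y‖ ∧
              ‖s y‖ ≤ 4 * k * u / N).card * (4 * k * u / N) + E * (N / (4 * k * u)) := by
            rw [Finset.sum_add_distrib, Finset.sum_add_distrib, ← Finset.sum_mul, ← hE2,
              Finset.sum_const, Finset.card_univ, nsmul_eq_mul, hcard, ← Finset.sum_filter,
              Finset.sum_const, nsmul_eq_mul]
        _ = _ := by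
            have e1 : N * (u / (2 * N)) = u / 2 := by field_simp
            have e2 : E * (N / (4 * k * u)) = u / 4 := by rw [hEu]; field_simp
            rw [e1, e2]
    set G : ℝ := ((Finset.univ.filter fun y => u / (2 * N) ≤ ‖s y‖ ∧
        ‖s y‖ ≤ 4 * k * u / N).card : ℝ) with hG
    rw [div_le_iff₀ (by positivity)]
    have h1 : u / 4 ≤ G * (4 * k * u / N) := by linarith
    have h2 : G * (4 * k * u / N) = (G * (16 * k)) * (u / (4 * N)) := by field_simp; ring
    have h3 : u / 4 = N * (u / (4 * N)) := by field_simp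
    rw [h2, h3] at h1
    exact le_of_mul_le_mul_right h1 (by positivity)
  · intro y₀ hy₀
    obtain ⟨hlo, hhi⟩ := (Finset.mem_filter.mp hy₀).2
    set τ : ℝ := 4 * k * ‖s y₀‖ with hτ
    have hθ : 16 * k ^ 2 * Complex.normSq (s y₀) = τ ^ 2 := by
      rw [Complex.normSq_eq_norm_sq]; ring
    rw [hθ]
    have hτlo : 2 * k * u / N ≤ τ := by
      calc 2 * k * u / N = 4 * k * (u / (2 * N)) := by field_simp; ring
        _ ≤ τ := by rw [hτ]; gcongr
    have hτhi : τ ≤ 16 * k ^ 2 * u / N := by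
      calc τ ≤ 4 * k * (4 * k * u / N) := by rw [hτ]; gcongr
        _ = _ := by ring
    have hτ0 : 0 < τ := lt_of_lt_of_le (by positivity) hτlo
    refine ⟨by positivity, ?_⟩
    -- as `2 k u / N ≤ τ`, the truncation changes the correlation by at most `u / 2`
    have hpt : ∀ y, ‖s y - truncate (τ ^ 2) s y‖ ≤ ‖s y‖ ^ 2 * (N / (2 * k * u)) := by
      intro y
      rw [truncate]
      split_ifs with h
      · rw [sub_self, norm_zero]; positivity
      · rw [sub_zero]
        have h1 : τ ≤ ‖s y‖ := by
          rw [Complex.normSq_eq_norm_sq] at h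
          push Not at h
          exact (abs_le_of_sq_le_sq' h.le (norm_nonneg _)).2
        have e : ‖s y‖ ^ 2 * (N / (2 * k * u)) = ‖s y‖ * (‖s y‖ / (2 * k * u / N)) := by
          field_simp
        have h3 : 1 ≤ ‖s y‖ / (2 * k * u / N) :=
          (one_le_div (by positivity)).mpr (hτlo.trans h1)
        rw [e]
        nlinarith [norm_nonneg (s y)]
    have hdiff : ‖∑ y, s y * (starRingEnd ℂ) (g y) -
        ∑ y, truncate (τ ^ 2) s y * (starRingEnd ℂ) (g y)‖ ≤ u / 2 := by
      rw [← Finset.sum_sub_distrib]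
      calc _ ≤ ∑ y, ‖s y * (starRingEnd ℂ) (g y) - truncate (τ ^ 2) s y * (starRingEnd ℂ) (g y)‖ :=
            norm_sum_le _ _
        _ ≤ ∑ y, ‖s y‖ ^ 2 * (N / (2 * k * u)) := by
            refine Finset.sum_le_sum fun y _ => ?_
            rw [← sub_mul, norm_mul, hgn, mul_one]
            exact hpt y
        _ = u / 2 := by
            rw [← Finset.sum_mul, ← hE2, hEu]
            field_simp
    have hres : u / 2 ≤ ‖∑ y, truncate (τ ^ 2) s y * (starRingEnd ℂ) (g y)‖ := by
      have := norm_sub_norm_le (∑ y, s y * (starRingEnd ℂ) (g y))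
        (∑ y, truncate (τ ^ 2) s y * (starRingEnd ℂ) (g y))
      linarith
    rw [Complex.normSq_eq_norm_sq]
    calc τ ^ 2 * N ^ 2 * (1 / (1024 * k ^ 4))
        ≤ (16 * k ^ 2 * u / N) ^ 2 * N ^ 2 * (1 / (1024 * k ^ 4)) := by gcongr
      _ = (u / 2) ^ 2 := by field_simp; ring
      _ ≤ _ := by gcongr

/-! ### Linear recurrences of Hankel matrices -/

/-- The largest `j < i` with `a j = 1`, or `m` if there is none. -/
def lastOne (a : ℕ → ZMod 2) (m : ℕ) : ℕ → ℕ
  | 0 => m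
  | i + 1 => if a i = 1 then i else lastOne a m i

/-- The sequence with initial values `g` that satisfies the linear recurrence of order `d` with
coefficients `a` and inhomogeneity `α`. -/
def solveRecurrence (a g α : ℕ → ZMod 2) (d q : ℕ) : ZMod 2 :=
  if _h : q < d then g q
  else α (q - d) + ∑ j : Fin d, a j * solveRecurrence a g α d (q - d + j)
termination_by q
decreasing_by omega

theorem lastOne_cases (a : ℕ → ZMod 2) (m i : ℕ) :
    (lastOne a m i = m ∧ ∀ j < i, a j = 0) ∨
      (lastOne a m i < i ∧ a (lastOne a m i) = 1 ∧ ∀ j < i, lastOne a m i < j → a j = 0) := by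
  induction i with
  | zero => exact Or.inl ⟨rfl, fun j hj => absurd hj (Nat.not_lt_zero j)⟩
  | succ i ih =>
    rw [lastOne]
    split_ifs with h
    · refine Or.inr ⟨by omega, h, fun j hj hj' => by omega⟩
    · have h0 : a i = 0 := (zmod_two_cases _).resolve_right h
      rcases ih with ⟨h1, h2⟩ | ⟨h1, h2, h3⟩
      · refine Or.inl ⟨h1, fun j hj => ?_⟩
        rcases Nat.lt_succ_iff_lt_or_eq.mp hj with h | rfl
        · exact h2 j h
        · exact h0
      · refine Or.inr ⟨by omega, h2, fun j hj hj' => ?_⟩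
        rcases Nat.lt_succ_iff_lt_or_eq.mp hj with h | rfl
        · exact h3 j h hj'
        · exact h0

/-- The first row of a Hankel matrix `P` satisfies the linear recurrence with coefficients `a` and
inhomogeneity `P a`, of order the last index `d` with `a d = 1`: entry `q - d` of `P a` contains
`P 0 q` with coefficient `1` and otherwise only earlier entries of the row. If `n ≤ d`, all entries
are initial values. -/
theorem solveRecurrence_eq {n d : ℕ} (hn : 0 < n) {P : Matrix (Fin n) (Fin n) (ZMod 2)}
    (hP : IsHankel P) {a g α : ℕ → ZMod 2}
    (hd : d < n → a d = 1 ∧ ∀ j, d < j → a j = 0)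
    (hα : d < n → ∀ z : Fin n, α z = P.mulVec (fun j => a j) z)
    (hg : ∀ q : Fin n, (q : ℕ) < d → g q = P ⟨0, hn⟩ q) (q : Fin n) :
    solveRecurrence a g α d q = P ⟨0, hn⟩ q := by
  obtain ⟨q, hq⟩ := q
  induction q using Nat.strong_induction_on with
  | _ q ih =>
    rw [solveRecurrence]
    by_cases h : q < d
    · rw [dif_pos h]
      exact hg ⟨q, hq⟩ h
    rw [dif_neg h]
    have hdn : d < n := by omega
    obtain ⟨had, ha⟩ := hd hdn
    set p : ℕ → ZMod 2 := fun i => if hi : i < n then P ⟨0, hn⟩ ⟨i, hi⟩ else 0 with hp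
    have h1 : ∑ j : Fin d, a j * solveRecurrence a g α d (q - d + j) =
        ∑ j ∈ Finset.range d, p (q - d + j) * a j := by
      rw [← Fin.sum_univ_eq_sum_range (fun j => p (q - d + j) * a j)]
      refine Finset.sum_congr rfl fun j _ => ?_
      have hj := j.isLt
      have hlt : q - d + j < n := by omega
      have := ih (q - d + j) (by omega) hlt
      simp only at this
      rw [this, hp]
      simp only [hlt, dif_pos]
      ring
    have h2 : α (q - d) = ∑ j ∈ Finset.range (d + 1), p (q - d + j) * a j := by
      have := hα hdn ⟨q - d, by omega⟩
      simp only at this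
      rw [this, Matrix.mulVec, dotProduct]
      have h3 : ∀ j : Fin n, P ⟨q - d, by omega⟩ j * a j = p (q - d + j) * a j := by
        intro j
        by_cases hj : d < (j : ℕ)
        · rw [ha j hj, mul_zero, mul_zero]
        · have hlt : q - d + j < n := by omega
          simp only [hp, hlt, dif_pos]
          rw [hP ⟨q - d, by omega⟩ j ⟨0, hn⟩ ⟨q - d + j, hlt⟩ (by simp)]
      rw [Finset.sum_congr rfl fun j _ => h3 j,
        Fin.sum_univ_eq_sum_range (fun j => p (q - d + j) * a j)]
      refine (Finset.sum_subset (Finset.range_mono (by omega)) fun j _ hj => ?_).symm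
      rw [Finset.mem_range] at hj
      rw [ha j (by omega), mul_zero]
    rw [h1, h2, Finset.sum_range_succ, had, mul_one, Nat.sub_add_cancel (by omega), hp,
      add_right_comm, CharTwo.add_self_eq_zero, zero_add]
    simp [hq]

/-! ### Decoding of a label from random bits -/

/-- The first row of the Hankel matrix, decoded from a guess `a` of a direction with large
derivative, a guess `g` of its initial values, and the rows `ρ` of a labelled cube. For `a = 0` the
order of the recurrence is `m`. -/
noncomputable def decodeRow {n : ℕ} (h : (Fin n → ZMod 2) → ℂ) (m : ℕ) (a g : ℕ → ZMod 2)
    (ρ : ℕ → ℕ → ZMod 2) (q : ℕ) : ZMod 2 :=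
  solveRecurrence a g (cubeBit (derivative h fun j => a j) ρ m) (lastOne a m m) q

/-- Reversal of the coordinates. -/
def reversed {n : ℕ} (h : (Fin n → ZMod 2) → ℂ) (y : Fin n → ZMod 2) : ℂ := h fun j => y j.rev

/-- The Hankel matrix with first row `p` and with last row `p'`, the latter read backwards. -/
def hankelOf (n : ℕ) (p p' : ℕ → ZMod 2) : Matrix (Fin n) (Fin n) (ZMod 2) :=
  Matrix.of fun i j =>
    if n - 1 ≤ (i : ℕ) + j then p' (2 * n - 2 - ((i : ℕ) + j)) else p ((i : ℕ) + j)

theorem isHankel_hankelOf (n : ℕ) (p p' : ℕ → ZMod 2) : IsHankel (hankelOf n p p') := by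
  intro i j i' j' h
  simp only [hankelOf, Matrix.of_apply, h]

/-- The signal with the quadratic part of a phase removed. -/
noncomputable def dechirp {n : ℕ} (h : (Fin n → ZMod 2) → ℂ) (P : Matrix (Fin n) (Fin n) (ZMod 2))
    (y : Fin n → ZMod 2) : ℂ := h y * (starRingEnd ℂ) (phase P 0 y)

/-- The label decoded from guesses and labelled cubes: the two halves of the matrix are decoded from
the signal and from the reversed signal. -/
noncomputable def decodeLabel {n : ℕ} (h : (Fin n → ZMod 2) → ℂ) (m : ℕ) (a g : ℕ → ZMod 2)
    (ρ : ℕ → ℕ → ZMod 2) (a' g' : ℕ → ZMod 2) (ρ' ρ'' : ℕ → ℕ → ZMod 2) : Label n :=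
  (hankelOf n (decodeRow h m a g ρ) (decodeRow (reversed h) m a' g' ρ'), fun z =>
    cubeBit (dechirp h (hankelOf n (decodeRow h m a g ρ) (decodeRow (reversed h) m a' g' ρ')))
      ρ'' m z)

theorem hankelOf_eq {n : ℕ} (hn : 0 < n) {P : Matrix (Fin n) (Fin n) (ZMod 2)} (hP : IsHankel P)
    {p p' : ℕ → ZMod 2} (hp : ∀ q : Fin n, p q = P ⟨0, hn⟩ q)
    (hp' : ∀ q : Fin n, p' q = P (Fin.rev ⟨0, hn⟩) q.rev) : hankelOf n p p' = P := by
  ext i j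
  have hi := i.isLt
  have hj := j.isLt
  rw [hankelOf, Matrix.of_apply]
  split_ifs with h
  · have := hp' ⟨2 * n - 2 - ((i : ℕ) + j), by omega⟩
    simp only at this
    rw [this]
    refine hP _ _ _ _ ?_
    simp only [Fin.val_rev]
    omega
  · have := hp ⟨(i : ℕ) + j, by omega⟩
    simp only at this
    rw [this]
    exact hP _ _ _ _ (by simp)

/-- For a suitable guess of a direction and of initial values, half of all labelled cubes lead to
the first row of the matrix. -/
theorem exists_decodeRow_eq {n m : ℕ} (hn : 0 < n) {P : Matrix (Fin n) (Fin n) (ZMod 2)}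
    (hP : IsHankel P) (l : Fin n → ZMod 2) (h : (Fin n → ZMod 2) → ℂ) {θ η : ℝ} (hθ : 0 < θ)
    (hη : 0 < η) (hh : ∀ y, Complex.normSq (h y) ≤ θ) (hm : 2 < 2 ^ m * η)
    (hm' : 32 * (n + 1) ≤ 2 ^ m * η ^ 2)
    (hc : θ * (2 ^ n) ^ 2 * η ≤ Complex.normSq (∑ y, h y * (starRingEnd ℂ) (phase P l y))) :
    ∃ a g : ℕ → ZMod 2, (∀ j, m ≤ j → a j = 0 ∧ g j = 0) ∧
      ∃ (α : Fin n → ZMod 2) (𝒴 : Finset (Fin (m + 1) → Fin n → ZMod 2)),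
        ((2 : ℝ) ^ n) ^ (m + 1) / 2 ≤ 𝒴.card ∧
        ∀ Y ∈ 𝒴, ∀ ρ, RowsMatch α Y ρ →
          ∀ q : Fin n, decodeRow h m a g ρ q = P ⟨0, hn⟩ q := by
  set g : ℕ → ZMod 2 := fun q => if hq : q < n ∧ q < m then P ⟨0, hn⟩ ⟨q, hq.1⟩ else 0 with hg
  have hgm : ∀ j, m ≤ j → g j = 0 := fun j hj => by
    simp only [hg]; rw [dif_neg]; omega
  have hgq : ∀ q : Fin n, (q : ℕ) < m → g q = P ⟨0, hn⟩ q := fun q hq => by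
    simp only [hg]; rw [dif_pos ⟨q.isLt, hq⟩]
  rcases Nat.lt_or_ge n m with hnm | hmn
  · -- the direction `0` gives order `m`, so that all entries of the row are guessed
    refine ⟨0, g, fun j hj => ⟨rfl, hgm j hj⟩, 0, Finset.univ, ?_, fun Y _ ρ _ q => ?_⟩
    · rw [Finset.card_univ]
      simp only [Fintype.card_fun, Fintype.card_fin, ZMod.card]
      push_cast
      have : (0 : ℝ) < (2 ^ n) ^ (m + 1) := by positivity
      linarith
    · have hd : lastOne (0 : ℕ → ZMod 2) m m = m := by
        rcases lastOne_cases 0 m m with h | h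
        · exact h.1
        · exact absurd h.2.1 (by simp)
      rw [decodeRow, hd]
      exact solveRecurrence_eq hn hP (fun h => by omega) (fun h => by omega) hgq q
  · obtain ⟨a, ha0, ham, hlarge⟩ := exists_large_derivative hP l h hθ hη hh hmn hm hc
    have hderiv : ∀ y, Complex.normSq (derivative h a y) ≤ θ ^ 2 := by
      intro y
      rw [derivative, Complex.normSq_mul, Complex.normSq_conj, sq]
      exact mul_le_mul (hh _) (hh _) (Complex.normSq_nonneg _) hθ.le
    obtain ⟨𝒴, hcard, h𝒴⟩ := half_le_card_decoding (m := m) (derivative h a) (P.mulVec a)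
      (b := θ ^ 2) (by positivity) hderiv (by
        calc 8 * (n + 1) * θ ^ 2 * ((2 : ℝ) ^ n) ^ 2
            = (32 * (n + 1)) * (θ ^ 2 * ((2 : ℝ) ^ n) ^ 2 / 4) := by ring
          _ ≤ (2 ^ m * η ^ 2) * (θ ^ 2 * ((2 : ℝ) ^ n) ^ 2 / 4) := by gcongr
          _ = 2 ^ m * (θ * 2 ^ n * η / 2) ^ 2 := by ring
          _ ≤ _ := by gcongr)
    set a' : ℕ → ZMod 2 := fun j => if hj : j < n then a ⟨j, hj⟩ else 0 with ha'
    have haa : (fun j : Fin n => a' j) = a := by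
      funext j
      simp [ha']
    have ham' : ∀ j, m ≤ j → a' j = 0 := by
      intro j hj
      simp only [ha']
      split_ifs with h
      · exact ham ⟨j, h⟩ hj
      · rfl
    refine ⟨a', g, fun j hj => ⟨ham' j hj, hgm j hj⟩, P.mulVec a, 𝒴, hcard,
      fun Y hY ρ hρ q => ?_⟩
    rw [decodeRow, haa]
    have hd : lastOne a' m m < m ∧ a' (lastOne a' m m) = 1 ∧
        ∀ j < m, lastOne a' m m < j → a' j = 0 := by
      rcases lastOne_cases a' m m with h | h
      · exfalso
        apply ha0
        rw [← haa]
        funext j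
        rcases Nat.lt_or_ge j m with hj | hj
        · exact h.2 j hj
        · exact ham' j hj
      · exact h
    refine solveRecurrence_eq hn hP (fun _ => ⟨hd.2.1, fun j hj => ?_⟩) (fun _ z => ?_)
      (fun q hq => hgq q (by omega)) q
    · rcases Nat.lt_or_ge j m with hjm | hjm
      · exact hd.2.2 j hjm hj
      · exact ham' j hjm
    · rw [haa]
      exact h𝒴 Y hY ρ hρ z

theorem phase_comp_rev {n : ℕ} (P : Matrix (Fin n) (Fin n) (ZMod 2)) (l y : Fin n → ZMod 2) :
    phase (P.submatrix Fin.rev Fin.rev) (fun j => l j.rev) (fun j => y j.rev) = phase P l y := by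
  rw [phase, phase]
  congr 2
  · rw [← Equiv.sum_comp Fin.revPerm]
    refine Finset.sum_congr rfl fun i _ => ?_
    rw [← Equiv.sum_comp Fin.revPerm]
    refine Finset.sum_congr rfl fun j _ => ?_
    simp
  · rw [← Equiv.sum_comp Fin.revPerm]
    simp

/-- The guesses and cubes that decode to a label whose codeword correlates with `h`. -/
theorem exists_decodeLabel_eq {n m : ℕ} (hn : 0 < n) {P : Matrix (Fin n) (Fin n) (ZMod 2)}
    (hP : IsHankel P) (l : Fin n → ZMod 2) (h : (Fin n → ZMod 2) → ℂ) {θ η : ℝ} (hθ : 0 < θ)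
    (hη : 0 < η) (hη1 : η ≤ 1) (hh : ∀ y, Complex.normSq (h y) ≤ θ)
    (hm' : 32 * (n + 1) ≤ 2 ^ m * η ^ 2)
    (hc : θ * (2 ^ n) ^ 2 * η ≤ Complex.normSq (∑ y, h y * (starRingEnd ℂ) (phase P l y))) :
    ∃ a g a' g' : ℕ → ZMod 2,
      (∀ j, m ≤ j → a j = 0 ∧ g j = 0) ∧ (∀ j, m ≤ j → a' j = 0 ∧ g' j = 0) ∧
      ∃ (α α' : Fin n → ZMod 2) (𝒴 𝒴' 𝒴'' : Finset (Fin (m + 1) → Fin n → ZMod 2)),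
        ((2 : ℝ) ^ n) ^ (m + 1) / 2 ≤ 𝒴.card ∧ ((2 : ℝ) ^ n) ^ (m + 1) / 2 ≤ 𝒴'.card ∧
        ((2 : ℝ) ^ n) ^ (m + 1) / 2 ≤ 𝒴''.card ∧
        ∀ Y ∈ 𝒴, ∀ Y' ∈ 𝒴', ∀ Y'' ∈ 𝒴'', ∀ ρ ρ' ρ'', RowsMatch α Y ρ → RowsMatch α' Y' ρ' →
          RowsMatch l Y'' ρ'' → decodeLabel h m a g ρ a' g' ρ' ρ'' = (P, l) := by
  have hn1 : (1 : ℝ) ≤ n := by exact_mod_cast hn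
  have hmη : 32 * ((n : ℝ) + 1) ≤ 2 ^ m * η := by
    refine hm'.trans (mul_le_mul_of_nonneg_left ?_ (by positivity))
    nlinarith
  have hm : 2 < 2 ^ m * η := by linarith
  obtain ⟨a, g, hag, α, 𝒴, hcard, h𝒴⟩ := exists_decodeRow_eq hn hP l h hθ hη hh hm hm' hc
  have hP' : IsHankel (P.submatrix Fin.rev Fin.rev) := by
    intro i j i' j' hij
    refine hP _ _ _ _ ?_
    simp only [Fin.val_rev]
    omega
  have hc' : θ * (2 ^ n) ^ 2 * η ≤ Complex.normSq (∑ y, reversed h y *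
      (starRingEnd ℂ) (phase (P.submatrix Fin.rev Fin.rev) (fun j => l j.rev) y)) := by
    refine hc.trans (le_of_eq ?_)
    congr 1
    refine Fintype.sum_equiv (Equiv.arrowCongr Fin.revPerm (Equiv.refl (ZMod 2))) _ _ fun y => ?_
    have e : (Equiv.arrowCongr Fin.revPerm (Equiv.refl (ZMod 2))) y = fun j => y j.rev := by
      funext j
      simp [Equiv.arrowCongr]
    rw [e, phase_comp_rev, reversed]
    simp
  obtain ⟨a', g', hag', α', 𝒴', hcard', h𝒴'⟩ := exists_decodeRow_eq hn hP' (fun j => l j.rev)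
    (reversed h) hθ hη (fun y => hh _) hm hm' hc'
  have hd : ∀ y, Complex.normSq (dechirp h P y) ≤ θ := by
    intro y
    rw [dechirp, Complex.normSq_mul, Complex.normSq_conj, normSq_phase, mul_one]
    exact hh y
  obtain ⟨𝒴'', hcard'', h𝒴''⟩ := half_le_card_decoding (m := m) (dechirp h P) l hθ hd (by
      have e : ∑ y, sgn (l ⬝ᵥ y) * dechirp h P y =
          ∑ y, h y * (starRingEnd ℂ) (phase P l y) := by
        refine Finset.sum_congr rfl fun y _ => ?_
        rw [phase_eq_mul_sgn P l, map_mul, conj_sgn, dechirp]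
        ring
      rw [e]
      calc 8 * (n + 1) * θ * ((2 : ℝ) ^ n) ^ 2 ≤
            (32 * (n + 1)) * (θ * ((2 : ℝ) ^ n) ^ 2) := by
              have : 0 ≤ (n + 1) * θ * ((2 : ℝ) ^ n) ^ 2 := by positivity
              linarith
        _ ≤ (2 ^ m * η) * (θ * ((2 : ℝ) ^ n) ^ 2) := by gcongr
        _ = 2 ^ m * (θ * (2 ^ n) ^ 2 * η) := by ring
        _ ≤ _ := by gcongr)
  refine ⟨a, g, a', g', hag, hag', α, α', 𝒴, 𝒴', 𝒴'', hcard, hcard', hcard'',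
    fun Y hY Y' hY' Y'' hY'' ρ ρ' ρ'' hρ hρ' hρ'' => ?_⟩
  have hH : hankelOf n (decodeRow h m a g ρ) (decodeRow (reversed h) m a' g' ρ') = P :=
    hankelOf_eq hn hP (h𝒴 Y hY ρ hρ) fun q => by rw [h𝒴' Y' hY' ρ' hρ' q]; rfl
  rw [decodeLabel, hH]
  congr 1
  funext z
  exact h𝒴'' Y'' hY'' ρ'' hρ'' z

/-! ### Probabilities of events on a coin tape -/

theorem coins_add_apply (a b : ℕ) (S : Set (List Bool)) :
    (coins (a + b)).toOuterMeasure S =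
      ∑' u, coins a u * (coins b).toOuterMeasure {v | u ++ v ∈ S} := by
  rw [coins_add, PMF.toOuterMeasure_bind_apply]
  simp only [PMF.toOuterMeasure_map_apply]
  rfl

/-- Chaining of lower bounds: the event for the second part of the tape may depend on the first. -/
theorem mul_le_coins_add {a b : ℕ} {p q : ℝ≥0∞} {A : Set (List Bool)} {S : Set (List Bool)}
    (hA : p ≤ (coins a).toOuterMeasure A)
    (hS : ∀ u ∈ A, q ≤ (coins b).toOuterMeasure {v | u ++ v ∈ S}) :
    p * q ≤ (coins (a + b)).toOuterMeasure S := by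
  rw [coins_add_apply]
  calc p * q ≤ (coins a).toOuterMeasure A * q := by gcongr
    _ = ∑' u, A.indicator (coins a) u * q := by
        rw [PMF.toOuterMeasure_apply, ENNReal.tsum_mul_right]
    _ ≤ _ := by
        refine ENNReal.tsum_le_tsum fun u => ?_
        by_cases hu : u ∈ A
        · rw [Set.indicator_of_mem hu]
          exact mul_le_mul_right (hS u hu) _
        · rw [Set.indicator_of_notMem hu, zero_mul]
          exact zero_le

theorem coins_add_le_mul {a b : ℕ} (A B : Set (List Bool)) :
    (coins (a + b)).toOuterMeasure {x | x.take a ∈ A ∧ x.drop a ∈ B} ≤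
      (coins a).toOuterMeasure A * (coins b).toOuterMeasure B := by
  rw [coins_add_apply, PMF.toOuterMeasure_apply (coins a), ← ENNReal.tsum_mul_right]
  refine ENNReal.tsum_le_tsum fun u => ?_
  by_cases hu : u ∈ (coins a).support
  · have hl := length_of_mem_support_coins hu
    have e : {v | u ++ v ∈ {x : List Bool | x.take a ∈ A ∧ x.drop a ∈ B}} =
        {v | u ∈ A ∧ v ∈ B} := by
      ext v
      simp [List.take_left' hl, List.drop_left' hl]
    rw [e]
    by_cases hA : u ∈ A
    · simp [hA]
    · simp [hA]
  · rw [PMF.mem_support_iff, not_not] at hu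
    rw [hu, zero_mul]
    exact zero_le

theorem coins_compl (L : ℕ) (A : Set (List Bool)) :
    (coins L).toOuterMeasure Aᶜ = 1 - (coins L).toOuterMeasure A := by
  have h : (coins L).toOuterMeasure A + (coins L).toOuterMeasure Aᶜ = 1 := by
    rw [PMF.toOuterMeasure_apply, PMF.toOuterMeasure_apply, ← ENNReal.tsum_add,
      ← (coins L).tsum_coe]
    exact tsum_congr fun x => congrFun (Set.indicator_self_add_compl A (coins L)) x
  have hle : (coins L).toOuterMeasure A ≤ 1 := h ▸ le_self_add
  exact ENNReal.eq_sub_of_add_eq (ne_top_of_le_ne_top ENNReal.one_ne_top hle) (by rwa [add_comm])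

/-- The probability that all of `R` independent trials fail. -/
theorem coins_all_fail_le {L : ℕ} {q : ℝ≥0∞} {A : Set (List Bool)}
    (hq : q ≤ (coins L).toOuterMeasure A) (R : ℕ) :
    (coins (R * L)).toOuterMeasure {w | ∀ j < R, (w.drop (j * L)).take L ∉ A} ≤ (1 - q) ^ R := by
  induction R with
  | zero =>
    have := coins_compl (0 * L) {w | ∀ j < 0, (w.drop (j * L)).take L ∉ A}
    rw [pow_zero, ← compl_compl {w : List Bool | ∀ j < 0, (w.drop (j * L)).take L ∉ A},
      coins_compl]
    exact tsub_le_self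
  | succ R ih =>
    have e : (R + 1) * L = L + R * L := by ring
    rw [e, pow_succ']
    refine le_trans ((coins (L + R * L)).toOuterMeasure.mono ?_)
      ((coins_add_le_mul Aᶜ {w | ∀ j < R, (w.drop (j * L)).take L ∉ A}).trans ?_)
    · intro w hw
      refine ⟨by simpa using hw 0 (by omega), fun j hj => ?_⟩
      have := hw (j + 1) (by omega)
      rw [List.drop_drop]
      rwa [show L + j * L = (j + 1) * L by ring]
    · rw [coins_compl]
      gcongr

/-- A list of coins, read as a sequence of bits that is continued by zeros. -/
def bitsOf (x : List Bool) (q : ℕ) : ZMod 2 := if x.getD q false then 1 else 0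

/-- A list of coins, cut into rows of length `w`. -/
def rowsOf (w : ℕ) (x : List Bool) (i q : ℕ) : ZMod 2 := bitsOf x (i * w + q)

theorem bitsOf_eq_zero {x : List Bool} {q : ℕ} (h : x.length ≤ q) : bitsOf x q = 0 := by
  simp [bitsOf, List.getD_eq_getElem?_getD, List.getElem?_eq_none h]

/-- The first `L` bits of a tape are uniformly distributed. -/
theorem card_div_le_coins {L : ℕ} (𝒮 : Finset (Fin L → ZMod 2)) :
    (𝒮.card : ℝ≥0∞) / 2 ^ L ≤
      (coins L).toOuterMeasure {x | x.length = L ∧ (fun q : Fin L => bitsOf x q) ∈ 𝒮} := by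
  classical
  set f : (Fin L → ZMod 2) → List Bool := fun v => List.ofFn fun q => decide (v q = 1) with hf
  have hbits : ∀ v, (fun q : Fin L => bitsOf (f v) q) = v := by
    intro v
    funext q
    rcases zmod_two_cases (v q) with h | h <;>
      simp [bitsOf, hf, List.getD_eq_getElem?_getD, h]
  have hinj : Function.Injective f := fun v v' h => by rw [← hbits v, h, hbits]
  rw [PMF.toOuterMeasure_apply]
  refine le_trans (le_of_eq ?_) (ENNReal.sum_le_tsum (𝒮.image f))
  rw [Finset.sum_image fun v _ v' _ h => hinj h]
  have : ∀ v ∈ 𝒮, {x : List Bool | x.length = L ∧ (fun q : Fin L => bitsOf x q) ∈ 𝒮}.indicator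
      (coins L) (f v) = ((2 : ℝ≥0∞) ^ L)⁻¹ := by
    intro v hv
    have hl : (f v).length = L := by simp [hf]
    rw [Set.indicator_of_mem (by exact ⟨hl, by rw [hbits]; exact hv⟩), coins_apply hl]
  rw [Finset.sum_congr rfl this, Finset.sum_const, nsmul_eq_mul, ENNReal.div_eq_inv_mul, mul_comm]

theorem inv_le_coins_guess {m : ℕ} (g : ℕ → ZMod 2) (hg : ∀ j, m ≤ j → g j = 0) :
    ((2 : ℝ≥0∞) ^ m)⁻¹ ≤ (coins m).toOuterMeasure {x | x.length = m ∧ bitsOf x = g} := by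
  have h := card_div_le_coins {(fun q : Fin m => g q)}
  rw [Finset.card_singleton, Nat.cast_one, one_div] at h
  refine h.trans ((coins m).toOuterMeasure.mono ?_)
  rintro x ⟨hx, hx'⟩
  refine ⟨hx, funext fun q => ?_⟩
  rcases Nat.lt_or_ge q m with hq | hq
  · exact congrFun (Finset.mem_singleton.mp hx') ⟨q, hq⟩
  · rw [hg q hq, bitsOf_eq_zero (by omega)]

/-- Random rows have uniformly distributed vectors in their first `n` columns, and the `m + 1` bits
in the last column are the values of `α` with probability `2 ^ (-(m + 1))`. -/
theorem inv_le_coins_rows {n m : ℕ} (hn : 0 < n) (α : Fin n → ZMod 2)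
    (𝒴 : Finset (Fin (m + 1) → Fin n → ZMod 2)) (h𝒴 : ((2 : ℝ) ^ n) ^ (m + 1) / 2 ≤ 𝒴.card) :
    ((2 : ℝ≥0∞) ^ (m + 2))⁻¹ ≤ (coins ((m + 1) * (n + 1))).toOuterMeasure
      {x | x.length = (m + 1) * (n + 1) ∧ ∃ Y ∈ 𝒴, RowsMatch α Y (rowsOf (n + 1) x)} := by
  classical
  set f : (Fin (m + 1) → Fin n → ZMod 2) → Fin ((m + 1) * (n + 1)) → ZMod 2 := fun Y q =>
    if h : (q : ℕ) % (n + 1) < n then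
      Y ⟨(q : ℕ) / (n + 1), Nat.div_lt_of_lt_mul (q.isLt.trans_eq (Nat.mul_comm _ _))⟩
        ⟨(q : ℕ) % (n + 1), h⟩
    else α ⬝ᵥ Y ⟨(q : ℕ) / (n + 1), Nat.div_lt_of_lt_mul (q.isLt.trans_eq (Nat.mul_comm _ _))⟩
    with hf
  have hlt : ∀ (i : Fin (m + 1)) {c : ℕ}, c < n + 1 → i * (n + 1) + c < (m + 1) * (n + 1) := by
    intro i c hc
    have := Nat.mul_le_mul_right (n + 1) (Nat.le_of_lt_succ i.isLt)
    rw [Nat.succ_mul]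
    omega
  have hdiv : ∀ (i : ℕ) {c : ℕ}, c < n + 1 → (i * (n + 1) + c) / (n + 1) = i := by
    intro i c hc
    rw [Nat.add_comm, Nat.add_mul_div_right _ _ (by omega), Nat.div_eq_of_lt hc, Nat.zero_add]
  have hmod : ∀ (i : ℕ) {c : ℕ}, c < n + 1 → (i * (n + 1) + c) % (n + 1) = c := by
    intro i c hc
    rw [Nat.add_comm, Nat.add_mul_mod_self_right, Nat.mod_eq_of_lt hc]
  have hfY : ∀ Y (i : Fin (m + 1)) (q : Fin n),
      f Y ⟨i * (n + 1) + q, hlt i (by omega)⟩ = Y i q := by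
    intro Y i q
    have hq : (q : ℕ) < n + 1 := by omega
    simp only [hf, hdiv i hq, hmod i hq, q.isLt, dif_pos]
  have hfα : ∀ Y (i : Fin (m + 1)), f Y ⟨i * (n + 1) + n, hlt i (by omega)⟩ = α ⬝ᵥ Y i := by
    intro Y i
    have hq : n < n + 1 := by omega
    simp only [hf, hdiv i hq, hmod i hq, lt_irrefl, dif_neg, not_false_eq_true]
  have hinj : Function.Injective f := by
    intro Y Y' h
    funext i q
    rw [← hfY Y, h, hfY]
  refine le_trans ?_ ((card_div_le_coins (𝒴.image f)).trans
    ((coins ((m + 1) * (n + 1))).toOuterMeasure.mono ?_))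
  · rw [Finset.card_image_of_injective _ hinj]
    have hpos : 1 ≤ n * (m + 1) := Nat.mul_pos hn (by omega)
    have hcard : 2 ^ (n * (m + 1) - 1) ≤ 𝒴.card := by
      have h1 : (2 : ℝ) ^ (n * (m + 1) - 1) * 2 = (2 ^ n) ^ (m + 1) := by
        rw [← pow_succ, Nat.sub_add_cancel hpos, pow_mul]
      have h2 : (2 : ℝ) ^ (n * (m + 1) - 1) ≤ 𝒴.card := by linarith
      exact_mod_cast h2
    rw [ENNReal.le_div_iff_mul_le (Or.inl (by simp)) (Or.inl (by simp))]
    have e : (m + 1) * (n + 1) = (m + 2) + (n * (m + 1) - 1) := by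
      have : (m + 1) * (n + 1) = n * (m + 1) + (m + 1) := by ring
      omega
    rw [e, pow_add 2 (m + 2), ← mul_assoc, ENNReal.inv_mul_cancel (by simp) (by simp), one_mul]
    exact_mod_cast hcard
  · rintro x ⟨hx, hx'⟩
    obtain ⟨Y, hY, hYx⟩ := Finset.mem_image.mp hx'
    refine ⟨hx, Y, hY, fun i => ⟨fun q => ?_, ?_⟩⟩
    · rw [← hfY Y i q, hYx]
      rfl
    · rw [← hfα Y i, hYx]
      rfl

/-! ### The success probability of a trial -/

/-- The number of coins of a trial. -/
def trialLength (n m : ℕ) : ℕ :=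
  n + (m + (m + ((m + 1) * (n + 1) + (m + (m + ((m + 1) * (n + 1) + (m + 1) * (n + 1)))))))

/-- The label decoded from a random position `y₀`, which fixes the level of truncation, and from
guesses and rows of cubes. -/
noncomputable def labelOf {n : ℕ} (s : (Fin n → ZMod 2) → ℂ) (k : ℝ) (m : ℕ)
    (y₀ a g r a' g' r' r'' : List Bool) : Label n :=
  decodeLabel (truncate (16 * k ^ 2 * Complex.normSq (s fun j => bitsOf y₀ j)) s) m
    (bitsOf a) (bitsOf g) (rowsOf (n + 1) r) (bitsOf a') (bitsOf g') (rowsOf (n + 1) r')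
    (rowsOf (n + 1) r'')

/-- The label decoded from the coins `x` of a trial. -/
noncomputable def trialLabel {n : ℕ} (s : (Fin n → ZMod 2) → ℂ) (k : ℝ) (m : ℕ)
    (x : List Bool) : Label n :=
  let w := (m + 1) * (n + 1)
  let x₁ := x.drop n
  let x₂ := x₁.drop m
  let x₃ := x₂.drop m
  let x₄ := x₃.drop w
  let x₅ := x₄.drop m
  let x₆ := x₅.drop m
  let x₇ := x₆.drop w
  labelOf s k m (x.take n) (x₁.take m) (x₂.take m) (x₃.take w) (x₄.take m) (x₅.take m)
    (x₆.take w) x₇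

theorem trialLabel_append {n : ℕ} (s : (Fin n → ZMod 2) → ℂ) (k : ℝ) {m : ℕ}
    {y₀ a g r a' g' r' r'' : List Bool} (h₀ : y₀.length = n) (ha : a.length = m)
    (hg : g.length = m) (hr : r.length = (m + 1) * (n + 1)) (ha' : a'.length = m)
    (hg' : g'.length = m) (hr' : r'.length = (m + 1) * (n + 1)) :
    trialLabel s k m (y₀ ++ (a ++ (g ++ (r ++ (a' ++ (g' ++ (r' ++ r''))))))) =
      labelOf s k m y₀ a g r a' g' r' r'' := by
  simp only [trialLabel, List.drop_left' h₀, List.take_left' h₀, List.drop_left' ha,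
    List.take_left' ha, List.drop_left' hg, List.take_left' hg, List.drop_left' hr,
    List.take_left' hr, List.drop_left' ha', List.take_left' ha', List.drop_left' hg',
    List.take_left' hg', List.drop_left' hr', List.take_left' hr']

/-- A trial finds any given label of large correlation with probability at least
`1 / (16 k · 2 ^ (4 m) · 2 ^ (3 (m + 2)))`. -/
theorem le_coins_trialLabel_eq {n m : ℕ} (hn : 0 < n) {k : ℝ} (hk : 1 ≤ k)
    (hm : 2 ^ 26 * n * k ^ 8 ≤ 2 ^ m) (s : (Fin n → ZMod 2) → ℂ)
    (hs : 0 < ∑ y, Complex.normSq (s y)) {P : Matrix (Fin n) (Fin n) (ZMod 2)} (hP : IsHankel P)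
    (l : Fin n → ZMod 2)
    (hc : 2 ^ n * (∑ y, Complex.normSq (s y)) / k ≤
      Complex.normSq (∑ y, s y * (starRingEnd ℂ) (phase P l y))) :
    ENNReal.ofReal (1 / (16 * k)) * (((2 : ℝ≥0∞) ^ m)⁻¹ * (((2 : ℝ≥0∞) ^ m)⁻¹ *
      (((2 : ℝ≥0∞) ^ (m + 2))⁻¹ * (((2 : ℝ≥0∞) ^ m)⁻¹ * (((2 : ℝ≥0∞) ^ m)⁻¹ *
      (((2 : ℝ≥0∞) ^ (m + 2))⁻¹ * ((2 : ℝ≥0∞) ^ (m + 2))⁻¹)))))) ≤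
    (coins (trialLength n m)).toOuterMeasure {x | trialLabel s k m x = (P, l)} := by
  have hn1 : (1 : ℝ) ≤ n := by exact_mod_cast hn
  have hk0 : 0 < k := by linarith
  obtain ⟨𝒢, hcard, h𝒢⟩ := exists_truncation s (phase P l) hk (normSq_phase P l) hs hc
  have hη1 : 1 / (1024 * k ^ 4) ≤ 1 := by
    rw [div_le_one (by positivity)]
    have : 1 ≤ k ^ 4 := one_le_pow₀ hk
    linarith
  have hmη : 32 * ((n : ℝ) + 1) ≤ 2 ^ m * (1 / (1024 * k ^ 4)) ^ 2 := by
    calc 32 * ((n : ℝ) + 1) ≤ 2 ^ 6 * n := by linarith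
      _ = (2 ^ 26 * n * k ^ 8) * (1 / (1024 * k ^ 4)) ^ 2 := by field_simp; norm_num
      _ ≤ _ := by gcongr
  refine mul_le_coins_add
    (A := {y₀ | y₀.length = n ∧ (fun q : Fin n => bitsOf y₀ q) ∈ 𝒢}) ?_ ?_
  · refine le_trans ?_ (card_div_le_coins 𝒢)
    have e : ((𝒢.card : ℝ≥0∞)) / 2 ^ n = ENNReal.ofReal (𝒢.card / 2 ^ n) := by
      rw [ENNReal.ofReal_div_of_pos (by positivity), ENNReal.ofReal_natCast,
        ENNReal.ofReal_pow (by norm_num), ENNReal.ofReal_ofNat]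
    rw [e]
    refine ENNReal.ofReal_le_ofReal ?_
    rw [le_div_iff₀ (by positivity)]
    calc 1 / (16 * k) * 2 ^ n = 2 ^ n / (16 * k) := by ring
      _ ≤ _ := hcard
  rintro y₀ ⟨hy₀, hy₀'⟩
  obtain ⟨hθ, hcorr⟩ := h𝒢 _ hy₀'
  obtain ⟨a, g, a', g', hag, hag', α, α', 𝒴, 𝒴', 𝒴'', h𝒴, h𝒴', h𝒴'', hdec⟩ :=
    exists_decodeLabel_eq hn hP l
      (truncate (16 * k ^ 2 * Complex.normSq (s fun q => bitsOf y₀ q)) s) hθ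
      (η := 1 / (1024 * k ^ 4)) (by positivity) hη1 (normSq_truncate_le hθ.le s) hmη hcorr
  refine mul_le_coins_add (inv_le_coins_guess a fun j hj => (hag j hj).1) ?_
  rintro xa ⟨hxa, rfl⟩
  refine mul_le_coins_add (inv_le_coins_guess g fun j hj => (hag j hj).2) ?_
  rintro xg ⟨hxg, rfl⟩
  refine mul_le_coins_add (inv_le_coins_rows hn α 𝒴 h𝒴) ?_
  rintro r ⟨hr, Y, hY, hYr⟩
  refine mul_le_coins_add (inv_le_coins_guess a' fun j hj => (hag' j hj).1) ?_
  rintro xa' ⟨hxa', rfl⟩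
  refine mul_le_coins_add (inv_le_coins_guess g' fun j hj => (hag' j hj).2) ?_
  rintro xg' ⟨hxg', rfl⟩
  refine mul_le_coins_add (inv_le_coins_rows hn α' 𝒴' h𝒴') ?_
  rintro r' ⟨hr', Y', hY', hYr'⟩
  refine (inv_le_coins_rows hn l 𝒴'' h𝒴'').trans
    ((coins ((m + 1) * (n + 1))).toOuterMeasure.mono ?_)
  rintro r'' ⟨hr'', Y'', hY'', hYr''⟩
  change trialLabel s k m _ = _
  rw [trialLabel_append s k hy₀ hxa hxg hr hxa' hxg' hr']
  exact hdec Y hY Y' hY' Y'' hY'' _ _ _ hYr hYr' hYr''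

/-! ### The names of the arrays -/

/-- The variable that holds `n`. -/
@[simp] abbrev vN : ℕ := 0
/-- The variable that holds the dimension `m` of the cubes. -/
@[simp] abbrev vExp : ℕ := 1
/-- The variable that holds `2 ^ m`. -/
@[simp] abbrev vPow : ℕ := 2
/-- The variable that holds the number `(m + 1) * (n + 1)` of entries of the rows of a cube. -/
@[simp] abbrev vLen : ℕ := 3
/-- The number of the current trial. -/
@[simp] abbrev vRound : ℕ := 4
/-- Loop counter. -/
@[simp] abbrev vZ : ℕ := 5
/-- Loop counter. -/
@[simp] abbrev vS : ℕ := 6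
/-- Loop counter. -/
@[simp] abbrev vI : ℕ := 7
/-- Loop counter. -/
@[simp] abbrev vJ : ℕ := 8
/-- A pointer into one of the arrays of rows. -/
@[simp] abbrev vPtr : ℕ := 9
/-- A pointer into the array of the points of the cube. -/
@[simp] abbrev vSrc : ℕ := 10
/-- A pointer into the array of the points of the cube. -/
@[simp] abbrev vDst : ℕ := 11
/-- The order of the linear recurrence. -/
@[simp] abbrev vDeg : ℕ := 12
/-- An auxiliary number. -/
@[simp] abbrev vAux : ℕ := 13
/-- The random position. -/
@[simp] abbrev aPos : ℕ := 20
/-- The direction of the derivative. -/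
@[simp] abbrev aDir : ℕ := 21
/-- The guessed initial values. -/
@[simp] abbrev aGuess : ℕ := 22
/-- The rows of a cube. -/
@[simp] abbrev aRows : ℕ := 23
/-- The points of a cube. -/
@[simp] abbrev aCube : ℕ := 24
/-- The current point of the cube. -/
@[simp] abbrev aPoint : ℕ := 25
/-- The decoded character. -/
@[simp] abbrev aChar : ℕ := 26
/-- The decoded row of the Hankel matrix. -/
@[simp] abbrev aRow : ℕ := 27
/-- The reverse diagonals of the decoded Hankel matrix. -/
@[simp] abbrev aHankel : ℕ := 28
/-- The position of the next sample. -/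
@[simp] abbrev aQuery : ℕ := 29
/-- The complex variable that holds `k`. -/
@[simp] abbrev nK : ℕ := 0
/-- The complex variable that holds the level of truncation. -/
@[simp] abbrev nTheta : ℕ := 1
/-- The samples. -/
@[simp] abbrev nSample : ℕ := 2
/-- The value of the current function at the current point. -/
@[simp] abbrev nVal : ℕ := 3
/-- The sums over the cube. -/
@[simp] abbrev nSum : ℕ := 4

infixr:60 " ;; " => Program.seq

/-- Assignment to a scalar variable. -/
abbrev Program.assign (v : ℕ) (e : NatExpr) : Program := .setNat v (.lit 0) e

/-- The sum of two bits modulo `2`. -/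
def NatExpr.xor (e f : NatExpr) : NatExpr := .add (.sub e f) (.sub f e)

theorem NatExpr.eval_xor {σ : Memory} {e f : NatExpr} {a b : ZMod 2} (he : e.eval σ = a.val)
    (hf : f.eval σ = b.val) : (NatExpr.xor e f).eval σ = (a + b).val := by
  rw [NatExpr.xor, NatExpr.eval, NatExpr.eval, NatExpr.eval, he, hf]
  clear he hf
  revert a b; decide

theorem one_le_val_iff (a : ZMod 2) : 1 ≤ a.val ↔ a = 1 := by
  revert a; decide

/-- The first `L` cells of the array `A` hold the bits `u`. -/
def HoldsBits (σ : Memory) (A L : ℕ) (u : ℕ → ZMod 2) : Prop := ∀ q < L, σ.nat A q = (u q).val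

/-! ### Tossing coins and sampling -/

/-- Fill an array with as many coins as the variable `v` says. -/
def fill (A v : ℕ) : Program := .for vI (.var v) (.toss A (.var vI))

theorem wp_fill {n : ℕ} (s : Signal n) {A v : ℕ} {σ : Memory} {x : List Bool} (hA : A ≠ vI)
    (hv : v ≠ vI) (hvA : v ≠ A) (hx : σ.nat v 0 = x.length) :
    Wp s (fill A v) σ x (x.length * 4 + 3) fun σ' => HoldsBits σ' A x.length (bitsOf x) := by
  have e : x = (List.range x.length).flatMap fun j => [x.getD j false] := by
    rw [← List.map_eq_flatMap]
    refine List.ext_getElem (by simp) fun i h1 h2 => ?_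
    simp [List.getD_eq_getElem?_getD, List.getElem?_eq_getElem h1]
  have := Wp.for (s := s) (p := .toss A (.var vI)) (σ := σ) (B := 1) (i := vI) (e := .var v)
    (fun j τ => HoldsBits τ A j (bitsOf x)) x.length (fun j => [x.getD j false])
    (by simpa [Program.setsNat] using hA)
    (fun τ hF => by
      rw [NatExpr.eval, NatExpr.eval, hF.nat v, hx]
      simp [Program.for, Program.setsNat, Ne.symm hv, Ne.symm hvA])
    (fun j τ u h q hq => by rw [Memory.writeNat_nat_of_ne _ _ _ hA]; exact h q hq)
    (fun q hq => absurd hq (Nat.not_lt_zero q))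
    (fun j τ hj _ hi h => Wp.toss fun q hq => by
      simp only [NatExpr.eval, hi, Memory.writeNat_nat_self]
      rcases Nat.lt_succ_iff_lt_or_eq.mp hq with hq | rfl
      · rw [Function.update_of_ne (by omega)]
        exact h q hq
      · rw [Function.update_self, bitsOf]
        cases x.getD q false <;> rfl)
  rw [← e] at this
  exact this

/-- Store in the given cell the truncated sample at the position that stands in `aQuery`. -/
def sampleTruncated (c : ℕ) : Program :=
  .query nSample (.lit c) aQuery (.lit 0) ;;
  .branch (.numLE (.mul (.get nSample (.lit c)) (.conj (.get nSample (.lit c))))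
      (.get nTheta (.lit 0)))
    .skip (.setNum nSample (.lit c) (.ofNat (.lit 0)))

theorem wp_sampleTruncated {n : ℕ} (s : Signal n) {c : ℕ} {σ : Memory} {θ : ℝ}
    (hθ : (σ.num nTheta 0).re = θ) {y : Fin n → ZMod 2}
    (hy : ∀ j : Fin n, σ.nat aQuery j = (y j).val) :
    Wp s (sampleTruncated c) σ [] 5 fun σ' =>
      σ'.num nSample = Function.update (σ.num nSample) c (truncate θ s.ofLp y) := by
  have e : (fun j : Fin n => ((σ.nat 29 j : ℕ) : ZMod 2)) = y := by
    funext j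
    rw [show σ.nat 29 j = (y j).val from hy j, ZMod.natCast_zmod_val]
  refine Wp.seq_nil (B := 1) (B' := 3) (Wp.query ?_)
  refine Wp.branch (B := 1) (B' := 1) (fun h => Wp.skip ?_) (fun h => Wp.setNum ?_)
  · simp [Test.Holds, NumExpr.eval, NatExpr.eval, e, Complex.mul_conj, hθ] at h
    simp [NatExpr.eval, e, truncate, h]
  · simp only [Test.Holds, NumExpr.eval, NatExpr.eval] at h
    simp [e, Complex.mul_conj, hθ] at h
    simp [NatExpr.eval, NumExpr.eval, e, truncate, not_le.mpr h]

/-! ### Evaluation of derivatives and of dechirped signals -/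

/-- The position of coordinate `vJ`, or of its mirror image. -/
def coordinate (rev : Bool) : NatExpr :=
  if rev then .sub (.sub (.var vN) (.lit 1)) (.var vJ) else .var vJ

/-- Write the bits of `e`, as `vJ` runs through `0, …, n - 1`, to `aQuery`. -/
def setQuery (rev : Bool) (e : NatExpr) : Program :=
  .for vJ (.var vN) (.setNat aQuery (coordinate rev) e)

theorem wp_setQuery {n : ℕ} (s : Signal n) (rev : Bool) {e : NatExpr} {σ : Memory}
    {u : ℕ → ZMod 2} (hn : σ.nat vN 0 = n)
    (he : ∀ τ j, j < n → Frame (setQuery rev e) σ τ → τ.nat vJ 0 = j → e.eval τ = (u j).val) :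
    Wp s (setQuery rev e) σ [] (n * 4 + 3) fun σ' =>
      ∀ j : Fin n, σ'.nat aQuery j = (u (if rev then j.rev else j)).val := by
  refine (Wp.for_nil (B := 1)
    (fun j τ => ∀ i < j, τ.nat aQuery (if rev then n - 1 - i else i) = (u i).val) n rfl
    (fun τ hF => by simpa [NatExpr.eval, hF.nat vN rfl] using hn)
    (fun j τ v h i hi => by simpa using h i hi) (fun i hi => absurd hi (Nat.not_lt_zero i))
    (fun j τ hj hF hJ h => Wp.setNat fun i hi => ?_)).conseq fun τ hF h j => ?_
  · have hc : (coordinate rev).eval τ = if rev then n - 1 - j else j := by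
      have hN : τ.nat vN 0 = n := by rw [hF.nat vN rfl]; exact hn
      cases rev <;> simp_all [coordinate, NatExpr.eval]
    rw [he τ j hj hF hJ, hc, Memory.writeNat_nat_self]
    rcases Nat.lt_succ_iff_lt_or_eq.mp hi with hi | rfl
    · rw [Function.update_of_ne (by cases rev <;> simp <;> omega)]
      exact h i hi
    · rw [Function.update_self]
  · cases rev with
    | false => simpa using h j j.isLt
    | true =>
      have hj := j.isLt
      have := h (j.rev : ℕ) j.rev.isLt
      simp only [if_true, Fin.val_rev] at this ⊢
      rwa [show n - 1 - (n - ((j : ℕ) + 1)) = j by omega] at this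

/-- Evaluate the derivative in direction `aDir` at the point `aPoint`. -/
def evalDerivative (rev : Bool) : Program :=
  setQuery rev (.get aPoint (.var vJ)) ;;
  sampleTruncated 0 ;;
  setQuery rev (.xor (.get aPoint (.var vJ)) (.get aDir (.var vJ))) ;;
  sampleTruncated 1 ;;
  .setNum nVal (.lit 0) (.mul (.get nSample (.lit 1)) (.conj (.get nSample (.lit 0))))

/-- The signal, with reversed coordinates if `rev` holds. -/
def orient {n : ℕ} (rev : Bool) (h : (Fin n → ZMod 2) → ℂ) : (Fin n → ZMod 2) → ℂ :=
  if rev then reversed h else h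

theorem orient_apply {n : ℕ} (rev : Bool) (h : (Fin n → ZMod 2) → ℂ) (u : ℕ → ZMod 2) :
    orient rev h (fun j => u j) = h fun j => u (if rev then j.rev else j) := by
  cases rev <;> simp [orient, reversed]

theorem wp_evalDerivative {n : ℕ} (s : Signal n) (rev : Bool) {σ : Memory} {θ : ℝ}
    (hn : σ.nat vN 0 = n) (hθ : (σ.num nTheta 0).re = θ) {u a : ℕ → ZMod 2}
    (hu : HoldsBits σ aPoint n u) (ha : HoldsBits σ aDir n a) :
    Wp s (evalDerivative rev) σ [] (8 * n + 21) fun σ' => σ'.num nVal 0 =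
      derivative (orient rev (truncate θ s.ofLp)) (fun j => a j) (fun j => u j) := by
  refine Wp.time (B := (n * 4 + 3) + (5 + ((n * 4 + 3) + (5 + 1 + 1) + 1) + 1) + 1) ?_ (by omega)
  refine Wp.seq_nil ((wp_setQuery s rev (u := u) hn fun τ j hj hF hJ => ?_).conseq
    fun σ1 hF1 h1 => ?_)
  · rw [NatExpr.eval, NatExpr.eval, NatExpr.eval, hJ, hF.nat aPoint rfl]
    exact hu j hj
  have hn1 : σ1.nat vN 0 = n := by rw [hF1.nat vN rfl]; exact hn
  refine Wp.seq_nil ((wp_sampleTruncated s (c := 0) (σ := σ1) (θ := θ)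
    (by rw [hF1.num nTheta rfl]; exact hθ) h1).conseq fun σ2 hF2 h2 => ?_)
  have hn2 : σ2.nat vN 0 = n := by rw [hF2.nat vN rfl]; exact hn1
  refine Wp.seq_nil (B := n * 4 + 3) (B' := 5 + 1 + 1)
    ((wp_setQuery s rev (u := fun j => u j + a j) hn2 fun τ j hj hF hJ => ?_).conseq
      fun σ3 hF3 h3 => ?_)
  · refine NatExpr.eval_xor ?_ ?_
    · rw [NatExpr.eval, NatExpr.eval, NatExpr.eval, hJ, hF.nat aPoint rfl, hF2.nat aPoint rfl,
        hF1.nat aPoint rfl]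
      exact hu j hj
    · rw [NatExpr.eval, NatExpr.eval, NatExpr.eval, hJ, hF.nat aDir rfl, hF2.nat aDir rfl,
        hF1.nat aDir rfl]
      exact ha j hj
  refine Wp.seq_nil ((wp_sampleTruncated s (c := 1) (σ := σ3) (θ := θ)
    (by rw [hF3.num nTheta rfl, hF2.num nTheta rfl, hF1.num nTheta rfl]; exact hθ) h3).conseq
    fun σ4 hF4 h4 => ?_)
  refine Wp.setNum ?_
  have e : (fun j : Fin n => u j) + (fun j : Fin n => a j) =
      fun j : Fin n => (fun i => u i + a i) (j : ℕ) := rfl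
  rw [derivative, e, orient_apply rev _ (fun i => u i + a i), orient_apply]
  simp only [NumExpr.eval, NatExpr.eval, h4, hF3.num nSample rfl, h2, Memory.writeNum_num_self,
    Function.update_self]
  rw [Function.update_of_ne (by decide), Function.update_self]

/-- Evaluate the signal without its quadratic phase `aHankel` at the point `aPoint`. -/
def evalDechirp : Program :=
  setQuery false (.get aPoint (.var vJ)) ;;
  sampleTruncated 0 ;;
  .setNum nVal (.lit 0) (.get nSample (.lit 0)) ;;
  .for vI (.var vN) (.for vJ (.var vN)
    (.branch (.and (.natLE (.lit 1) (.get aPoint (.var vI)))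
        (.and (.natLE (.lit 1) (.get aHankel (.add (.var vI) (.var vJ))))
          (.natLE (.lit 1) (.get aPoint (.var vJ)))))
      (.setNum nVal (.lit 0) (.mul (.get nVal (.lit 0)) (.conj .imag)))
      .skip))

theorem val_mul_val_mul_val (a b c : ZMod 2) :
    a.val * b.val * c.val = if a = 1 ∧ b = 1 ∧ c = 1 then 1 else 0 := by
  revert a b c; decide

theorem wp_evalDechirp {n : ℕ} (s : Signal n) {σ : Memory} {θ : ℝ}
    (hn : σ.nat vN 0 = n) (hθ : (σ.num nTheta 0).re = θ) {u p : ℕ → ZMod 2}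
    (hu : HoldsBits σ aPoint n u) (hp : HoldsBits σ aHankel (2 * n - 1) p) :
    Wp s evalDechirp σ [] (n * (n * 6 + 6) + 4 * n + 15) fun σ' => σ'.num nVal 0 =
      dechirp (truncate θ s.ofLp) (Matrix.of fun i j => p ((i : ℕ) + j)) (fun j => u j) := by
  set f : ℕ → ℕ → ℕ := fun i j => (u i).val * (p (i + j)).val * (u j).val with hf
  set v := truncate θ s.ofLp (fun j => u j) with hv
  refine Wp.time (B := (n * 4 + 3) + (5 + (1 + (n * ((n * ((1 + 1 + 1) + 3) + 3) + 3) + 3) + 1) +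
    1) + 1) ?_ (le_of_eq (by ring))
  refine Wp.seq_nil ((wp_setQuery s false (u := u) hn fun τ j hj hF hJ => ?_).conseq
    fun σ1 hF1 h1 => ?_)
  · rw [NatExpr.eval, NatExpr.eval, NatExpr.eval, hJ, hF.nat aPoint rfl]
    exact hu j hj
  refine Wp.seq_nil ((wp_sampleTruncated s (c := 0) (σ := σ1) (θ := θ)
    (by rw [hF1.num nTheta rfl]; exact hθ) h1).conseq fun σ2 hF2 h2 => ?_)
  refine Wp.seq_nil (Wp.setNum ?_)
  set σ3 := σ2.writeNum nVal (NatExpr.eval σ2 (.lit 0)) (NumExpr.eval σ2 (.get nSample (.lit 0)))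
    with hσ3
  have h3 : σ3.num nVal 0 = v := by
    simp [hσ3, NumExpr.eval, NatExpr.eval, h2, hv]
  have h3n : ∀ a, a ≠ aQuery → a ≠ vJ → σ3.nat a = σ.nat a := by
    intro a ha ha'
    rw [hσ3, Memory.writeNum_nat, hF2.nat a, hF1.nat a]
    · simp [setQuery, Program.for, Program.setsNat, Ne.symm ha, Ne.symm ha']
    · simp [sampleTruncated, Program.setsNat]
  refine (Wp.for_nil (fun i τ => τ.num nVal 0 =
      v * (starRingEnd ℂ) Complex.I ^ ∑ i' ∈ Finset.range i, ∑ j ∈ Finset.range n, f i' j) n rfl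
    (fun τ hF => by rw [NatExpr.eval, hF.nat vN rfl, h3n vN (by decide) (by decide)]; exact hn)
    (fun _ _ _ h => h) (by simpa using h3)
    (fun i τ hi hF hI h => (Wp.for_nil (fun j τ => τ.num nVal 0 =
        v * (starRingEnd ℂ) Complex.I ^ ((∑ i' ∈ Finset.range i, ∑ j ∈ Finset.range n, f i' j) +
          ∑ j' ∈ Finset.range j, f i j')) n rfl
      (fun τ' hF' => by
        rw [NatExpr.eval, hF'.nat vN rfl, hF.nat vN rfl, h3n vN (by decide) (by decide)]
        exact hn)
      (fun _ _ _ h => h) (by simpa using h) fun j τ' hj hF' hJ h' => ?_).conseq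
        fun τ' _ h' => ?_)).conseq fun τ _ h => ?_
  · have hpt : τ'.nat aPoint = σ.nat aPoint := by
      rw [hF'.nat aPoint rfl, hF.nat aPoint rfl, h3n aPoint (by decide) (by decide)]
    have hhk : τ'.nat aHankel = σ.nat aHankel := by
      rw [hF'.nat aHankel rfl, hF.nat aHankel rfl, h3n aHankel (by decide) (by decide)]
    have hvi : τ'.nat vI 0 = i := by rw [hF'.nat vI rfl]; exact hI
    have htest : (Test.and (.natLE (.lit 1) (.get aPoint (.var vI)))
        (.and (.natLE (.lit 1) (.get aHankel (.add (.var vI) (.var vJ))))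
          (.natLE (.lit 1) (.get aPoint (.var vJ))))).Holds τ' ↔
        (u i = 1 ∧ p (i + j) = 1 ∧ u j = 1) := by
      simp only [Test.Holds, NatExpr.eval, hvi, hJ, hpt, hhk, hu i hi, hu j hj,
        hp (i + j) (by omega), one_le_val_iff]
    refine Wp.branch (fun hb => Wp.setNum ?_) (fun hb => Wp.skip ?_)
    · rw [htest] at hb
      have : f i j = 1 := by rw [hf]; simp only [val_mul_val_mul_val, if_pos hb]
      rw [Finset.sum_range_succ, ← add_assoc, this, pow_succ]
      rw [NumExpr.eval, NumExpr.eval, NumExpr.eval, NumExpr.eval, NatExpr.eval,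
        Memory.writeNum_num_self, Function.update_self, h', mul_assoc]
    · rw [htest] at hb
      rw [Finset.sum_range_succ, ← add_assoc]
      have : f i j = 0 := by rw [hf]; simp only [val_mul_val_mul_val, if_neg hb]
      rw [this, add_zero]
      exact h'
  · rw [Finset.sum_range_succ]
    exact h'
  · rw [h, dechirp, phase, map_pow, hv]
    congr 2
    simp only [Pi.zero_apply, ZMod.val_zero, zero_mul, Finset.sum_const_zero, mul_zero, add_zero,
      Matrix.of_apply]
    rw [← Fin.sum_univ_eq_sum_range (fun i => ∑ j ∈ Finset.range n, f i j)]
    refine Finset.sum_congr rfl fun i _ => ?_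
    rw [← Fin.sum_univ_eq_sum_range (fun j => f i j)]

/-! ### Construction of a cube -/

/-- The length `n + 1` of a row. -/
abbrev rowLength : NatExpr := .add (.var vN) (.lit 1)

/-- Compute all points of the affine cube with rows `aRows`: every edge doubles the table. -/
def buildCube : Program :=
  .for vI rowLength (.setNat aCube (.var vI) (.get aRows (.var vI))) ;;
  .assign vAux (.lit 1) ;;
  .assign vDst rowLength ;;
  .assign vPtr rowLength ;;
  .for vZ (.var vExp)
    (.assign vSrc (.lit 0) ;;
     .for vS (.var vAux)
      (.for vJ rowLength
        (.setNat aCube (.var vDst)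
          (.xor (.get aCube (.var vSrc)) (.get aRows (.add (.var vPtr) (.var vJ)))) ;;
         .assign vDst (.add (.var vDst) (.lit 1)) ;;
         .assign vSrc (.add (.var vSrc) (.lit 1)))) ;;
     .assign vAux (.add (.var vAux) (.var vAux)) ;;
     .assign vPtr (.add (.var vPtr) rowLength))

theorem row_index_lt {S' S w q : ℕ} (hS : S' < S) (hq : q < w) : S' * w + q < S * w := by
  have := Nat.mul_le_mul_right w (Nat.succ_le_of_lt hS)
  rw [Nat.succ_mul] at this
  omega

/-- The table `aCube` holds the points of the cube with rows `ρ`. -/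
def HoldsCube (σ : Memory) (w m : ℕ) (ρ : ℕ → ℕ → ZMod 2) : Prop :=
  ∀ S < 2 ^ m, ∀ q < w, σ.nat aCube (S * w + q) = (cube ρ m S q).val

theorem wp_buildCube {n : ℕ} (s : Signal n) {m : ℕ} {σ : Memory} (hn : σ.nat vN 0 = n)
    (hm : σ.nat vExp 0 = m) {x : ℕ → ZMod 2} (hx : HoldsBits σ aRows ((m + 1) * (n + 1)) x) :
    Wp s buildCube σ [] (m * (2 ^ m * (8 * n + 14) + 12) + 4 * n + 17) fun σ' =>
      HoldsCube σ' (n + 1) m fun i q => x (i * (n + 1) + q) := by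
  set w := n + 1 with hw
  set ρ : ℕ → ℕ → ZMod 2 := fun i q => x (i * w + q) with hρ
  refine Wp.time (B := (w * (1 + 3) + 3) + (1 + (1 + (1 +
    (m * ((1 + ((2 ^ m * ((w * (5 + 3) + 3) + 3) + 3) + (1 + 1 + 1) + 1) + 1) + 3) + 3) + 1) + 1) +
      1) + 1) ?_ (le_of_eq (by rw [hw]; ring))
  -- the base point
  refine Wp.seq_nil ((Wp.for_nil (B := 1) (fun j τ => HoldsBits τ aCube j (ρ 0)) w rfl
    (fun τ hF => by simp only [NatExpr.eval, hF.nat vN rfl, hn, hw])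
    (fun j τ v h q hq => by simpa using h q hq) (fun q hq => absurd hq (Nat.not_lt_zero q))
    (fun j τ hj hF hJ h => Wp.setNat fun q hq => ?_)).conseq fun σ1 hF1 h1 => ?_)
  · simp only [NatExpr.eval, hJ, Memory.writeNat_nat_self]
    rcases Nat.lt_succ_iff_lt_or_eq.mp hq with hq | rfl
    · rw [Function.update_of_ne (by omega)]
      exact h q hq
    · rw [Function.update_self, hF.nat aRows rfl, hρ]
      simp only [zero_mul, zero_add]
      exact hx q (lt_of_lt_of_le hj (Nat.le_mul_of_pos_left w (Nat.succ_pos m)))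
  have hn1 : σ1.nat 0 0 = n := by rw [hF1.nat vN rfl]; exact hn
  refine Wp.seq_nil (Wp.setNat ?_)
  refine Wp.seq_nil (Wp.setNat ?_)
  refine Wp.seq_nil (Wp.setNat ?_)
  generalize hσ2 : Memory.writeNat (Memory.writeNat (Memory.writeNat σ1 _ _ _) _ _ _) _ _ _ = σ2
  have hn2 : σ2.nat vN 0 = n := by simp [← hσ2, hn1]
  have hm2 : σ2.nat vExp 0 = m := by simpa [← hσ2, hF1.nat 1 rfl] using hm
  have hr2 : σ2.nat aRows = σ.nat aRows := by simp [← hσ2, hF1.nat 23 rfl]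
  refine (Wp.for_nil (fun z τ => τ.nat vAux 0 = 2 ^ z ∧ τ.nat vDst 0 = 2 ^ z * w ∧
      τ.nat vPtr 0 = (z + 1) * w ∧ HoldsCube τ w z ρ) m rfl
    (fun τ hF => by rw [NatExpr.eval, hF.nat vExp rfl]; exact hm2)
    (fun z τ v h => by simpa [HoldsCube] using h) ?_ ?_).conseq fun τ _ h => h.2.2.2
  · refine ⟨by simp [← hσ2, NatExpr.eval], by simp [← hσ2, NatExpr.eval, hn1, hw],
      by simp [← hσ2, NatExpr.eval, hn1, hw], fun S hS q hq => ?_⟩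
    obtain rfl : S = 0 := by simpa using hS
    have := h1 q hq
    simpa [← hσ2, cube] using this
  rintro z τ hz hF - ⟨hA, hD, hP, hC⟩
  have hnτ : τ.nat vN 0 = n := by rw [hF.nat vN rfl]; exact hn2
  have hrτ : τ.nat aRows = σ.nat aRows := by rw [hF.nat aRows rfl, hr2]
  refine Wp.seq_nil (Wp.setNat ?_)
  generalize hτ1 : Memory.writeNat τ _ _ _ = τ1
  have hnτ1 : τ1.nat vN 0 = n := by simpa [← hτ1] using hnτ
  have hrτ1 : τ1.nat aRows = σ.nat aRows := by simpa [← hτ1] using hrτ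
  have hAτ1 : τ1.nat vAux 0 = 2 ^ z := by simpa [← hτ1] using hA
  have hPτ1 : τ1.nat vPtr 0 = (z + 1) * w := by simpa [← hτ1] using hP
  have hle : 2 ^ z ≤ 2 ^ m := Nat.pow_le_pow_right (by norm_num) hz.le
  refine Wp.seq_nil (B' := 1 + 1 + 1) (((Wp.for_nil (B := w * (5 + 3) + 3)
        (fun S τ' => τ'.nat vSrc 0 = S * w ∧
      τ'.nat vDst 0 = (2 ^ z + S) * w ∧
      ∀ S' < 2 ^ z + S, ∀ q < w, τ'.nat aCube (S' * w + q) = (cube ρ (z + 1) S' q).val) (2 ^ z) rfl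
    (fun τ' hF' => by rw [NatExpr.eval, hF'.nat vAux rfl]; exact hAτ1)
    (fun S τ' v h => by simpa using h) ?_ ?_).time
      (B' := 2 ^ m * ((w * (5 + 3) + 3) + 3) + 3)
      (Nat.add_le_add_right (Nat.mul_le_mul_right _ hle) _)).conseq fun τ2 hF2 h2 => ?_)
  · refine ⟨by simp [← hτ1, NatExpr.eval], by simpa [← hτ1] using hD, fun S' hS' q hq => ?_⟩
    have := hC S' hS' q hq
    rw [cube, if_pos (show S' < 2 ^ z from hS')]
    simpa [← hτ1] using this
  · rintro S τ2 hS hF2 - ⟨hsrc, hdst, htab⟩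
    have hnτ2 : τ2.nat vN 0 = n := by rw [hF2.nat vN rfl]; exact hnτ1
    refine (Wp.for_nil (fun j τ' => τ'.nat vSrc 0 = S * w + j ∧
        τ'.nat vDst 0 = (2 ^ z + S) * w + j ∧
        (∀ S' < 2 ^ z + S, ∀ q < w, τ'.nat aCube (S' * w + q) = (cube ρ (z + 1) S' q).val) ∧
        ∀ q < j, τ'.nat aCube ((2 ^ z + S) * w + q) = (cube ρ (z + 1) (2 ^ z + S) q).val) w rfl
      (fun τ' hF' => by simp only [NatExpr.eval, hF'.nat vN rfl, hnτ2, hw])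
      (fun j τ' v h => by simpa using h)
      ⟨by simpa using hsrc, by simpa using hdst, htab, fun q hq => absurd hq (Nat.not_lt_zero q)⟩
      ?_).conseq fun τ' _ h => ?_
    · rintro j τ3 hj hF3 hJ ⟨hsrc3, hdst3, htab3, hrow3⟩
      have hval : (NatExpr.xor (.get aCube (.var vSrc))
          (.get aRows (.add (.var vPtr) (.var vJ)))).eval τ3 =
            (cube ρ (z + 1) (2 ^ z + S) j).val := by
        rw [cube, if_neg (by omega), Nat.add_sub_cancel_left]
        refine NatExpr.eval_xor ?_ ?_
        · rw [NatExpr.eval, NatExpr.eval, NatExpr.eval, hsrc3, htab3 S (by omega) j hj, cube,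
            if_pos hS]
        · rw [NatExpr.eval, NatExpr.eval, NatExpr.eval, NatExpr.eval, NatExpr.eval, NatExpr.eval,
            hJ,
            hF3.nat vPtr rfl, hF2.nat vPtr rfl, hPτ1, hF3.nat aRows rfl, hF2.nat aRows rfl, hrτ1]
          exact hx _ (row_index_lt (by omega) hj)
      refine Wp.seq_nil (B := 1) (B' := 3) (Wp.setNat ?_)
      refine Wp.seq_nil (B := 1) (B' := 1) (Wp.setNat ?_)
      refine Wp.setNat ?_
      rw [hval]
      have hdv : NatExpr.eval τ3 (.var vDst) = (2 ^ z + S) * w + j := by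
        rw [NatExpr.eval]; exact hdst3
      rw [hdv]
      refine ⟨by simp [NatExpr.eval, hsrc3, add_assoc], by simp [NatExpr.eval, hdst3, add_assoc],
        fun S' hS' q hq => ?_, fun q hq => ?_⟩
      · have := row_index_lt hS' hq
        have e := htab3 S' hS' q hq
        simp only [vSrc, vDst, aCube, ne_eq, Nat.reduceEqDiff,
          not_false_eq_true, Memory.writeNat_nat_of_ne, Memory.writeNat_nat_self]
        rw [Function.update_of_ne (by omega)]
        exact e
      · simp only [vSrc, vDst, aCube, ne_eq, Nat.reduceEqDiff,
          not_false_eq_true, Memory.writeNat_nat_of_ne, Memory.writeNat_nat_self]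
        rcases Nat.lt_succ_iff_lt_or_eq.mp hq with hq | rfl
        · rw [Function.update_of_ne (by omega)]
          exact hrow3 q hq
        · rw [Function.update_self]
    · refine ⟨by rw [h.1]; ring, by rw [h.2.1]; ring, fun S' hS' q hq => ?_⟩
      rcases Nat.lt_succ_iff_lt_or_eq.mp hS' with hS' | rfl
      · exact h.2.2.1 S' hS' q hq
      · exact h.2.2.2 q hq
  · obtain ⟨-, hdst, htab⟩ := h2
    have hAτ2 : τ2.nat 13 0 = 2 ^ z := by rw [hF2.nat vAux rfl]; exact hAτ1
    have hPτ2 : τ2.nat 9 0 = (z + 1) * w := by rw [hF2.nat vPtr rfl]; exact hPτ1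
    have hnτ2 : τ2.nat 0 0 = n := by rw [hF2.nat vN rfl]; exact hnτ1
    refine Wp.seq_nil (B := 1) (B' := 1) (Wp.setNat (Wp.setNat ?_))
    refine ⟨by simp [NatExpr.eval, hAτ2, pow_succ, mul_two], ?_, ?_, fun S hS q hq => ?_⟩
    · simp only [vDst, vPtr, vAux, ne_eq, Nat.reduceEqDiff,
          not_false_eq_true, Memory.writeNat_nat_of_ne]
      rw [hdst, pow_succ, mul_two]
    · simp [NatExpr.eval, hPτ2, hnτ2, hw]
      ring
    · have := htab S (by rw [pow_succ, mul_two] at hS; exact hS) q hq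
      simpa using this

/-! ### Decoding of a character -/

/-- Decode a character that correlates with the function computed by `ev`, over the cube in
`aCube`. -/
def decodeChar (ev : Program) : Program :=
  .for vZ rowLength
    (.setNum nSum (.var vZ) (.ofNat (.lit 0)) ;;
     .assign vPtr (.lit 0) ;;
     .for vS (.var vPow)
      (.for vJ rowLength (.setNat aPoint (.var vJ) (.get aCube (.add (.var vPtr) (.var vJ)))) ;;
       .assign vPtr (.add (.var vPtr) rowLength) ;;
       .setNat aPoint (.var vZ) (.sub (.lit 1) (.get aPoint (.var vZ))) ;;
       ev ;;
       .branch (.natLE (.lit 1) (.get aPoint (.var vN)))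
        (.setNum nSum (.var vZ) (.sub (.get nSum (.var vZ)) (.get nVal (.lit 0))))
        (.setNum nSum (.var vZ) (.add (.get nSum (.var vZ)) (.get nVal (.lit 0)))))) ;;
  .for vZ rowLength
    (.branch
      (.numLE (.ofNat (.lit 0)) (.mul (.get nSum (.var vZ)) (.conj (.get nSum (.var vN)))))
      (.setNat aChar (.var vZ) (.lit 1))
      (.setNat aChar (.var vZ) (.lit 0)))

/-- The program writes only to the working space of the evaluation of a function. -/
structure IsEvaluation (ev : Program) : Prop where
  nat : ∀ a, a ≠ vI → a ≠ vJ → a ≠ aQuery → ev.setsNat a = false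
  num : ∀ a, a ≠ nSample → a ≠ nVal → ev.setsNum a = false

/-- The memories agree on the data that the functions depend on. -/
structure SameData (σ τ : Memory) : Prop where
  len : τ.nat vN = σ.nat vN
  dir : τ.nat aDir = σ.nat aDir
  hankel : τ.nat aHankel = σ.nat aHankel
  theta : τ.num nTheta = σ.num nTheta

theorem SameData.of_frame {p : Program} {σ τ : Memory} (h : Frame p σ τ)
    (h1 : p.setsNat vN = false) (h2 : p.setsNat aDir = false) (h3 : p.setsNat aHankel = false)
    (h4 : p.setsNum nTheta = false) : SameData σ τ :=
  ⟨h.nat _ h1, h.nat _ h2, h.nat _ h3, h.num _ h4⟩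

theorem SameData.trans {σ τ υ : Memory} (h : SameData σ τ) (h' : SameData τ υ) : SameData σ υ :=
  ⟨h'.len.trans h.len, h'.dir.trans h.dir, h'.hankel.trans h.hankel, h'.theta.trans h.theta⟩

theorem wp_decodeChar {n : ℕ} (s : Signal n) {ev : Program} (hev : IsEvaluation ev) {m E : ℕ}
    {σ : Memory} (hn : σ.nat vN 0 = n) (hM : σ.nat vPow 0 = 2 ^ m) {ρ : ℕ → ℕ → ZMod 2}
    (hC : HoldsCube σ (n + 1) m ρ) {F : (Fin n → ZMod 2) → ℂ}
    (hF : ∀ τ u, SameData σ τ → HoldsBits τ aPoint n u →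
      Wp s ev τ [] E fun τ' => τ'.num nVal 0 = F fun j => u j) :
    Wp s (decodeChar ev) σ [] ((n + 1) * (2 ^ m * (4 * n + E + 19) + 16) + 7) fun σ' =>
      HoldsBits σ' aChar (n + 1) (cubeBit F ρ m) := by
  set w := n + 1 with hw
  have evN : ∀ a, a ≠ 7 → a ≠ 8 → a ≠ 29 → ev.setsNat a = false := hev.nat
  have evC : ∀ a, a ≠ 2 → a ≠ 3 → ev.setsNum a = false := hev.num
  refine Wp.time (B := (w * ((1 + (1 + (2 ^ m * (((w * (1 + 3) + 3) + (1 + (1 + (E +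
    (1 + 1 + 1) + 1) + 1) + 1) + 1) + 3) + 3) + 1) + 1) + 3) + 3) +
    (w * ((1 + 1 + 1) + 3) + 3) + 1) ?_ (le_of_eq (by rw [hw]; ring))
  refine Wp.seq_nil ((Wp.for_nil (fun z τ => ∀ z' < z, τ.num nSum z' = cubeSum F ρ m z') w
    (by simp [Program.for, Program.setsNat, evN])
    (fun τ hf => by
      have := hf.nat 0 (by simp [Program.for, Program.setsNat, evN])
      simp only [NatExpr.eval, vN, this, hw]
      rw [show σ.nat 0 0 = n from hn])
    (fun _ _ _ h => h) (fun z hz => absurd hz (Nat.not_lt_zero z)) ?_).conseq fun σ1 hF1 h1 => ?_)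
  · intro z τ hz hf hZ hsum
    have sd : SameData σ τ := .of_frame hf (by simp [Program.for, Program.setsNat, evN])
      (by simp [Program.for, Program.setsNat, evN]) (by simp [Program.for, Program.setsNat, evN])
      (by simp [Program.for, Program.setsNum, evC])
    have hCτ : τ.nat aCube = σ.nat aCube := hf.nat _ (by simp [Program.for, Program.setsNat, evN])
    have hMτ : τ.nat vPow 0 = 2 ^ m := by
      rw [hf.nat _ (by simp [Program.for, Program.setsNat, evN])]; exact hM
    refine Wp.seq_nil (Wp.setNum ?_)
    refine Wp.seq_nil (Wp.setNat ?_)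
    generalize hτ1 : Memory.writeNat (Memory.writeNum τ _ _ _) _ _ _ = τ1
    have hZ1 : τ1.nat 5 0 = z := by simpa [← hτ1] using hZ
    have hM1 : τ1.nat 2 0 = 2 ^ m := by simpa [← hτ1] using hMτ
    have hC1 : τ1.nat 24 = σ.nat 24 := by simpa [← hτ1] using hCτ
    have sd1 : SameData σ τ1 := sd.trans (by constructor <;> simp [← hτ1])
    have hZτ : NatExpr.eval τ (.var vZ) = z := hZ
    refine (Wp.for_nil (fun S τ' => τ'.nat vPtr 0 = S * w ∧
        τ'.num nSum z = ∑ S' ∈ Finset.range S,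
          sgn (flipBit z (cube ρ m S') n) * F (fun j => flipBit z (cube ρ m S') j) ∧
        ∀ z' < z, τ'.num nSum z' = cubeSum F ρ m z') (2 ^ m)
      (by simp [Program.for, Program.setsNat, evN])
      (fun τ' hf' => by
        simp only [NatExpr.eval]
        rw [hf'.nat _ (by simp [Program.for, Program.setsNat, evN])]; exact hM1)
      (fun S τ' v h => by simpa using h) ?_ ?_).conseq fun τ' _ h z' hz' => ?_
    · refine ⟨by simp [← hτ1, NatExpr.eval], ?_, fun z' hz' => ?_⟩
      · rw [← hτ1, Memory.writeNat_num, hZτ, Memory.writeNum_num_self, Function.update_self]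
        simp [NumExpr.eval, NatExpr.eval]
      · rw [← hτ1, Memory.writeNat_num, hZτ, Memory.writeNum_num_self,
          Function.update_of_ne (by omega)]
        exact hsum z' hz'
    · rintro S τ2 hS hf2 - ⟨hP, hacc, hold⟩
      have sd2 : SameData σ τ2 := sd1.trans (.of_frame hf2
        (by simp [Program.for, Program.setsNat, evN])
        (by simp [Program.for, Program.setsNat, evN])
        (by simp [Program.for, Program.setsNat, evN])
        (by simp [Program.for, Program.setsNum, evC]))
      have hZ2 : τ2.nat 5 0 = z := by
        rw [hf2.nat _ (by simp [Program.for, Program.setsNat, evN])]; exact hZ1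
      have hC2 : τ2.nat 24 = σ.nat 24 := by
        rw [hf2.nat _ (by simp [Program.for, Program.setsNat, evN])]; exact hC1
      have hn2 : τ2.nat 0 0 = n := by
        have := sd2.len
        simp only [vN] at this
        rw [this]; exact hn
      refine Wp.seq_nil ((Wp.for_nil (B := 1)
        (fun j τ' => HoldsBits τ' aPoint j (cube ρ m S)) w rfl
        (fun τ' hf' => by
          have := hf'.nat vN rfl
          simp only [vN] at this
          simp only [NatExpr.eval, vN, this, hn2, hw])
        (fun j τ' v h q hq => by simpa using h q hq) (fun q hq => absurd hq (Nat.not_lt_zero q))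
        (fun j τ' hj hf' hJ h => Wp.setNat fun q hq => ?_)).conseq fun τ3 hf3 h3 => ?_)
      · simp only [NatExpr.eval, hJ, Memory.writeNat_nat_self]
        rcases Nat.lt_succ_iff_lt_or_eq.mp hq with hq | rfl
        · rw [Function.update_of_ne (by omega)]
          exact h q hq
        · rw [Function.update_self, hf'.nat vPtr rfl, hP, hf'.nat aCube rfl]
          simp only [aCube, hC2]
          exact hC S hS q hj
      have sd3 : SameData σ τ3 := sd2.trans (.of_frame hf3 rfl rfl rfl rfl)
      have hn3 : τ3.nat 0 0 = n := by
        have := hf3.nat vN rfl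
        simp only [vN] at this
        rw [this]; exact hn2
      have hZ3 : τ3.nat 5 0 = z := by
        have := hf3.nat vZ rfl
        simp only [vZ] at this
        rw [this]; exact hZ2
      have hP3 : τ3.nat 9 0 = S * w := by
        have := hf3.nat vPtr rfl
        simp only [vPtr] at this
        rw [this]; exact hP
      refine Wp.seq_nil (Wp.setNat ?_)
      refine Wp.seq_nil (Wp.setNat ?_)
      generalize hτ4 : Memory.writeNat (Memory.writeNat τ3 _ _ _) _ _ _ = τ4
      have hbits : HoldsBits τ4 aPoint w (flipBit z (cube ρ m S)) := by
        intro q hq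
        have e : ∀ b : ZMod 2, 1 - b.val = (b + 1).val := by decide
        simp only [← hτ4, NatExpr.eval, vPtr, vZ, aPoint, Memory.writeNat_nat_self, ne_eq,
          Nat.reduceEqDiff, not_false_eq_true, Memory.writeNat_nat_of_ne,
          hZ3, flipBit]
        by_cases hqz : q = z
        · subst hqz
          rw [Function.update_self, Function.update_self, ← e]
          congr 1
          exact h3 q hq
        · rw [Function.update_of_ne hqz, Function.update_of_ne hqz]
          exact h3 q hq
      have sd4 : SameData σ τ4 := sd3.trans (by constructor <;> simp [← hτ4])
      have hn4 : τ4.nat 0 0 = n := by simpa [← hτ4] using hn3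
      have hZ4 : τ4.nat 5 0 = z := by simpa [← hτ4] using hZ3
      have hP4 : τ4.nat 9 0 = (S + 1) * w := by
        simp [← hτ4, NatExpr.eval, hP3, hn3, hw]
        ring
      refine Wp.seq_nil ((hF τ4 _ sd4 fun q hq => hbits q (by omega)).conseq fun τ5 hf5 h5 => ?_)
      have hn5 : τ5.nat 0 0 = n := by
        rw [hf5.nat _ (evN _ (by decide) (by decide) (by decide))]; exact hn4
      have hZ5 : τ5.nat 5 0 = z := by
        rw [hf5.nat _ (evN _ (by decide) (by decide) (by decide))]; exact hZ4
      have hP5 : τ5.nat 9 0 = (S + 1) * w := by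
        rw [hf5.nat _ (evN _ (by decide) (by decide) (by decide))]; exact hP4
      have hb5 : τ5.nat 25 n = (flipBit z (cube ρ m S) n).val := by
        rw [hf5.nat _ (evN _ (by decide) (by decide) (by decide))]; exact hbits n (by omega)
      have hs5 : τ5.num 4 = τ2.num 4 := by
        rw [hf5.num _ (evC _ (by decide) (by decide)), ← hτ4]
        exact hf3.num nSum rfl
      have htest : (Test.natLE (.lit 1) (.get aPoint (.var vN))).Holds τ5 ↔
          flipBit z (cube ρ m S) n = 1 := by
        simp only [Test.Holds, NatExpr.eval, vN, aPoint, hn5, hb5, one_le_val_iff]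
      have hzv : NatExpr.eval τ5 (.var vZ) = z := hZ5
      have hfin : ∀ v : ℂ, v = ∑ S' ∈ Finset.range (S + 1),
          sgn (flipBit z (cube ρ m S') n) * F (fun j => flipBit z (cube ρ m S') j) →
          (τ5.writeNum nSum (NatExpr.eval τ5 (.var vZ)) v).nat vPtr 0 = (S + 1) * w ∧
          (τ5.writeNum nSum (NatExpr.eval τ5 (.var vZ)) v).num nSum z =
            ∑ S' ∈ Finset.range (S + 1),
              sgn (flipBit z (cube ρ m S') n) * F (fun j => flipBit z (cube ρ m S') j) ∧
          ∀ z' < z, (τ5.writeNum nSum (NatExpr.eval τ5 (.var vZ)) v).num nSum z' =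
            cubeSum F ρ m z' := by
        intro v hv
        rw [hzv, Memory.writeNum_nat, Memory.writeNum_num_self, Function.update_self]
        refine ⟨hP5, hv, fun z' hz' => ?_⟩
        rw [Function.update_of_ne (by omega)]
        simp only [nSum, hs5]
        exact hold z' hz'
      have hacc' : τ5.num 4 z = ∑ S' ∈ Finset.range S,
          sgn (flipBit z (cube ρ m S') n) * F (fun j => flipBit z (cube ρ m S') j) := by
        rw [hs5]; exact hacc
      refine Wp.branch (fun hb => Wp.setNum (hfin _ ?_)) (fun hb => Wp.setNum (hfin _ ?_))
      · rw [htest] at hb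
        rw [Finset.sum_range_succ, hb, NumExpr.eval, NumExpr.eval, hzv, hacc', NumExpr.eval,
          NatExpr.eval, h5, sgn_one]
        ring
      · rw [htest] at hb
        rw [Finset.sum_range_succ, (zmod_two_cases _).resolve_right hb, NumExpr.eval,
          NumExpr.eval, hzv, hacc', NumExpr.eval, NatExpr.eval, h5, sgn_zero]
        ring
    · rcases Nat.lt_succ_iff_lt_or_eq.mp hz' with hz' | rfl
      · exact h.2.2 z' hz'
      · exact h.2.1
  · have hn1 : σ1.nat 0 0 = n := by
      rw [hF1.nat _ (by simp [Program.for, Program.setsNat, evN])]; exact hn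
    refine Wp.for_nil (fun z τ => HoldsBits τ aChar z (cubeBit F ρ m)) w rfl
      (fun τ hf => by
        have := hf.nat vN rfl
        simp only [vN] at this
        simp only [NatExpr.eval, vN, this, hn1, hw])
      (fun z τ v h q hq => by simpa using h q hq) (fun q hq => absurd hq (Nat.not_lt_zero q)) ?_
    intro z τ hz hf hZ h
    have hs : τ.num nSum = σ1.num nSum := hf.num _ rfl
    have hnτ : NatExpr.eval τ (.var vN) = n := by
      rw [NatExpr.eval, hf.nat vN rfl]; exact hn1
    have hzv : NatExpr.eval τ (.var vZ) = z := hZ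
    have htest : (Test.numLE (.ofNat (.lit 0))
        (.mul (.get nSum (.var vZ)) (.conj (.get nSum (.var vN))))).Holds τ ↔
        0 ≤ (cubeSum F ρ m z * (starRingEnd ℂ) (cubeSum F ρ m n)).re := by
      simp only [Test.Holds, NumExpr.eval, hzv, hnτ, hs, h1 z hz, h1 n (by omega)]
      rw [NatExpr.eval, Nat.cast_zero, Complex.zero_re]
    have hfin : ∀ v, v = (cubeBit F ρ m z).val →
        HoldsBits (τ.writeNat aChar (NatExpr.eval τ (.var vZ)) v) aChar (z + 1)
          (cubeBit F ρ m) := by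
      intro v hv q hq
      rw [hzv, Memory.writeNat_nat_self]
      rcases Nat.lt_succ_iff_lt_or_eq.mp hq with hq | rfl
      · rw [Function.update_of_ne (by omega)]
        exact h q hq
      · rw [Function.update_self, hv]
    refine Wp.branch (fun hb => Wp.setNat (hfin _ ?_)) (fun hb => Wp.setNat (hfin _ ?_))
    · rw [htest] at hb
      rw [cubeBit, if_pos hb]
      rfl
    · rw [htest] at hb
      rw [cubeBit, if_neg hb]
      rfl

/-! ### The linear recurrence -/

/-- Solve the linear recurrence with coefficients `aDir`, initial values `aGuess` and inhomogeneity
`aChar`. -/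
def solveRow : Program :=
  .assign vDeg (.var vExp) ;;
  .for vJ (.var vExp)
    (.branch (.natLE (.lit 1) (.get aDir (.var vJ))) (.assign vDeg (.var vJ)) .skip) ;;
  .for vI (.var vN)
    (.branch (.natLE (.var vDeg) (.var vI))
      (.assign vAux (.get aChar (.sub (.var vI) (.var vDeg))) ;;
       .for vJ (.var vDeg)
        (.branch (.natLE (.lit 1) (.get aDir (.var vJ)))
          (.assign vAux
            (.xor (.var vAux) (.get aRow (.add (.sub (.var vI) (.var vDeg)) (.var vJ)))))
          .skip) ;;
       .setNat aRow (.var vI) (.var vAux))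
      (.setNat aRow (.var vI) (.get aGuess (.var vI))))

theorem lastOne_le (a : ℕ → ZMod 2) (m : ℕ) : lastOne a m m ≤ m := by
  rcases lastOne_cases a m m with h | h
  · exact h.1.le
  · exact h.1.le

theorem wp_solveRow {n : ℕ} (s : Signal n) {m : ℕ} {σ : Memory} (hn : σ.nat vN 0 = n)
    (hm : σ.nat vExp 0 = m) {a g α : ℕ → ZMod 2} (ha : HoldsBits σ aDir m a)
    (hg : HoldsBits σ aGuess m g) (hα : HoldsBits σ aChar n α) :
    Wp s solveRow σ [] (n * (m * 6 + 12) + 6 * m + 9) fun σ' =>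
      HoldsBits σ' aRow n (solveRecurrence a g α (lastOne a m m)) := by
  set d := lastOne a m m with hd
  have hdm : d ≤ m := lastOne_le a m
  refine Wp.time (B := 1 + ((m * ((1 + 1 + 1) + 3) + 3) +
    (n * (((1 + ((m * ((1 + 1 + 1) + 3) + 3) + 1 + 1) + 1) + 1 + 1) + 3) + 3) + 1) + 1) ?_
    (le_of_eq (by ring))
  refine Wp.seq_nil (Wp.setNat ?_)
  generalize hσ1 : Memory.writeNat σ _ _ _ = σ1
  have hm1 : σ1.nat 1 0 = m := by simpa [← hσ1] using hm
  have hn1 : σ1.nat 0 0 = n := by simpa [← hσ1] using hn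
  have ha1 : σ1.nat 21 = σ.nat 21 := by simp [← hσ1]
  refine Wp.seq_nil (B := m * ((1 + 1 + 1) + 3) + 3)
    (B' := n * (((1 + ((m * ((1 + 1 + 1) + 3) + 3) + 1 + 1) + 1) + 1 + 1) + 3) + 3)
    ((Wp.for_nil (fun j τ => τ.nat vDeg 0 = lastOne a m j) m rfl
    (fun τ hF => by rw [NatExpr.eval, hF.nat vExp rfl]; exact hm1)
    (fun j τ v h => by simpa using h) ?_ ?_).conseq fun σ2 hF2 h2 => ?_)
  · simpa [← hσ1, NatExpr.eval, lastOne] using hm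
  · intro j τ hj hF hJ h
    have htest : (Test.natLE (.lit 1) (.get aDir (.var vJ))).Holds τ ↔ a j = 1 := by
      rw [Test.Holds, NatExpr.eval, NatExpr.eval, NatExpr.eval, NatExpr.eval, hJ, hF.nat aDir rfl]
      rw [show σ1.nat aDir j = (a j).val by
        rw [show σ1.nat aDir = σ.nat aDir from ha1]; exact ha j hj, one_le_val_iff]
    refine Wp.branch (fun hb => Wp.setNat ?_) (fun hb => Wp.skip ?_)
    · rw [htest] at hb
      rw [lastOne, if_pos hb]
      simpa [NatExpr.eval] using hJ
    · rw [htest] at hb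
      rw [lastOne, if_neg hb]
      exact h
  have hn2 : σ2.nat vN 0 = n := by rw [hF2.nat vN rfl]; exact hn1
  have ha2 : σ2.nat aDir = σ.nat aDir := by rw [hF2.nat aDir rfl]; exact ha1
  have hg2 : σ2.nat aGuess = σ.nat aGuess := by rw [hF2.nat aGuess rfl]; simp [← hσ1]
  have hα2 : σ2.nat aChar = σ.nat aChar := by rw [hF2.nat aChar rfl]; simp [← hσ1]
  refine Wp.for_nil (fun q τ => HoldsBits τ aRow q (solveRecurrence a g α d)) n rfl
    (fun τ hF => by rw [NatExpr.eval, hF.nat vN rfl]; exact hn2)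
    (fun q τ v h i hi => by simpa using h i hi) (fun q hq => absurd hq (Nat.not_lt_zero q)) ?_
  intro q τ hq hF hI h
  have hdτ : τ.nat vDeg 0 = d := by rw [hF.nat vDeg rfl]; exact h2
  have htest : (Test.natLE (.var vDeg) (.var vI)).Holds τ ↔ d ≤ q := by
    rw [Test.Holds, NatExpr.eval, NatExpr.eval, NatExpr.eval, NatExpr.eval, hI, hdτ]
  have hfin : ∀ (τ' : Memory) v, τ'.nat vI 0 = q → τ'.nat aRow = τ.nat aRow →
      v = (solveRecurrence a g α d q).val →
      HoldsBits (τ'.writeNat aRow (NatExpr.eval τ' (.var vI)) v) aRow (q + 1)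
        (solveRecurrence a g α d) := by
    intro τ' v hI' hrow hv i hi
    rw [NatExpr.eval, NatExpr.eval, hI', Memory.writeNat_nat_self]
    rcases Nat.lt_succ_iff_lt_or_eq.mp hi with hi | rfl
    · rw [Function.update_of_ne (by omega), hrow]
      exact h i hi
    · rw [Function.update_self, hv]
  refine Wp.branch (B := 1 + ((m * ((1 + 1 + 1) + 3) + 3) + 1 + 1) + 1) (B' := 1)
    (fun hb => ?_) (fun hb => Wp.setNat (hfin τ _ hI rfl ?_))
  · rw [htest] at hb
    refine Wp.seq_nil (Wp.setNat ?_)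
    generalize hτ1 : Memory.writeNat τ _ _ _ = τ1
    have hd1 : τ1.nat 12 0 = d := by simpa [← hτ1] using hdτ
    have hI1 : τ1.nat 7 0 = q := by simpa [← hτ1] using hI
    have hrow1 : τ1.nat 27 = τ.nat 27 := by simp [← hτ1]
    have hdir1 : τ1.nat 21 = σ.nat 21 := by
      have := hF.nat aDir rfl
      simp only [aDir] at this ha2
      simp [← hτ1, this, ha2]
    have hstart : τ1.nat 13 0 = (α (q - d)).val := by
      rw [← hτ1, Memory.writeNat_nat_self, NatExpr.eval, Function.update_self, NatExpr.eval,
        NatExpr.eval, NatExpr.eval, NatExpr.eval, NatExpr.eval, NatExpr.eval,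
        hI, hdτ, hF.nat aChar rfl, hα2]
      exact hα _ (by omega)
    refine Wp.seq_nil (B := m * ((1 + 1 + 1) + 3) + 3) (B' := 1)
      (((Wp.for_nil (B := 1 + 1 + 1) (fun j τ' => τ'.nat vAux 0 =
        (α (q - d) + ∑ j' ∈ Finset.range j,
          a j' * solveRecurrence a g α d (q - d + j')).val) d rfl
      (fun τ' hF' => by rw [NatExpr.eval, hF'.nat vDeg rfl]; exact hd1)
      (fun j τ' v h => by simpa using h) (by simpa using hstart) ?_).time
        (Nat.add_le_add_right (Nat.mul_le_mul_right _ hdm) _)).conseq fun τ2 hF2' h2' => ?_)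
    · intro j τ' hj hF' hJ hacc
      have hrow' : τ'.nat aRow = τ.nat aRow := by rw [hF'.nat aRow rfl]; exact hrow1
      have htest' : (Test.natLE (.lit 1) (.get aDir (.var vJ))).Holds τ' ↔ a j = 1 := by
        rw [Test.Holds, NatExpr.eval, NatExpr.eval, NatExpr.eval, NatExpr.eval, hJ,
          hF'.nat aDir rfl]
        rw [show τ1.nat aDir j = (a j).val by
          rw [show τ1.nat aDir = σ.nat aDir from hdir1]; exact ha j (by omega), one_le_val_iff]
      refine Wp.branch (fun hb' => Wp.setNat ?_) (fun hb' => Wp.skip ?_)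
      · rw [htest'] at hb'
        rw [NatExpr.eval, Memory.writeNat_nat_self, Function.update_self, Finset.sum_range_succ,
          ← add_assoc, hb', one_mul]
        refine NatExpr.eval_xor ?_ ?_
        · rw [NatExpr.eval, NatExpr.eval]; exact hacc
        · have hI' : τ'.nat vI 0 = q := by rw [hF'.nat vI rfl]; exact hI1
          have hd' : τ'.nat vDeg 0 = d := by rw [hF'.nat vDeg rfl]; exact hd1
          rw [NatExpr.eval, NatExpr.eval, NatExpr.eval, NatExpr.eval, NatExpr.eval, NatExpr.eval,
            NatExpr.eval, NatExpr.eval, NatExpr.eval, hI', hd', hJ, hrow']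
          exact h _ (by omega)
      · rw [htest'] at hb'
        rw [Finset.sum_range_succ, (zmod_two_cases _).resolve_right hb', zero_mul, add_zero]
        exact hacc
    · refine Wp.setNat (hfin τ2 _ ?_ ?_ ?_)
      · rw [hF2'.nat vI rfl]; exact hI1
      · rw [hF2'.nat aRow rfl]; exact hrow1
      · rw [NatExpr.eval, NatExpr.eval, h2', solveRecurrence, dif_neg (by omega),
          Fin.sum_univ_eq_sum_range (fun j => a j * solveRecurrence a g α d (q - d + j))]
  · rw [htest] at hb
    rw [solveRecurrence, dif_pos (by omega), NatExpr.eval, NatExpr.eval, NatExpr.eval, hI,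
      hF.nat aGuess rfl, hg2]
    exact hg q (by omega)

/-! ### The two halves of the Hankel matrix -/

/-- The registers hold the parameters of the trials. -/
structure Ready (σ : Memory) (n m : ℕ) (k : ℝ) : Prop where
  dim : σ.nat vN 0 = n
  exp : σ.nat vExp 0 = m
  pow : σ.nat vPow 0 = 2 ^ m
  len : σ.nat vLen 0 = (m + 1) * (n + 1)
  bound : σ.num nK 0 = k

theorem Ready.of_frame {p : Program} {σ τ : Memory} {n m : ℕ} {k : ℝ} (h : Ready σ n m k)
    (hF : Frame p σ τ) (h1 : p.setsNat vN = false) (h2 : p.setsNat vExp = false)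
    (h3 : p.setsNat vPow = false) (h4 : p.setsNat vLen = false) (h5 : p.setsNum nK = false) :
    Ready τ n m k where
  dim := by rw [hF.nat _ h1]; exact h.dim
  exp := by rw [hF.nat _ h2]; exact h.exp
  pow := by rw [hF.nat _ h3]; exact h.pow
  len := by rw [hF.nat _ h4]; exact h.len
  bound := by rw [hF.num _ h5]; exact h.bound

/-- The index of the reverse diagonal through entry `vI` of the first row, or, counted backwards, of
the last row. -/
def diagonal (rev : Bool) : NatExpr :=
  if rev then .sub (.sub (.add (.var vN) (.var vN)) (.lit 2)) (.var vI) else .var vI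

/-- Decode the first row of the Hankel matrix or, from the reversed signal, its last row. -/
def decodeHalf (rev : Bool) : Program :=
  fill aDir vExp ;;
  .for vJ (.var vN)
    (.branch (.natLE (.var vExp) (.var vJ)) (.setNat aDir (.var vJ) (.lit 0)) .skip) ;;
  fill aGuess vExp ;;
  fill aRows vLen ;;
  buildCube ;;
  decodeChar (evalDerivative rev) ;;
  solveRow ;;
  .for vI (.var vN) (.setNat aHankel (diagonal rev) (.get aRow (.var vI)))

theorem isEvaluation_evalDerivative (rev : Bool) : IsEvaluation (evalDerivative rev) := by
  have hN : ∀ a, (evalDerivative rev).setsNat a = ((8 == a || (29 == a || 8 == a)) || (false ||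
      ((8 == a || (29 == a || 8 == a)) || false))) := fun a => rfl
  have hC : ∀ a, (evalDerivative rev).setsNum a = ((false || (false || false)) ||
      ((2 == a || (false || 2 == a)) || ((false || (false || false)) ||
        ((2 == a || (false || 2 == a)) || 3 == a)))) := fun a => rfl
  refine ⟨fun a h1 h2 h3 => ?_, fun a h1 h2 => ?_⟩
  · have h2' : (8 : ℕ) ≠ a := Ne.symm h2
    have h3' : (29 : ℕ) ≠ a := Ne.symm h3
    simp [hN, h2', h3']
  · have h1' : (2 : ℕ) ≠ a := Ne.symm h1
    have h2' : (3 : ℕ) ≠ a := Ne.symm h2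
    simp [hC, h1', h2']

/-- The number of steps of `decodeHalf`. -/
def halfTime (n m : ℕ) : ℕ :=
  (m * 4 + 3) + ((n * ((1 + 1 + 1) + 3) + 3) + ((m * 4 + 3) + (((m + 1) * (n + 1) * 4 + 3) +
    ((m * (2 ^ m * (8 * n + 14) + 12) + 4 * n + 17) +
      (((n + 1) * (2 ^ m * (4 * n + (8 * n + 21) + 19) + 16) + 7) +
        ((n * (m * 6 + 12) + 6 * m + 9) + (n * (1 + 3) + 3) + 1) + 1) + 1) + 1) + 1) + 1) + 1

theorem wp_decodeHalf {n : ℕ} (s : Signal n) (rev : Bool) {m : ℕ} {k θ : ℝ} {σ : Memory}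
    (hσ : Ready σ n m k) (hθ : (σ.num nTheta 0).re = θ) {a g r : List Bool} (hla : a.length = m)
    (hlg : g.length = m) (hlr : r.length = (m + 1) * (n + 1)) :
    Wp s (decodeHalf rev) σ (a ++ (g ++ r)) (halfTime n m) fun σ' =>
      (∀ i < n, σ'.nat aHankel (if rev then 2 * n - 2 - i else i) =
        (decodeRow (orient rev (truncate θ s.ofLp)) m (bitsOf a) (bitsOf g)
          (rowsOf (n + 1) r) i).val) ∧
      (rev = true → ∀ q < n - 1, σ'.nat aHankel q = σ.nat aHankel q) := by
  rw [halfTime]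
  refine Wp.seq (B := m * 4 + 3) (((wp_fill s (A := aDir) (v := vExp) (x := a) (by decide)
    (by decide) (by decide) (by rw [hla]; exact hσ.exp)).time (by rw [hla])).conseq
    fun σ1 hF1 h1 => ?_)
  rw [hla] at h1
  have r1 := hσ.of_frame hF1 rfl rfl rfl rfl rfl
  refine Wp.seq_nil (B := n * ((1 + 1 + 1) + 3) + 3) ((Wp.for_nil
    (fun j τ => HoldsBits τ aDir (max m j) (bitsOf a)) n rfl
    (fun τ hF => by rw [NatExpr.eval, hF.nat vN rfl]; exact r1.dim)
    (fun j τ v h q hq => by simpa using h q hq) (by simpa using h1) ?_).conseq fun σ2 hF2 h2 => ?_)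
  · intro j τ hj hF hJ h
    have hm : τ.nat vExp 0 = m := by rw [hF.nat vExp rfl]; exact r1.exp
    refine Wp.branch (fun hb => Wp.setNat ?_) (fun hb => Wp.skip ?_)
    · rw [Test.Holds, NatExpr.eval, NatExpr.eval, NatExpr.eval, NatExpr.eval, hJ, hm] at hb
      intro q hq
      rw [NatExpr.eval, NatExpr.eval, NatExpr.eval, hJ, Memory.writeNat_nat_self]
      by_cases hqj : q = j
      · rw [hqj, Function.update_self, bitsOf_eq_zero (by omega)]
        rfl
      · rw [Function.update_of_ne hqj]
        exact h q (by omega)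
    · rw [Test.Holds, NatExpr.eval, NatExpr.eval, NatExpr.eval, NatExpr.eval, hJ, hm] at hb
      intro q hq
      exact h q (by omega)
  have r2 := r1.of_frame hF2 rfl rfl rfl rfl rfl
  refine Wp.seq (B := m * 4 + 3) (((wp_fill s (A := aGuess) (v := vExp) (x := g) (by decide)
    (by decide) (by decide) (by rw [hlg]; exact r2.exp)).time (by rw [hlg])).conseq
    fun σ3 hF3 h3 => ?_)
  rw [hlg] at h3
  have r3 := r2.of_frame hF3 rfl rfl rfl rfl rfl
  refine Wp.seq_last (B := (m + 1) * (n + 1) * 4 + 3) (((wp_fill s (A := aRows) (v := vLen) (x := r)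
    (by decide) (by decide) (by decide) (by rw [hlr]; exact r3.len)).time (by rw [hlr])).conseq
    fun σ4 hF4 h4 => ?_)
  rw [hlr] at h4
  have r4 := r3.of_frame hF4 rfl rfl rfl rfl rfl
  refine Wp.seq_nil ((wp_buildCube s r4.dim r4.exp h4).conseq fun σ5 hF5 h5 => ?_)
  have r5 := r4.of_frame hF5 rfl rfl rfl rfl rfl
  have hdir5 : HoldsBits σ5 aDir (max m n) (bitsOf a) := by
    intro q hq
    rw [hF5.nat aDir rfl, hF4.nat aDir rfl, hF3.nat aDir rfl]
    exact h2 q hq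
  have hg5 : HoldsBits σ5 aGuess m (bitsOf g) := by
    intro q hq
    rw [hF5.nat aGuess rfl, hF4.nat aGuess rfl]
    exact h3 q hq
  have hθ5 : (σ5.num nTheta 0).re = θ := by
    rw [hF5.num nTheta rfl, hF4.num nTheta rfl, hF3.num nTheta rfl, hF2.num nTheta rfl,
      hF1.num nTheta rfl]
    exact hθ
  refine Wp.seq_nil ((wp_decodeChar s (isEvaluation_evalDerivative rev) r5.dim r5.pow h5
    (F := derivative (orient rev (truncate θ s.ofLp)) fun j => bitsOf a j)
    fun τ u hsd hu => wp_evalDerivative s rev (by rw [hsd.len]; exact r5.dim)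
      (by rw [hsd.theta]; exact hθ5) hu fun q hq => by
        rw [hsd.dir]; exact hdir5 q (by omega)).conseq fun σ6 hF6 h6 => ?_)
  have r6 := r5.of_frame hF6 rfl rfl rfl rfl rfl
  refine Wp.seq_nil (B := n * (m * 6 + 12) + 6 * m + 9) (B' := n * (1 + 3) + 3)
    ((wp_solveRow s r6.dim r6.exp (a := bitsOf a) (g := bitsOf g)
    (α := cubeBit (derivative (orient rev (truncate θ s.ofLp)) fun j => bitsOf a j)
      (rowsOf (n + 1) r) m) (fun q hq => by rw [hF6.nat aDir rfl]; exact hdir5 q (by omega))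
    (fun q hq => by rw [hF6.nat aGuess rfl]; exact hg5 q hq) (fun q hq => h6 q (by omega))).conseq
    fun σ7 hF7 h7 => ?_)
  have r7 := r6.of_frame hF7 rfl rfl rfl rfl rfl
  have hH7 : σ7.nat aHankel = σ.nat aHankel := by
    rw [hF7.nat aHankel rfl, hF6.nat aHankel rfl, hF5.nat aHankel rfl, hF4.nat aHankel rfl,
      hF3.nat aHankel rfl, hF2.nat aHankel rfl, hF1.nat aHankel rfl]
  refine Wp.for_nil (fun q τ => (∀ i < q, τ.nat aHankel (if rev then 2 * n - 2 - i else i) =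
        (decodeRow (orient rev (truncate θ s.ofLp)) m (bitsOf a) (bitsOf g)
          (rowsOf (n + 1) r) i).val) ∧
      (rev = true → ∀ q < n - 1, τ.nat aHankel q = σ.nat aHankel q)) n rfl
    (fun τ hF => by rw [NatExpr.eval, hF.nat vN rfl]; exact r7.dim)
    (fun q τ v h => by simpa using h)
    ⟨fun i hi => absurd hi (Nat.not_lt_zero i), fun _ q _ => by rw [hH7]⟩ ?_
  rintro q τ hq hF hI ⟨hdone, hkeep⟩
  have hn : τ.nat vN 0 = n := by rw [hF.nat vN rfl]; exact r7.dim
  have hdiag : (diagonal rev).eval τ = if rev then 2 * n - 2 - q else q := by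
    cases rev with
    | false => simp only [diagonal, NatExpr.eval, Bool.false_eq_true, if_false, hI]
    | true => simp only [diagonal, NatExpr.eval, if_true, hI, hn]; omega
  refine Wp.setNat ?_
  rw [hdiag, Memory.writeNat_nat_self]
  refine ⟨fun i hi => ?_, fun hr i hi => ?_⟩
  · rcases Nat.lt_succ_iff_lt_or_eq.mp hi with hi | rfl
    · rw [Function.update_of_ne (by cases rev <;> simp <;> omega)]
      exact hdone i hi
    · rw [Function.update_self, NatExpr.eval, NatExpr.eval, NatExpr.eval, hI, hF.nat aRow rfl]
      exact h7 i hq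
  · rw [Function.update_of_ne (by rw [hr, if_pos rfl]; omega)]
    exact hkeep hr i hi

/-! ### A trial -/

/-- Write the decoded label to the output. -/
def emitLabel : Program :=
  .for vI (.var vN) (.for vJ (.var vN) (.emit (.get aHankel (.add (.var vI) (.var vJ))))) ;;
  .for vJ (.var vN) (.emit (.get aChar (.var vJ)))

theorem ofFn_eq_map_range {α : Type*} (n : ℕ) (f : ℕ → α) :
    (List.ofFn fun i : Fin n => f i) = (List.range n).map f :=
  List.ext_getElem (by simp) fun i h1 h2 => by simp

theorem encode_of (n : ℕ) (p u : ℕ → ZMod 2) :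
    encode ((Matrix.of fun i j => p ((i : ℕ) + j), fun z => u z) : Label n) =
      ((List.range n).flatMap fun i => (List.range n).map fun j => p (i + j)) ++
        (List.range n).map u := by
  have e : (List.ofFn fun i : Fin n => List.ofFn fun j : Fin n => p ((i : ℕ) + j)) =
      (List.range n).map fun i => (List.range n).map fun j => p (i + j) := by
    rw [← ofFn_eq_map_range n]
    congr 1
    funext i
    exact ofFn_eq_map_range n fun j => p (i + j)
  rw [List.flatMap_def, ← e, ← ofFn_eq_map_range n u]
  rfl

theorem wp_emitLabel {n : ℕ} (s : Signal n) {σ : Memory} (hn : σ.nat vN 0 = n) {p u : ℕ → ZMod 2}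
    (hp : HoldsBits σ aHankel (2 * n - 1) p) (hu : HoldsBits σ aChar n u) :
    Wp s emitLabel σ [] (n * (n * 4 + 6) + 4 * n + 7) fun σ' => σ'.out =
      σ.out ++ encode ((Matrix.of fun i j => p ((i : ℕ) + j), fun z => u z) : Label n) := by
  rw [encode_of, ← List.append_assoc]
  refine Wp.time (B := (n * ((n * (1 + 3) + 3) + 3) + 3) + (n * (1 + 3) + 3) + 1) ?_
    (le_of_eq (by ring))
  refine Wp.seq_nil ((Wp.for_nil (fun i τ => τ.out = σ.out ++ (List.range i).flatMap fun i' =>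
    (List.range n).map fun j => p (i' + j)) n rfl
    (fun τ hF => by rw [NatExpr.eval, hF.nat vN rfl]; exact hn)
    (fun i τ v h => h) (by simp) ?_).conseq fun σ1 hF1 h1 => ?_)
  · intro i τ hi hF hI h
    refine (Wp.for_nil (fun j τ' => τ'.out = τ.out ++ (List.range j).map fun j' => p (i + j')) n rfl
      (fun τ' hF' => by rw [NatExpr.eval, hF'.nat vN rfl, hF.nat vN rfl]; exact hn)
      (fun j τ' v h => h) (by simp) ?_).conseq fun τ' hF' h' => ?_
    · intro j τ' hj hF' hJ h'
      refine Wp.emit ?_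
      have hI' : τ'.nat vI 0 = i := by rw [hF'.nat vI rfl]; exact hI
      have e : NatExpr.eval τ' (.get aHankel (.add (.var vI) (.var vJ))) = (p (i + j)).val := by
        rw [NatExpr.eval, NatExpr.eval, NatExpr.eval, NatExpr.eval, NatExpr.eval, NatExpr.eval, hI',
          hJ, hF'.nat aHankel rfl, hF.nat aHankel rfl]
        exact hp _ (by omega)
      simp only [e, ZMod.natCast_zmod_val, h', List.range_succ, List.map_append, List.map_singleton,
        List.append_assoc]
    · simp only [h', h, List.range_succ, List.flatMap_append, List.flatMap_singleton,
        List.append_assoc]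
  · refine (Wp.for_nil (fun j τ' => τ'.out = σ1.out ++ (List.range j).map u) n rfl
      (fun τ' hF' => by rw [NatExpr.eval, hF'.nat vN rfl, hF1.nat vN rfl]; exact hn)
      (fun j τ' v h => h) (by simp) ?_).conseq fun τ' hF' h' => by rw [h', h1]
    intro j τ' hj hF' hJ h'
    refine Wp.emit ?_
    have e : NatExpr.eval τ' (.get aChar (.var vJ)) = (u j).val := by
      rw [NatExpr.eval, NatExpr.eval, NatExpr.eval,
        hJ, hF'.nat aChar rfl, hF1.nat aChar rfl]
      exact hu _ hj
    simp only [e, ZMod.natCast_zmod_val, h', List.range_succ, List.map_append, List.map_singleton,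
      List.append_assoc]

theorem isEvaluation_evalDechirp : IsEvaluation evalDechirp := by
  have hN : ∀ a, evalDechirp.setsNat a = ((8 == a || (29 == a || 8 == a)) || (false ||
      (false || (7 == a || ((8 == a || (false || 8 == a)) || 7 == a))))) := fun a => by
    cases h : evalDechirp.setsNat a <;>
      simp_all [evalDechirp, setQuery, sampleTruncated, Program.for, Program.setsNat]
  have hC : ∀ a, evalDechirp.setsNum a = true → a = 2 ∨ a = 3 := fun a => by
    simp only [evalDechirp, setQuery, sampleTruncated, Program.for, Program.setsNum]
    simp only [Bool.or_eq_true, beq_iff_eq, nSample, nVal]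
    grind
  refine ⟨fun a h1 h2 h3 => ?_, fun a h1 h2 => ?_⟩
  · have h1' : (7 : ℕ) ≠ a := Ne.symm h1
    have h2' : (8 : ℕ) ≠ a := Ne.symm h2
    have h3' : (29 : ℕ) ≠ a := Ne.symm h3
    simp [hN, h1', h2', h3']
  · by_contra h
    rcases hC a (by simpa using h) with h | h
    · exact h1 h
    · exact h2 h

/-- One trial: sample a random position to fix the level of truncation, decode the two halves of a
Hankel matrix, remove its quadratic phase, decode the remaining character, and output the label. -/
def trial : Program :=
  fill aPos vN ;;
  .query nSample (.lit 0) aPos (.lit 0) ;;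
  .setNum nTheta (.lit 0) (.mul
    (.mul (.ofNat (.lit 16)) (.mul (.get nK (.lit 0)) (.get nK (.lit 0))))
    (.mul (.get nSample (.lit 0)) (.conj (.get nSample (.lit 0))))) ;;
  decodeHalf false ;;
  decodeHalf true ;;
  fill aRows vLen ;;
  buildCube ;;
  decodeChar evalDechirp ;;
  emitLabel

/-- The number of steps of `trial`. -/
def trialTime (n m : ℕ) : ℕ :=
  (n * 4 + 3) + (1 + (1 + (halfTime n m + (halfTime n m + (((m + 1) * (n + 1) * 4 + 3) +
    ((m * (2 ^ m * (8 * n + 14) + 12) + 4 * n + 17) +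
      (((n + 1) * (2 ^ m * (4 * n + (n * (n * 6 + 6) + 4 * n + 15) + 19) + 16) + 7) +
        (n * (n * 4 + 6) + 4 * n + 7) + 1) + 1) + 1) + 1) + 1) + 1) + 1) + 1

theorem exists_append_of_length_add {α : Type*} {x : List α} {a b : ℕ} (h : x.length = a + b) :
    ∃ y z, y.length = a ∧ z.length = b ∧ x = y ++ z :=
  ⟨x.take a, x.drop a, by simp [h], by simp [h], (List.take_append_drop a x).symm⟩

theorem wp_trial {n : ℕ} (s : Signal n) {m : ℕ} {k : ℝ} {σ : Memory}
    (hσ : Ready σ n m k) {x : List Bool} (hx : x.length = trialLength n m) :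
    Wp s trial σ x (trialTime n m) fun σ' =>
      σ'.out = σ.out ++ encode (trialLabel s.ofLp k m x : Label n) := by
  rw [trialLength] at hx
  obtain ⟨y₀, x1, h₀, hx1, rfl⟩ := exists_append_of_length_add hx
  obtain ⟨a, x2, hla, hx2, rfl⟩ := exists_append_of_length_add hx1
  obtain ⟨g, x3, hlg, hx3, rfl⟩ := exists_append_of_length_add hx2
  obtain ⟨r, x4, hlr, hx4, rfl⟩ := exists_append_of_length_add hx3
  obtain ⟨a', x5, hla', hx5, rfl⟩ := exists_append_of_length_add hx4
  obtain ⟨g', x6, hlg', hx6, rfl⟩ := exists_append_of_length_add hx5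
  obtain ⟨r', r'', hlr', hlr'', rfl⟩ := exists_append_of_length_add hx6
  rw [trialLabel_append s.ofLp k h₀ hla hlg hlr hla' hlg' hlr', trialTime, labelOf]
  set θ := 16 * k ^ 2 * Complex.normSq (s fun j => bitsOf y₀ j) with hθdef
  set h := truncate θ s.ofLp with hh
  refine Wp.seq (B := n * 4 + 3) (((wp_fill s (A := aPos) (v := vN) (x := y₀) (by decide)
    (by decide) (by decide) (by rw [h₀]; exact hσ.dim)).time (by rw [h₀])).conseq
    fun σ1 hF1 h1 => ?_)
  rw [h₀] at h1
  have r1 := hσ.of_frame hF1 rfl rfl rfl rfl rfl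
  refine Wp.seq_nil (Wp.query ?_)
  refine Wp.seq_nil (Wp.setNum ?_)
  have hpos : (fun j : Fin n => ((σ1.nat aPos (NatExpr.eval σ1 (.lit 0) + (j : ℕ)) : ℕ) : ZMod 2)) =
      fun j : Fin n => bitsOf y₀ j := by
    funext j
    rw [NatExpr.eval, Nat.zero_add, h1 j j.isLt, ZMod.natCast_zmod_val]
  rw [hpos]
  generalize hσ2 : Memory.writeNum (Memory.writeNum σ1 _ _ _) _ _ _ = σ2
  have hθ2 : (σ2.num nTheta 0).re = θ := by
    have := r1.bound
    simp only [nK] at this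
    simp [← hσ2, NumExpr.eval, NatExpr.eval, this]
    rw [hθdef, Complex.normSq_apply]
    ring
  have ho2 : σ2.out = σ.out := by rw [← hσ2]; exact hF1.out rfl
  have r2 : Ready σ2 n m k := by
    subst hσ2
    exact ⟨r1.dim, r1.exp, r1.pow, r1.len, by simpa using r1.bound⟩
  rw [show a ++ (g ++ (r ++ (a' ++ (g' ++ (r' ++ r''))))) =
    (a ++ (g ++ r)) ++ ((a' ++ (g' ++ r')) ++ r'') by simp only [List.append_assoc]]
  refine Wp.seq ((wp_decodeHalf s false r2 hθ2 hla hlg hlr).conseq fun σ3 hF3 h3 => ?_)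
  have r3 := r2.of_frame hF3 rfl rfl rfl rfl rfl
  have hθ3 : (σ3.num nTheta 0).re = θ := by rw [hF3.num nTheta rfl]; exact hθ2
  refine Wp.seq ((wp_decodeHalf s true r3 hθ3 hla' hlg' hlr').conseq fun σ4 hF4 h4 => ?_)
  have r4 := r3.of_frame hF4 rfl rfl rfl rfl rfl
  have hθ4 : (σ4.num nTheta 0).re = θ := by rw [hF4.num nTheta rfl]; exact hθ3
  set p := decodeRow h m (bitsOf a) (bitsOf g) (rowsOf (n + 1) r) with hp
  set p' := decodeRow (reversed h) m (bitsOf a') (bitsOf g') (rowsOf (n + 1) r') with hp'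
  set pp : ℕ → ZMod 2 := fun q => if n - 1 ≤ q then p' (2 * n - 2 - q) else p q with hpp
  have hH4 : HoldsBits σ4 aHankel (2 * n - 1) pp := by
    intro q hq
    rw [hpp]
    dsimp only
    split_ifs with hc
    · have := h4.1 (2 * n - 2 - q) (by omega)
      rw [if_pos rfl, show 2 * n - 2 - (2 * n - 2 - q) = q by omega] at this
      exact this
    · rw [h4.2 rfl q (by omega)]
      have := h3.1 q (by omega)
      rwa [if_neg (by decide)] at this
  have hmat : hankelOf n p p' = Matrix.of fun i j : Fin n => pp ((i : ℕ) + j) := rfl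
  refine Wp.seq_last (B := (m + 1) * (n + 1) * 4 + 3) (((wp_fill s (A := aRows) (v := vLen)
    (x := r'') (by decide) (by decide) (by decide) (by rw [hlr'']; exact r4.len)).time
    (by rw [hlr''])).conseq fun σ5 hF5 h5 => ?_)
  rw [hlr''] at h5
  have r5 := r4.of_frame hF5 rfl rfl rfl rfl rfl
  refine Wp.seq_nil ((wp_buildCube s r5.dim r5.exp h5).conseq fun σ6 hF6 h6 => ?_)
  have r6 := r5.of_frame hF6 rfl rfl rfl rfl rfl
  have hH6 : HoldsBits σ6 aHankel (2 * n - 1) pp := by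
    intro q hq
    rw [hF6.nat aHankel rfl, hF5.nat aHankel rfl]
    exact hH4 q hq
  have hθ6 : (σ6.num nTheta 0).re = θ := by
    rw [hF6.num nTheta rfl, hF5.num nTheta rfl]; exact hθ4
  refine Wp.seq_nil (B' := n * (n * 4 + 6) + 4 * n + 7)
    ((wp_decodeChar s isEvaluation_evalDechirp r6.dim r6.pow h6
    (F := dechirp h (Matrix.of fun i j : Fin n => pp ((i : ℕ) + j)))
    fun τ u hsd hu => wp_evalDechirp s (by rw [hsd.len]; exact r6.dim)
      (by rw [hsd.theta]; exact hθ6) hu fun q hq => by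
        rw [hsd.hankel]; exact hH6 q hq).conseq fun σ7 hF7 h7 => ?_)
  have r7 := r6.of_frame hF7 rfl rfl rfl rfl rfl
  refine (wp_emitLabel s r7.dim (p := pp) (u := cubeBit (dechirp h
    (Matrix.of fun i j : Fin n => pp ((i : ℕ) + j))) (rowsOf (n + 1) r'') m)
    (fun q hq => by rw [hF7.nat aHankel rfl]; exact hH6 q hq)
    (fun q hq => h7 q (by omega))).conseq fun σ8 hF8 h8 => ?_
  rw [h8, hF7.out rfl, hF6.out rfl, hF5.out rfl, hF4.out rfl, hF3.out rfl, ho2, decodeLabel,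
    hmat]

/-! ### The program -/

/-- A power with a constant exponent. -/
def NumExpr.npow (x : NumExpr) : ℕ → NumExpr
  | 0 => .ofNat (.lit 1)
  | j + 1 => .mul (x.npow j) x

theorem NumExpr.eval_npow (σ : Memory) (x : NumExpr) (j : ℕ) :
    (x.npow j).eval σ = x.eval σ ^ j := by
  induction j with
  | zero => simp [NumExpr.npow, NumExpr.eval, NatExpr.eval]
  | succ j ih => rw [NumExpr.npow, NumExpr.eval, ih, pow_succ]

/-- The dimension of the random cubes: the least `m` with `2 ^ 26 * n * k ^ 8 ≤ 2 ^ m`. -/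
noncomputable def cubeDim (n : ℕ) (k : ℝ) : ℕ := Nat.clog 2 ⌈2 ^ 26 * n * k ^ 8⌉₊

/-- The number of trials. -/
noncomputable def rounds (c n : ℕ) (k : ℝ) : ℕ :=
  ⌈((c + 3) * 1024 : ℕ) * n * k * (2 ^ cubeDim n k) ^ 7⌉₊

theorem cubeDim_le_iff {n : ℕ} {k : ℝ} {j : ℕ} :
    cubeDim n k ≤ j ↔ 2 ^ 26 * n * k ^ 8 ≤ (2 : ℝ) ^ j := by
  rw [cubeDim, Nat.clog_le_iff_le_pow (by norm_num), Nat.ceil_le]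
  push_cast
  rfl

theorem rounds_le_iff {c n : ℕ} {k : ℝ} {j : ℕ} :
    rounds c n k ≤ j ↔ ((c + 3) * 1024 : ℕ) * n * k * (2 ^ cubeDim n k) ^ 7 ≤ (j : ℝ) := by
  rw [rounds, Nat.ceil_le]

/-- Compute the dimension of the cubes. -/
def findDim : Program :=
  .assign vPow (.lit 1) ;;
  .loop (.not (.numLE
      (.mul (.mul (.ofNat (.lit (2 ^ 26))) (.ofNat (.var vN))) (.npow (.get nK (.lit 0)) 8))
      (.ofNat (.var vPow))))
    (.assign vPow (.add (.var vPow) (.var vPow)) ;; .assign vExp (.add (.var vExp) (.lit 1)))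

/-- Compute the number of entries of the rows of a cube. -/
def findLen : Program :=
  .for vZ (.add (.var vExp) (.lit 1)) (.assign vLen (.add (.var vLen) rowLength))

/-- The list decoding algorithm with failure probability `N ^ (-c)`. -/
def algorithm (c : ℕ) : Program :=
  findDim ;;
  findLen ;;
  .loop (.not (.numLE
      (.mul (.mul (.mul (.ofNat (.lit ((c + 3) * 1024))) (.ofNat (.var vN))) (.get nK (.lit 0)))
        (.npow (.ofNat (.var vPow)) 7))
      (.ofNat (.var vRound))))
    (trial ;; .assign vRound (.add (.var vRound) (.lit 1)))

/-- The number of steps of `algorithm`. -/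
noncomputable def algorithmTime (c n : ℕ) (k : ℝ) : ℕ :=
  (1 + (cubeDim n k * ((1 + 1 + 1) + 1) + 1) + 1) + (((cubeDim n k + 1) * (1 + 3) + 3) +
    (rounds c n k * ((trialTime n (cubeDim n k) + 1 + 1) + 1) + 1) + 1) + 1

theorem wp_findDim {n : ℕ} (s : Signal n) {k : ℝ} {σ : Memory} (hn : σ.nat vN 0 = n)
    (he : σ.nat vExp 0 = 0) (hk : σ.num nK 0 = k) :
    Wp s findDim σ [] (1 + (cubeDim n k * ((1 + 1 + 1) + 1) + 1) + 1) fun σ' =>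
      σ'.nat vExp 0 = cubeDim n k ∧ σ'.nat vPow 0 = 2 ^ cubeDim n k := by
  refine Wp.seq_nil (Wp.setNat ?_)
  generalize hσ1 : Memory.writeNat σ _ _ _ = σ1
  have htest : ∀ σ' j, σ'.nat vN 0 = n → σ'.num nK 0 = (k : ℂ) → σ'.nat vPow 0 = 2 ^ j →
      ((Test.not (.numLE (.mul (.mul (.ofNat (.lit (2 ^ 26))) (.ofNat (.var vN)))
        (.npow (.get nK (.lit 0)) 8)) (.ofNat (.var vPow)))).Holds σ' ↔ j < cubeDim n k) := by
    intro σ' j h1 h2 h3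
    have e1 : NumExpr.eval σ' (.mul (.mul (.ofNat (.lit (2 ^ 26))) (.ofNat (.var vN)))
        (.npow (.get nK (.lit 0)) 8)) = ((2 ^ 26 * n * k ^ 8 : ℝ) : ℂ) := by
      rw [NumExpr.eval, NumExpr.eval, NumExpr.eval_npow, NumExpr.eval, NumExpr.eval, NumExpr.eval,
        NatExpr.eval, NatExpr.eval, NatExpr.eval, NatExpr.eval, h1, h2]
      norm_num
    have e2 : NumExpr.eval σ' (.ofNat (.var vPow)) = ((2 ^ j : ℝ) : ℂ) := by
      rw [NumExpr.eval, NatExpr.eval, NatExpr.eval, h3]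
      push_cast
      rfl
    rw [Test.Holds, Test.Holds, e1, e2, Complex.ofReal_re, Complex.ofReal_re, ← cubeDim_le_iff,
      not_le]
  have := Wp.loop (s := s) (σ := σ1) (B := 1 + 1 + 1)
    (b := .not (.numLE (.mul (.mul (.ofNat (.lit (2 ^ 26))) (.ofNat (.var vN)))
        (.npow (.get nK (.lit 0)) 8)) (.ofNat (.var vPow))))
    (p := .assign vPow (.add (.var vPow) (.var vPow)) ;; .assign vExp (.add (.var vExp) (.lit 1)))
    (fun j τ => τ.nat vExp 0 = j ∧ τ.nat vPow 0 = 2 ^ j) (cubeDim n k) (fun _ => [])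
    ⟨by simpa [← hσ1] using he, by simp [← hσ1, NatExpr.eval]⟩
    (fun j τ hj hF hI => ?_) (fun τ hF hI => ?_)
  · rwa [List.flatMap_eq_nil_iff.mpr fun _ _ => rfl] at this
  · refine ⟨(htest τ j (by rw [hF.nat vN rfl]; simpa [← hσ1] using hn)
      (by rw [hF.num nK rfl]; simpa [← hσ1] using hk) hI.2).mpr hj, ?_⟩
    obtain ⟨h1, h2⟩ := hI
    simp only [vExp, vPow] at h1 h2
    refine Wp.seq_nil (Wp.setNat (Wp.setNat ⟨?_, ?_⟩))
    · simp [NatExpr.eval, h1]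
    · simp [NatExpr.eval, h2, pow_succ, mul_two]
  · rw [htest τ _ (by rw [hF.nat vN rfl]; simpa [← hσ1] using hn)
      (by rw [hF.num nK rfl]; simpa [← hσ1] using hk) hI.2]
    exact lt_irrefl _

theorem wp_findLen {n : ℕ} (s : Signal n) {m : ℕ} {σ : Memory} (hn : σ.nat vN 0 = n)
    (he : σ.nat vExp 0 = m) (hl : σ.nat vLen 0 = 0) :
    Wp s findLen σ [] ((m + 1) * (1 + 3) + 3) fun σ' => σ'.nat vLen 0 = (m + 1) * (n + 1) := by
  refine Wp.for_nil (fun j τ => τ.nat vLen 0 = j * (n + 1)) (m + 1) rfl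
    (fun τ hF => by
      rw [NatExpr.eval, NatExpr.eval, NatExpr.eval, NatExpr.eval, hF.nat vExp rfl, he])
    (fun j τ v h => by simpa using h) (by simpa using hl) fun j τ hj hF hI h => Wp.setNat ?_
  have hn' : τ.nat vN 0 = n := by rw [hF.nat vN rfl]; exact hn
  simp only [vLen, vN] at h hn'
  simp [NatExpr.eval, h, hn']
  ring

theorem flatMap_take_drop {α : Type*} (L : ℕ) : ∀ (R : ℕ) (w : List α), w.length = R * L →
    ((List.range R).flatMap fun j => (w.drop (j * L)).take L) = w := by
  intro R
  induction R with
  | zero => intro w hw; simpa [eq_comm] using hw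
  | succ R ih =>
    intro w hw
    have hw' : (w.drop L).length = R * L := by rw [List.length_drop, hw, Nat.succ_mul]; omega
    rw [List.range_succ_eq_map, List.flatMap_cons, List.flatMap_map]
    have e : (fun j => List.take L (List.drop (Nat.succ j * L) w)) =
        fun j => ((w.drop L).drop (j * L)).take L := by
      funext j
      rw [List.drop_drop, Nat.succ_mul, Nat.add_comm]
    rw [e, ih _ hw', Nat.zero_mul, List.drop_zero, List.take_append_drop]

theorem wp_algorithm {n : ℕ} (s : Signal n) (c : ℕ) {k : ℝ} {w : List Bool}
    (hw : w.length = rounds c n k * trialLength n (cubeDim n k)) :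
    Wp s (algorithm c) (initial (algorithm c) n k).2 w (algorithmTime c n k) fun σ' =>
      σ'.out = (List.range (rounds c n k)).flatMap fun j =>
        encode (trialLabel s.ofLp k (cubeDim n k) ((w.drop (j * trialLength n (cubeDim n k))).take
          (trialLength n (cubeDim n k))) : Label n) := by
  set m := cubeDim n k with hm
  set L := trialLength n m with hL
  refine Wp.seq_nil ((wp_findDim s (n := n) (k := k) (by simp [initial]) (by simp [initial])
    (by simp [initial])).conseq fun σ1 hF1 h1 => ?_)
  refine Wp.seq_nil ((wp_findLen s (n := n) (m := m) (by rw [hF1.nat vN rfl]; simp [initial]) h1.1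
    (by rw [hF1.nat vLen rfl]; simp [initial])).conseq fun σ2 hF2 h2 => ?_)
  have r2 : Ready σ2 n m k := by
    refine ⟨?_, ?_, ?_, h2, ?_⟩
    · rw [hF2.nat vN rfl, hF1.nat vN rfl]; simp [initial]
    · rw [hF2.nat vExp rfl]; exact h1.1
    · rw [hF2.nat vPow rfl]; exact h1.2
    · rw [hF2.num nK rfl, hF1.num nK rfl]; simp [initial]
  have htest : ∀ σ' j, Ready σ' n m k → σ'.nat vRound 0 = j →
      ((Test.not (.numLE
        (.mul (.mul (.mul (.ofNat (.lit ((c + 3) * 1024))) (.ofNat (.var vN))) (.get nK (.lit 0)))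
        (.npow (.ofNat (.var vPow)) 7)) (.ofNat (.var vRound)))).Holds σ' ↔ j < rounds c n k) := by
    intro σ' j h1 h2
    have e1 : NumExpr.eval σ' (.mul (.mul (.mul (.ofNat (.lit ((c + 3) * 1024)))
        (.ofNat (.var vN))) (.get nK (.lit 0))) (.npow (.ofNat (.var vPow)) 7)) =
        ((((c + 3) * 1024 : ℕ) * n * k * (2 ^ m) ^ 7 : ℝ) : ℂ) := by
      rw [NumExpr.eval, NumExpr.eval, NumExpr.eval, NumExpr.eval_npow, NumExpr.eval, NumExpr.eval,
        NumExpr.eval, NumExpr.eval, NatExpr.eval, NatExpr.eval, NatExpr.eval, NatExpr.eval, h1.dim,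
        NatExpr.eval, h1.bound, NatExpr.eval, h1.pow]
      push_cast
      rfl
    have e2 : NumExpr.eval σ' (.ofNat (.var vRound)) = ((j : ℝ) : ℂ) := by
      rw [NumExpr.eval, NatExpr.eval, NatExpr.eval, h2]
      push_cast
      rfl
    rw [Test.Holds, Test.Holds, e1, e2, Complex.ofReal_re, Complex.ofReal_re, hm, ← rounds_le_iff,
      not_le]
  have key := Wp.loop (s := s) (σ := σ2) (B := trialTime n m + 1 + 1)
    (b := .not (.numLE
      (.mul (.mul (.mul (.ofNat (.lit ((c + 3) * 1024))) (.ofNat (.var vN))) (.get nK (.lit 0)))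
        (.npow (.ofNat (.var vPow)) 7)) (.ofNat (.var vRound))))
    (p := trial ;; .assign vRound (.add (.var vRound) (.lit 1)))
    (fun j τ => Ready τ n m k ∧ τ.nat vRound 0 = j ∧
    τ.out = (List.range j).flatMap fun j =>
      encode (trialLabel s.ofLp k m ((w.drop (j * L)).take L) : Label n)) (rounds c n k)
    (fun j => (w.drop (j * L)).take L) ⟨r2, ?_, ?_⟩ ?_ ?_
  · rw [flatMap_take_drop L _ w hw] at key
    exact key.conseq fun τ _ h => h.2.2
  · rw [hF2.nat vRound rfl, hF1.nat vRound rfl]; simp [initial]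
  · rw [hF2.out rfl, hF1.out rfl]; simp [initial]
  · rintro j τ hj hF ⟨hr, hj', ho⟩
    refine ⟨(htest τ j hr hj').mpr hj, ?_⟩
    have hlen : ((w.drop (j * L)).take L).length = trialLength n m := by
      have := Nat.mul_le_mul_right L (Nat.succ_le_of_lt hj)
      rw [Nat.succ_mul] at this
      rw [List.length_take, List.length_drop, hw]
      omega
    refine Wp.seq_last ((wp_trial s hr hlen).conseq fun τ1 hF1' h1' => Wp.setNat ?_)
    have hr1 := hr.of_frame hF1' rfl rfl rfl rfl rfl
    have hj1 : τ1.nat 4 0 = j := by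
      have := hF1'.nat vRound rfl
      simp only [vRound] at this hj'
      rw [this, hj']
    refine ⟨⟨?_, ?_, ?_, ?_, ?_⟩, ?_, ?_⟩
    · simpa using hr1.dim
    · simpa using hr1.exp
    · simpa using hr1.pow
    · simpa using hr1.len
    · simpa using hr1.bound
    · simp [NatExpr.eval, hj1]
    · rw [Memory.writeNat_out, h1', ho, List.range_succ, List.flatMap_append,
        List.flatMap_singleton]
  · rintro τ hF ⟨hr, hj', -⟩
    rw [htest τ _ hr hj']
    exact lt_irrefl _

/-! ### The running time -/

/-- By minimality, `2 ^ m` exceeds its lower bound at most by a factor of `2`. -/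
theorem two_pow_cubeDim_le {n : ℕ} (hn : 1 ≤ n) {k : ℝ} (hk : 1 ≤ k) :
    (2 : ℝ) ^ cubeDim n k ≤ 2 ^ 27 * n * k ^ 8 := by
  have hn1 : (1 : ℝ) ≤ n := by exact_mod_cast hn
  have hk8 : (1 : ℝ) ≤ k ^ 8 := one_le_pow₀ hk
  have hX : (1 : ℝ) < 2 ^ 26 * n * k ^ 8 := by
    calc (1 : ℝ) < 2 ^ 26 * 1 * 1 := by norm_num
      _ ≤ _ := by gcongr
  obtain ⟨j, hj⟩ : ∃ j, cubeDim n k = j + 1 := by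
    refine Nat.exists_eq_succ_of_ne_zero fun h => ?_
    have := cubeDim_le_iff.mp h.le
    rw [pow_zero] at this
    linarith
  have : ¬ cubeDim n k ≤ j := by omega
  rw [cubeDim_le_iff, not_le] at this
  rw [hj, pow_succ]
  linarith

theorem halfTime_le {n m Y : ℕ} (h1 : 1 ≤ Y) (hn : n ≤ Y) (hm : m ≤ Y) (hM : 2 ^ m ≤ Y) :
    halfTime n m ≤ 400 * Y ^ 4 := by
  have p0 : 1 ≤ Y ^ 4 := Nat.one_le_pow _ _ h1
  have p1 : Y ≤ Y ^ 4 := Nat.le_self_pow (by norm_num) Y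
  have p2 : Y ^ 2 ≤ Y ^ 4 := Nat.pow_le_pow_right h1 (by norm_num)
  have p3 : Y ^ 3 ≤ Y ^ 4 := Nat.pow_le_pow_right h1 (by norm_num)
  rw [halfTime]
  refine le_trans (b := (Y * 4 + 3) + ((Y * ((1 + 1 + 1) + 3) + 3) + ((Y * 4 + 3) +
    (((Y + 1) * (Y + 1) * 4 + 3) + ((Y * (Y * (8 * Y + 14) + 12) + 4 * Y + 17) +
      (((Y + 1) * (Y * (4 * Y + (8 * Y + 21) + 19) + 16) + 7) +
        ((Y * (Y * 6 + 12) + 6 * Y + 9) + (Y * (1 + 3) + 3) + 1) + 1) + 1) + 1) + 1) + 1) + 1)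
    (by gcongr) ?_
  ring_nf
  omega

theorem trialTime_le {n m Y : ℕ} (h1 : 1 ≤ Y) (hn : n ≤ Y) (hm : m ≤ Y) (hM : 2 ^ m ≤ Y) :
    trialTime n m ≤ 1200 * Y ^ 4 := by
  have p0 : 1 ≤ Y ^ 4 := Nat.one_le_pow _ _ h1
  have p1 : Y ≤ Y ^ 4 := Nat.le_self_pow (by norm_num) Y
  have p2 : Y ^ 2 ≤ Y ^ 4 := Nat.pow_le_pow_right h1 (by norm_num)
  have p3 : Y ^ 3 ≤ Y ^ 4 := Nat.pow_le_pow_right h1 (by norm_num)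
  have hh := halfTime_le h1 hn hm hM
  rw [trialTime]
  refine le_trans (b := (Y * 4 + 3) + (1 + (1 + (400 * Y ^ 4 + (400 * Y ^ 4 +
    (((Y + 1) * (Y + 1) * 4 + 3) + ((Y * (Y * (8 * Y + 14) + 12) + 4 * Y + 17) +
      (((Y + 1) * (Y * (4 * Y + (Y * (Y * 6 + 6) + 4 * Y + 15) + 19) + 16) + 7) +
        (Y * (Y * 4 + 6) + 4 * Y + 7) + 1) + 1) + 1) + 1) + 1) + 1) + 1) + 1)
    (by gcongr) ?_
  ring_nf
  omega

/-- A number that serves both as the constant factor and as the exponent of the time bound. -/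
def timeConstant (c : ℕ) : ℕ := (c + 4) * 2 ^ 320

set_option exponentiation.threshold 400 in
theorem algorithmTime_le (c : ℕ) {n : ℕ} (hn : 1 ≤ n) {k : ℝ} (hk : 1 ≤ k) :
    (algorithmTime c n k : ℝ) ≤ timeConstant c * (k * n) ^ timeConstant c := by
  have hn1 : (1 : ℝ) ≤ n := by exact_mod_cast hn
  have hk0 : 0 < k := by linarith
  set X := k * n with hX
  have hX1 : 1 ≤ X := one_le_mul_of_one_le_of_one_le hk hn1
  set m := cubeDim n k with hm
  set Y := n * 2 ^ m with hY
  have hM1 : 1 ≤ 2 ^ m := Nat.one_le_two_pow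
  have hY1 : 1 ≤ Y := Nat.mul_pos hn hM1
  have hnY : n ≤ Y := Nat.le_mul_of_pos_right n hM1
  have hMY : 2 ^ m ≤ Y := Nat.le_mul_of_pos_left _ hn
  have hmY : m ≤ Y := (Nat.lt_two_pow_self).le.trans hMY
  have hYr : (1 : ℝ) ≤ Y := by exact_mod_cast hY1
  have hYX : (Y : ℝ) ≤ 2 ^ 27 * X ^ 10 := by
    rw [hY]
    push_cast
    calc (n : ℝ) * 2 ^ m ≤ n * (2 ^ 27 * n * k ^ 8) := by
          gcongr; exact two_pow_cubeDim_le hn hk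
      _ = 2 ^ 27 * (n ^ 2 * k ^ 8) := by ring
      _ ≤ 2 ^ 27 * (n ^ 10 * k ^ 10) := by gcongr <;> first | assumption | norm_num
      _ = 2 ^ 27 * X ^ 10 := by rw [hX]; ring
  set R := rounds c n k with hR
  have hRle : (R : ℝ) ≤ ((c + 4) * 1024) * X * Y ^ 7 := by
    have h1 : (R : ℝ) ≤ ((c + 3) * 1024 : ℕ) * n * k * (2 ^ m) ^ 7 + 1 :=
      (Nat.ceil_lt_add_one (by positivity)).le
    have h2 : ((2 : ℝ) ^ m) ^ 7 ≤ Y ^ 7 := by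
      gcongr
      exact_mod_cast hMY
    have h3 : 1 ≤ X * Y ^ 7 := one_le_mul_of_one_le_of_one_le hX1 (one_le_pow₀ hYr)
    push_cast at h1
    calc (R : ℝ) ≤ (c + 3) * 1024 * n * k * (2 ^ m) ^ 7 + 1 := h1
      _ ≤ (c + 3) * 1024 * n * k * Y ^ 7 + X * Y ^ 7 := by gcongr
      _ = (c + 3) * 1024 * (X * Y ^ 7) + X * Y ^ 7 := by rw [hX]; ring
      _ ≤ ((c + 4) * 1024) * X * Y ^ 7 := by linarith
  have hT : (algorithmTime c n k : ℝ) ≤ 21 * Y + R * (1203 * Y ^ 4) := by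
    have : algorithmTime c n k ≤ 21 * Y + R * (1203 * Y ^ 4) := by
      have p0 : 1 ≤ Y ^ 4 := Nat.one_le_pow _ _ hY1
      have h1 : trialTime n m + 1 + 1 + 1 ≤ 1203 * Y ^ 4 := by
        have := trialTime_le hY1 hnY hmY hMY
        omega
      have h2 := Nat.mul_le_mul_left R h1
      rw [algorithmTime, ← hm, ← hR]
      omega
    exact_mod_cast this
  calc (algorithmTime c n k : ℝ) ≤ 21 * Y + R * (1203 * Y ^ 4) := hT
    _ ≤ 21 * (X * Y ^ 11) + (((c + 4) * 1024) * X * Y ^ 7) * (1203 * Y ^ 4) := by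
        gcongr
        calc (Y : ℝ) = 1 * Y ^ 1 := by ring
          _ ≤ X * Y ^ 11 := by gcongr; norm_num
    _ = (21 + (c + 4) * 1231872) * (X * Y ^ 11) := by ring
    _ ≤ ((c + 4) * 2 ^ 21) * (X * (2 ^ 27 * X ^ 10) ^ 11) := by
        gcongr
        have : (0 : ℝ) ≤ c := by positivity
        linarith
    _ = ((c + 4) * 2 ^ 318) * X ^ 111 := by ring
    _ ≤ ((c + 4) * 2 ^ 320) * X ^ timeConstant c := by
        gcongr
        · norm_num
        · norm_num
        · rw [timeConstant]
          calc 111 ≤ 1 * 2 ^ 320 := by norm_num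
            _ ≤ _ := Nat.mul_le_mul_right _ (by omega)
    _ = timeConstant c * X ^ timeConstant c := by rw [timeConstant]; push_cast; ring

/-! ### Correctness -/

theorem normSq_inner_codeword {n : ℕ} (s : Signal n) (P : Matrix (Fin n) (Fin n) (ZMod 2))
    (l : Fin n → ZMod 2) : ‖inner ℂ s (codeword P l)‖ ^ 2 =
      Complex.normSq (∑ y, s y * (starRingEnd ℂ) (phase P l y)) / 2 ^ n := by
  have e : inner ℂ s (codeword P l) = ((1 / Real.sqrt (2 ^ n) : ℝ) : ℂ) *
      (starRingEnd ℂ) (∑ y, s y * (starRingEnd ℂ) (phase P l y)) := by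
    rw [PiLp.inner_apply, map_sum, Finset.mul_sum]
    refine Finset.sum_congr rfl fun y _ => ?_
    rw [RCLike.inner_apply, map_mul, Complex.conj_conj, codeword, phase]
    ring
  rw [e, ← Complex.normSq_eq_norm_sq, Complex.normSq_mul, Complex.normSq_conj,
    Complex.normSq_ofReal, div_mul_div_comm, Real.mul_self_sqrt (by positivity)]
  ring

theorem norm_sq_eq_sum_normSq {n : ℕ} (s : Signal n) : ‖s‖ ^ 2 = ∑ y, Complex.normSq (s y) := by
  rw [EuclideanSpace.norm_sq_eq]
  exact Finset.sum_congr rfl fun y _ => (Complex.normSq_eq_norm_sq _).symm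

/-- The codeword has correlation at least `1 / k` with the signal. -/
def IsHeavy {n : ℕ} (k : ℝ) (s : Signal n) (x : Label n) : Prop :=
  1 / k * ‖s‖ ^ 2 ≤ ‖inner ℂ s (codeword x.1 x.2)‖ ^ 2

theorem IsHeavy.le_normSq_sum {n : ℕ} {k : ℝ} {s : Signal n} {x : Label n} (h : IsHeavy k s x) :
    2 ^ n * (∑ y, Complex.normSq (s y)) / k ≤
      Complex.normSq (∑ y, s y * (starRingEnd ℂ) (phase x.1 x.2 y)) := by
  rw [IsHeavy, normSq_inner_codeword, norm_sq_eq_sum_normSq, le_div_iff₀ (by positivity)] at h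
  calc _ = 1 / k * (∑ y, Complex.normSq (s y)) * 2 ^ n := by ring
    _ ≤ _ := h

/-- A Hankel matrix is determined by its first and its last row, so there are at most `2 ^ (3 n)`
labels of Hankel codewords. -/
theorem card_hankel_le {n : ℕ} (hn : 0 < n) {H : Finset (Label n)} (hH : ∀ x ∈ H, IsHankel x.1) :
    H.card ≤ 2 ^ (3 * n) := by
  classical
  let f : Label n → (Fin n → ZMod 2) × (Fin n → ZMod 2) × (Fin n → ZMod 2) := fun x =>
    (x.1 ⟨0, hn⟩, x.1 (Fin.rev ⟨0, hn⟩), x.2)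
  refine (Finset.card_le_card_of_injOn (t := Finset.univ) f (fun _ _ => Finset.mem_univ _)
    fun x hx y hy hxy => ?_).trans (le_of_eq ?_)
  · simp only [f, Prod.mk.injEq] at hxy
    refine Prod.ext ?_ hxy.2.2
    ext i j
    have hi := i.isLt
    have hj := j.isLt
    by_cases h : (i : ℕ) + j < n
    · have e : ∀ z ∈ H, z.1 i j = z.1 ⟨0, hn⟩ ⟨i + j, h⟩ := fun z hz => hH z hz _ _ _ _ (by simp)
      rw [e x hx, e y hy, hxy.1]
    · have e : ∀ z ∈ H, z.1 i j = z.1 (Fin.rev ⟨0, hn⟩) ⟨i + j - (n - 1), by omega⟩ :=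
        fun z hz => hH z hz _ _ _ _ (by simp; omega)
      rw [e x hx, e y hy, hxy.2.1]
  · rw [Finset.card_univ, Fintype.card_prod, Fintype.card_prod, Fintype.card_fun, ZMod.card,
      Fintype.card_fin]
    ring

/-- The success probability of a trial is at least `1 / (1024 k M ^ 7)`, where `M = 2 ^ m`. -/
theorem ofReal_le_coins_trialLabel_eq {n : ℕ} (hn : 1 ≤ n) {k : ℝ} (hk : 1 ≤ k) {s : Signal n}
    (hs : s ≠ 0) {x : Label n} (hx : IsHankel x.1) (hh : IsHeavy k s x) :
    ENNReal.ofReal (1 / (1024 * k * (2 ^ cubeDim n k) ^ 7)) ≤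
      (coins (trialLength n (cubeDim n k))).toOuterMeasure
        {w | trialLabel s.ofLp k (cubeDim n k) w = x} := by
  have hk0 : 0 < k := by linarith
  have hpos : 0 < ∑ y, Complex.normSq (s y) := by
    rw [← norm_sq_eq_sum_normSq]
    have := norm_pos_iff.mpr hs
    positivity
  refine le_trans (le_of_eq ?_) (le_coins_trialLabel_eq hn hk (cubeDim_le_iff.mp le_rfl) s.ofLp
    hpos hx x.2 hh.le_normSq_sum)
  have e : ∀ j : ℕ, ((2 : ℝ≥0∞) ^ j)⁻¹ = ENNReal.ofReal (((2 : ℝ) ^ j)⁻¹) := fun j => by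
    rw [ENNReal.ofReal_inv_of_pos (by positivity), ENNReal.ofReal_pow (by norm_num),
      ENNReal.ofReal_ofNat]
  simp only [e]
  rw [← ENNReal.ofReal_mul (by positivity), ← ENNReal.ofReal_mul (by positivity),
    ← ENNReal.ofReal_mul (by positivity), ← ENNReal.ofReal_mul (by positivity),
    ← ENNReal.ofReal_mul (by positivity), ← ENNReal.ofReal_mul (by positivity),
    ← ENNReal.ofReal_mul (by positivity)]
  congr 1
  rw [pow_add]
  field_simp
  norm_num

/-- Since `1 - q ≤ exp (-q)`, `R ≥ j / q` trials all fail with probability at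
most `2 ^ (-j)`. -/
theorem one_sub_pow_le {q : ℝ} (hq0 : 0 ≤ q) (hq1 : q ≤ 1) {R j : ℕ} (h : (j : ℝ) ≤ q * R) :
    (1 - ENNReal.ofReal q) ^ R ≤ ((2 : ℝ≥0∞) ^ j)⁻¹ := by
  have e : ((2 : ℝ≥0∞) ^ j)⁻¹ = ENNReal.ofReal (((2 : ℝ) ^ j)⁻¹) := by
    rw [ENNReal.ofReal_inv_of_pos (by positivity), ENNReal.ofReal_pow (by norm_num),
      ENNReal.ofReal_ofNat]
  rw [e, ← ENNReal.ofReal_one, ← ENNReal.ofReal_sub _ hq0, ← ENNReal.ofReal_pow (by linarith)]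
  refine ENNReal.ofReal_le_ofReal ?_
  calc (1 - q) ^ R ≤ Real.exp (-q) ^ R := by
        have := Real.add_one_le_exp (-q)
        exact pow_le_pow_left₀ (by linarith) (by linarith) R
    _ = Real.exp (-(q * R)) := by rw [← Real.exp_nat_mul]; ring_nf
    _ ≤ Real.exp (-j) := by gcongr
    _ = (Real.exp 1 ^ j)⁻¹ := by rw [Real.exp_neg, ← Real.exp_nat_mul, mul_one]
    _ ≤ ((2 : ℝ) ^ j)⁻¹ := by
        have := Real.add_one_le_exp (1 : ℝ)
        gcongr
        linarith

/-- The label found in the `j`-th trial. -/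
noncomputable def roundLabel {n : ℕ} (s : Signal n) (k : ℝ) (w : List Bool) (j : ℕ) : Label n :=
  trialLabel s.ofLp k (cubeDim n k)
    ((w.drop (j * trialLength n (cubeDim n k))).take (trialLength n (cubeDim n k)))

theorem isCorrectOutput_of_forall {n : ℕ} {k : ℝ} {s : Signal n} {w : List Bool} {R : ℕ}
    (h : ∀ x : Label n, IsHankel x.1 → IsHeavy k s x → ∃ j < R, roundLabel s k w j = x) :
    IsCorrectOutput k s ((List.range R).flatMap fun j => encode (roundLabel s k w j)) := by
  refine ⟨(List.range R).map (roundLabel s k w), by rw [List.flatMap_map], fun x hx => ?_,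
    fun P l hP hc => ?_⟩
  · obtain ⟨j, -, rfl⟩ := List.mem_map.mp hx
    exact isHankel_hankelOf _ _ _
  · obtain ⟨j, hj, hx⟩ := h (P, l) hP hc
    exact List.mem_map.mpr ⟨j, List.mem_range.mpr hj, hx⟩

/-- The probability that some label of a heavy Hankel codeword is missed by all trials: a union
bound over all labels. -/
theorem coins_exists_missed_le {n : ℕ} (hn : 1 ≤ n) (c : ℕ) {k : ℝ} (hk : 1 ≤ k) {s : Signal n}
    (hs : s ≠ 0) :
    (coins (rounds c n k * trialLength n (cubeDim n k))).toOuterMeasure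
      {w | ∃ x : Label n, IsHankel x.1 ∧ IsHeavy k s x ∧
        ∀ j < rounds c n k, roundLabel s k w j ≠ x} ≤ ((2 : ℝ≥0∞) ^ n)⁻¹ ^ c := by
  classical
  set L := trialLength n (cubeDim n k) with hL
  set R := rounds c n k with hR
  set q : ℝ := 1 / (1024 * k * (2 ^ cubeDim n k) ^ 7) with hq
  set H : Finset (Label n) := Finset.univ.filter fun x => IsHankel x.1 ∧ IsHeavy k s x with hH
  have hk0 : 0 < k := by linarith
  have hden : 1 ≤ 1024 * k * (2 ^ cubeDim n k) ^ 7 := by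
    have h1 : (1 : ℝ) ≤ (2 ^ cubeDim n k) ^ 7 := one_le_pow₀ (one_le_pow₀ (by norm_num))
    calc (1 : ℝ) ≤ 1024 * 1 * 1 := by norm_num
      _ ≤ _ := by gcongr
  have hqR : (((c + 3) * n : ℕ) : ℝ) ≤ q * R := by
    have := rounds_le_iff.mp (le_refl (rounds c n k))
    rw [hq, div_mul_eq_mul_div, one_mul, le_div_iff₀ (by positivity)]
    push_cast at this ⊢
    linarith
  have hone : ∀ x ∈ H, (coins (R * L)).toOuterMeasure {w | ∀ j < R, roundLabel s k w j ≠ x} ≤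
      ((2 : ℝ≥0∞) ^ ((c + 3) * n))⁻¹ := by
    intro x hx
    obtain ⟨-, hx1, hx2⟩ := Finset.mem_filter.mp hx
    exact (coins_all_fail_le (ofReal_le_coins_trialLabel_eq hn hk hs hx1 hx2) R).trans
      (one_sub_pow_le (by positivity) (by rw [div_le_one (by positivity)]; exact hden) hqR)
  have hsub : {w | ∃ x : Label n, IsHankel x.1 ∧ IsHeavy k s x ∧
      ∀ j < R, roundLabel s k w j ≠ x} = ⋃ x ∈ H, {w | ∀ j < R, roundLabel s k w j ≠ x} := by
    ext w
    simp [hH, and_assoc]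
  rw [hsub]
  refine (MeasureTheory.measure_biUnion_finset_le H _).trans
    ((Finset.sum_le_card_nsmul H _ _ hone).trans ?_)
  have hcard : (H.card : ℝ≥0∞) ≤ 2 ^ (3 * n) := by
    have : H.card ≤ 2 ^ (3 * n) := card_hankel_le hn fun x hx => (Finset.mem_filter.mp hx).2.1
    exact_mod_cast this
  rw [nsmul_eq_mul]
  calc (H.card : ℝ≥0∞) * (2 ^ ((c + 3) * n))⁻¹ ≤ 2 ^ (3 * n) * (2 ^ ((c + 3) * n))⁻¹ := by gcongr
    _ = (2 ^ (n * c))⁻¹ := by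
        rw [show (c + 3) * n = 3 * n + n * c by ring, pow_add,
          ENNReal.mul_inv (Or.inl (by simp)) (Or.inl (by simp)), ← mul_assoc,
          ENNReal.mul_inv_cancel (by simp) (by simp), one_mul]
    _ = (2 ^ n)⁻¹ ^ c := by rw [pow_mul, ENNReal.inv_pow]

/-- On a sufficiently long tape the program halts in time, and only the first part of the tape
matters. -/
theorem iterate_algorithm {n : ℕ} (s : Signal n) (c : ℕ) (k : ℝ) {w : List Bool}
    (hw : rounds c n k * trialLength n (cubeDim n k) ≤ w.length) :
    ∃ σ, ((tapeStep s)^[algorithmTime c n k] (initial (algorithm c) n k, w)).1 = ([], σ) ∧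
      σ.out = (List.range (rounds c n k)).flatMap fun j => encode (roundLabel s k
        (w.take (rounds c n k * trialLength n (cubeDim n k))) j) := by
  obtain ⟨σ, T, hT, hE, ho⟩ := wp_algorithm s c (k := k)
    (w := w.take (rounds c n k * trialLength n (cubeDim n k))) (List.length_take_of_le hw)
  refine ⟨σ, ?_, ho⟩
  have h := hE.iterate [] (w.drop (rounds c n k * trialLength n (cubeDim n k)))
  rw [List.take_append_drop] at h
  obtain ⟨U, hU⟩ := Nat.exists_eq_add_of_le' hT
  rw [hU, Function.iterate_add_apply]
  have e : initial (algorithm c) n k = ([algorithm c], (initial (algorithm c) n k).2) := rfl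
  rw [e, h, tapeStep_halted]

theorem run_algorithm {n : ℕ} (s : Signal n) (c : ℕ) (k : ℝ) :
    run s (algorithmTime c n k) (initial (algorithm c) n k) =
      (coins (rounds c n k * trialLength n (cubeDim n k) + algorithmTime c n k)).map fun w =>
        ((tapeStep s)^[algorithmTime c n k] (initial (algorithm c) n k, w)).1 :=
  run_eq_map_coins s _ _ _ (Nat.le_add_left _ _)

theorem haltsWithin_algorithm {n : ℕ} (s : Signal n) (c : ℕ) (k : ℝ) :
    HaltsWithin (algorithm c) k s (algorithmTime c n k) := by
  intro z hz
  rw [run_algorithm, PMF.mem_support_map_iff] at hz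
  obtain ⟨w, hw, rfl⟩ := hz
  obtain ⟨σ, h, -⟩ := iterate_algorithm s c k (w := w) (by
    rw [length_of_mem_support_coins hw]
    exact Nat.le_add_right _ _)
  rw [h]

theorem failureProbability_algorithm_le {n : ℕ} (hn : 1 ≤ n) (c : ℕ) {k : ℝ} (hk : 1 ≤ k)
    {s : Signal n} (hs : s ≠ 0) :
    failureProbability (algorithm c) k s (algorithmTime c n k) ≤ ((2 : ℝ≥0∞) ^ n)⁻¹ ^ c := by
  rw [failureProbability, run_algorithm, PMF.toOuterMeasure_map_apply]
  have hmissed := coins_exists_missed_le hn c hk hs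
  have hiter := fun w => iterate_algorithm s c k (w := w)
  generalize algorithmTime c n k = T at hiter ⊢
  generalize hK : rounds c n k * trialLength n (cubeDim n k) = K at hmissed hiter ⊢
  set B := {w | ∃ x : Label n, IsHankel x.1 ∧ IsHeavy k s x ∧
    ∀ j < rounds c n k, roundLabel s k w j ≠ x} with hB
  have hone : (coins T).toOuterMeasure Set.univ ≤ 1 := by
    rw [← Set.compl_empty, coins_compl]
    exact tsub_le_self
  have hB' : (coins (K + T)).toOuterMeasure {w | w.take K ∈ B ∧ w.drop K ∈ Set.univ} ≤
      ((2 : ℝ≥0∞) ^ n)⁻¹ ^ c := by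
    refine (coins_add_le_mul B Set.univ).trans ?_
    rw [← mul_one (((2 : ℝ≥0∞) ^ n)⁻¹ ^ c)]
    exact mul_le_mul' hmissed hone
  refine le_trans (PMF.toOuterMeasure_mono _ ?_) hB'
  rintro w ⟨hw, hsupp⟩
  refine ⟨?_, Set.mem_univ _⟩
  by_contra hcon
  obtain ⟨σ, h, ho⟩ := hiter w (by
    rw [length_of_mem_support_coins hsupp]
    exact Nat.le_add_right _ _)
  rw [Set.mem_preimage, Set.mem_ofPred_eq, h, ho] at hw
  refine hw (?_ : _)
  refine isCorrectOutput_of_forall fun x hx1 hx2 => ?_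
  by_contra hno
  push Not at hno
  exact hcon ⟨x, hx1, hx2, hno⟩

end HankelDecoding

theorem mainTheorem1 (c : ℕ) :
    ∃ (A : Program) (C : ℕ), ∀ (n : ℕ) (k : ℝ), 1 ≤ n → 1 ≤ k →
      ∃ T : ℕ, (T : ℝ) ≤ C * (k * n) ^ C ∧
        ∀ s : Signal n,
          HaltsWithin A k s T ∧
          (s ≠ 0 → failureProbability A k s T ≤ ((2 : ℝ≥0∞) ^ n)⁻¹ ^ c) :=
  ⟨algorithm c, timeConstant c, fun n k hn hk => ⟨algorithmTime c n k, algorithmTime_le c hn hk,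
    fun s => ⟨haltsWithin_algorithm s c k, failureProbability_algorithm_le hn c hk⟩⟩⟩
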